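/- \textbf{Theorem (Weil's descent theorem).} Let $k$ be a field of characteristic $0$, let $K\supset k$ be an algebraically closed field of infinite transcendence degree over $k$, and let $Y$ be a quasi-projective scheme over $K$ (that is, $Y$ is isomorphic over $K$ to a locally closed subscheme of some $\mathbb{P}^n_K$). For $\sigma\in\mathrm{Aut}(K/k)$ let ${}^{\sigma}Y$ denote the base change of $Y$ along $\operatorname{Spec}\sigma:\operatorname{Spec}K\to\operatorname{Spec}K$. A \emph{descent datum} for $Y$ from $K$ to $k$ is a family of isomorphisms of $K$-schemes $\varphi_\sigma:{}^{\sigma}Y\xrightarrow{\sim}Y$, $\sigma\in\mathrm{Aut}(K/k)$, with $\varphi_{\sigma\tau}=\varphi_\sigma\circ{}^{\sigma}\varphi_\tau$ for all $\sigma,\tau$. It defines an action of $\mathrm{Aut}(K/k)$ on the rational functions on $Y$ by $\sigma(f)={}^{\sigma}(\varphi_{\sigma^{-1}}^{*}(f))$. Here a rational function on $Y$ is a regular function on a schematically dense open subset of $Y$, two such being identified if they agree on a schematically dense open subset; an open $U\subset Y$ is schematically dense if $\Gamma(V,\mathcal O_Y)\to\Gamma(V\cap U,\mathcal O_Y)$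 is injective for every open $V\subset Y$ (for reduced $Y$ this just means dense). The descent datum is \emph{continuous} if for every rational function $f$ on $Y$ there is a subfield $k\subset L\subset K$, finitely generated over $k$, such that $f$ is invariant under $\mathrm{Aut}(K/L)$. For a $k$-scheme $X$, the $K$-scheme $X\times_kK$ carries a natural descent datum, in which ${}^{\sigma}(X\times_kK)\to X\times_kK$ is the canonical isomorphism. One says that $\{\varphi_\sigma\}$ \emph{comes from} $X$ if there is an isomorphism of $K$-schemes $X\times_kK\cong Y$ carrying the natural descent datum to $\{\varphi_\sigma\}$, and that $\{\varphi_\sigma\}$ is \emph{effective} if it comes from some $k$-scheme $X$. Then every continuous descent datum for $Y$ from $K$ to $k$ is effective. Moreover, every $k$-scheme $X$ from which it comes is quasi-projective over $k$; $X$ is affine if $Y$ is affine, and $X$ is quasi-affine if $Y$ is quasi-affine. -/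

import Mathlib

open CategoryTheory Limits AlgebraicGeometry TopologicalSpace

universe u

namespace WeilDescent

noncomputable section

/-! ### Quasi-projective schemes over a field -/

attribute [local instance] MvPolynomial.gradedAlgebra

/-- Projective `n`-space over a field `F`: `Proj F[x₀, …, xₙ]` with its structure morphism
to `Spec F`. -/
def projectiveSpace (F : Type u) [Field F] (n : ℕ) : Over (Spec (CommRingCat.of F)) :=
  Over.mk (Y := Proj (MvPolynomial.homogeneousSubmodule (Fin (n + 1)) F))
    (Proj.toSpecZero (MvPolynomial.homogeneousSubmodule (Fin (n + 1)) F) ≫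
      Spec.map (CommRingCat.ofHom
        (algebraMap F (MvPolynomial.homogeneousSubmodule (Fin (n + 1)) F 0))))

/-- An `F`-scheme is quasi-projective if it is isomorphic, over `F`, to a locally closed
subscheme of some projective space `ℙⁿ` over `F`. -/
def IsQuasiProjective {F : Type u} [Field F] (Y : Over (Spec (CommRingCat.of F))) : Prop :=
  ∃ (n : ℕ) (i : Y ⟶ projectiveSpace F n), IsImmersion i.left

/-! ### Rational functions on a scheme -/

/-- An open subset `U` is schematically dense if for every open `V` the restriction
`Γ(V) → Γ(V ∩ U)` is injective. (On a reduced scheme this is the same as being dense.) -/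
def IsSchematicallyDense {X : Scheme.{u}} (U : X.Opens) : Prop :=
  ∀ V : X.Opens, Function.Injective
    (X.presheaf.map (homOfLE (inf_le_left : V ⊓ U ≤ V)).op)

theorem IsSchematicallyDense.inf {X : Scheme.{u}} {U V : X.Opens}
    (hU : IsSchematicallyDense U) (hV : IsSchematicallyDense V) :
    IsSchematicallyDense (U ⊓ V) := by
  intro W s t h
  apply hU W
  apply hV (W ⊓ U)
  have e : (W ⊓ U) ⊓ V ≤ W ⊓ (U ⊓ V) := by rw [inf_assoc]
  have h' := congrArg (X.presheaf.map (homOfLE e).op) h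
  rw [← ConcreteCategory.comp_apply, ← ConcreteCategory.comp_apply, ← Functor.map_comp] at h'
  rw [← ConcreteCategory.comp_apply, ← ConcreteCategory.comp_apply, ← Functor.map_comp]
  exact h'

theorem IsSchematicallyDense.preimage {X Y : Scheme.{u}} (e : X ≅ Y) {U : Y.Opens}
    (hU : IsSchematicallyDense U) : IsSchematicallyDense (e.hom ⁻¹ᵁ U) := by
  intro V
  obtain ⟨W, rfl⟩ : ∃ W : Y.Opens, V = e.hom ⁻¹ᵁ W :=
    ⟨e.inv ⁻¹ᵁ V, by rw [← Scheme.Hom.comp_preimage]; simp⟩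
  intro s t h
  have hb : Function.Bijective (e.hom.app W) := ConcreteCategory.bijective_of_isIso (e.hom.app W)
  have hb' : Function.Bijective (e.hom.app (W ⊓ U)) :=
    ConcreteCategory.bijective_of_isIso (e.hom.app (W ⊓ U))
  obtain ⟨s, rfl⟩ := hb.2 s
  obtain ⟨t, rfl⟩ := hb.2 t
  congr 1
  apply hU W
  apply hb'.1
  have n := e.hom.naturality (homOfLE (inf_le_left : W ⊓ U ≤ W)).op
  have ns := ConcreteCategory.congr_hom n s
  have nt := ConcreteCategory.congr_hom n t
  rw [ConcreteCategory.comp_apply, ConcreteCategory.comp_apply] at ns nt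
  exact ns.trans (Eq.trans h nt.symm)

/-- A function defined on a schematically dense open subset of `X`. -/
structure PartialFunction (X : Scheme.{u}) where
  domain : X.Opens
  dense : IsSchematicallyDense domain
  val : Γ(X, domain)

/-- Two partial functions are equivalent if they agree on a schematically dense open subset. -/
def PartialFunction.Equiv {X : Scheme.{u}} (f g : PartialFunction X) : Prop :=
  ∃ (W : X.Opens) (_ : IsSchematicallyDense W) (hf : W ≤ f.domain) (hg : W ≤ g.domain),
    X.presheaf.map (homOfLE hf).op f.val = X.presheaf.map (homOfLE hg).op g.val

instance PartialFunction.setoid (X : Scheme.{u}) : Setoid (PartialFunction X) where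
  r := PartialFunction.Equiv
  iseqv :=
    { refl := fun f => ⟨f.domain, f.dense, le_rfl, le_rfl, rfl⟩
      symm := fun ⟨W, hW, hf, hg, h⟩ => ⟨W, hW, hg, hf, h.symm⟩
      trans := by
        rintro f g l ⟨W, hW, hf, hg, h⟩ ⟨W', hW', hg', hl, h'⟩
        refine ⟨W ⊓ W', hW.inf hW', inf_le_left.trans hf, inf_le_right.trans hl, ?_⟩
        have a := congrArg (X.presheaf.map (homOfLE (inf_le_left : W ⊓ W' ≤ W)).op) h
        have b := congrArg (X.presheaf.map (homOfLE (inf_le_right : W ⊓ W' ≤ W')).op) h'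
        simp only [← ConcreteCategory.comp_apply, ← Functor.map_comp] at a b
        exact a.trans b }

/-- The set of rational functions on a scheme: functions on schematically dense open subsets,
up to agreement on a schematically dense open subset. -/
def RationalFunction (X : Scheme.{u}) : Type u := Quotient (PartialFunction.setoid X)

/-- Pull-back of a partial function along an isomorphism of schemes. -/
def PartialFunction.pullback {X Y : Scheme.{u}} (e : X ≅ Y) (f : PartialFunction Y) :
    PartialFunction X where
  domain := e.hom ⁻¹ᵁ f.domain
  dense := f.dense.preimage e
  val := e.hom.app f.domain f.val

/-- Pull-back of rational functions along an isomorphism of schemes. -/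
def RationalFunction.pullback {X Y : Scheme.{u}} (e : X ≅ Y) :
    RationalFunction Y → RationalFunction X :=
  Quotient.map (PartialFunction.pullback e) (by
    rintro f g ⟨W, hW, hf, hg, h⟩
    refine ⟨e.hom ⁻¹ᵁ W, hW.preimage e, fun x hx => hf hx, fun x hx => hg hx, ?_⟩
    have nf := ConcreteCategory.congr_hom (e.hom.naturality (homOfLE hf).op) f.val
    have ng := ConcreteCategory.congr_hom (e.hom.naturality (homOfLE hg).op) g.val
    rw [ConcreteCategory.comp_apply, ConcreteCategory.comp_apply] at nf ng
    exact nf.symm.trans ((congrArg (e.hom.app W) h).trans ng))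

/-! ### Descent data -/

section Conjugation

variable {k K : Type u} [Field k] [Field K] [Algebra k K]

/-- The morphism `Spec K ⟶ Spec K` given by the ring homomorphism `σ : K → K`. -/
abbrev specAut (σ : K ≃ₐ[k] K) : Spec (CommRingCat.of K) ⟶ Spec (CommRingCat.of K) :=
  Spec.map (CommRingCat.ofHom (σ : K →+* K))

theorem specAut_mul (σ τ : K ≃ₐ[k] K) : specAut (σ * τ) = specAut σ ≫ specAut τ := by
  rw [← Spec.map_comp, ← CommRingCat.ofHom_comp]
  rfl

theorem specAut_one : specAut (1 : K ≃ₐ[k] K) = 𝟙 _ := by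
  have : CommRingCat.ofHom ((1 : K ≃ₐ[k] K) : K →+* K) = 𝟙 (CommRingCat.of K) := rfl
  rw [specAut, this, Spec.map_id]

/-- The conjugate `^σY` of a `K`-scheme `Y`, i.e. its base change along `Spec σ`. As `Spec σ`
is an isomorphism, this is realised as the same scheme `Y` with structure morphism
composed with `(Spec σ)⁻¹ = Spec σ⁻¹`; see `conj_isPullback`. -/
def conj (σ : K ≃ₐ[k] K) : Over (Spec (CommRingCat.of K)) ⥤ Over (Spec (CommRingCat.of K)) :=
  Over.map (specAut σ⁻¹)

/-- The projection `^σY ⟶ Y`, an isomorphism of schemes lying over `Spec σ`. -/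
def conjLeft (σ : K ≃ₐ[k] K) (Y : Over (Spec (CommRingCat.of K))) :
    ((conj σ).obj Y).left ≅ Y.left :=
  Iso.refl Y.left

theorem conj_hom (σ : K ≃ₐ[k] K) (Y : Over (Spec (CommRingCat.of K))) :
    ((conj σ).obj Y).hom = (conjLeft σ Y).hom ≫ Y.hom ≫ specAut σ⁻¹ :=
  (Category.id_comp _).symm

/-- `^σY` is the fibre product of `Y` with `Spec K` along `Spec σ : Spec K ⟶ Spec K`. -/
theorem conj_isPullback (σ : K ≃ₐ[k] K) (Y : Over (Spec (CommRingCat.of K))) :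
    IsPullback (conjLeft σ Y).hom ((conj σ).obj Y).hom Y.hom (specAut σ) := by
  have h : specAut σ⁻¹ ≫ specAut σ = 𝟙 _ := by
    rw [← specAut_mul, inv_mul_cancel, specAut_one]
  have h' : specAut σ ≫ specAut σ⁻¹ = 𝟙 _ := by
    rw [← specAut_mul, mul_inv_cancel, specAut_one]
  have : IsIso (specAut σ) := ⟨_, h', h⟩
  exact IsPullback.of_horiz_isIso ⟨by rw [conj_hom, Category.assoc, Category.assoc, h,
    Category.comp_id]⟩

/-- The canonical identification of `^(στ)Y` with `^σ(^τY)`, compatible with the projections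
to `Y`. -/
def conjMul (σ τ : K ≃ₐ[k] K) (Y : Over (Spec (CommRingCat.of K))) :
    (conj (σ * τ)).obj Y ≅ (conj σ).obj ((conj τ).obj Y) :=
  Over.isoMk (conjLeft (σ * τ) Y ≪≫ (conjLeft τ Y).symm ≪≫ (conjLeft σ ((conj τ).obj Y)).symm) (by
    rw [conj_hom σ, conj_hom τ, conj_hom (σ * τ), mul_inv_rev, specAut_mul]
    simp)

end Conjugation

/-- A descent datum for the `K`-scheme `Y` from `K` to `k`: isomorphisms `φ_σ : ^σY ⟶ Y` of
`K`-schemes for `σ ∈ Aut(K/k)` such that `φ_{στ} = φ_σ ∘ ^σφ_τ`. -/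
structure DescentDatum (k : Type u) {K : Type u} [Field k] [Field K] [Algebra k K]
    (Y : Over (Spec (CommRingCat.of K))) where
  iso : ∀ σ : K ≃ₐ[k] K, (conj σ).obj Y ≅ Y
  cocycle : ∀ σ τ : K ≃ₐ[k] K,
    (iso (σ * τ)).hom = (conjMul σ τ Y).hom ≫ (conj σ).map (iso τ).hom ≫ (iso σ).hom

namespace DescentDatum

variable {k K : Type u} [Field k] [Field K] [Algebra k K] {Y : Over (Spec (CommRingCat.of K))}

/-- The isomorphism of schemes `Y ⟶ Y` obtained by composing the inverse of the projection
`^σY ⟶ Y` with `φ_σ`; it gives the action of `σ` on points, `y ↦ φ_σ(^σy)`. -/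
def schemeIso (φ : DescentDatum k Y) (σ : K ≃ₐ[k] K) : Y.left ≅ Y.left :=
  (conjLeft σ Y).symm ≪≫
    Functor.mapIso (X := (conj σ).obj Y) (Y := Y) (Over.forget _) (φ.iso σ)

/-- The action of `σ ∈ Aut(K/k)` on rational functions, `σ(f) = ^σ(φ_{σ⁻¹}^* f)`. Conjugation
by `σ` of a rational function on `^(σ⁻¹)Y` is its transport along the canonical isomorphism
`Y = ^σ(^(σ⁻¹)Y) ⟶ ^(σ⁻¹)Y`, the inverse of the projection `^(σ⁻¹)Y ⟶ Y`. -/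
def act (φ : DescentDatum k Y) (σ : K ≃ₐ[k] K) (f : RationalFunction Y.left) :
    RationalFunction Y.left :=
  RationalFunction.pullback (φ.schemeIso σ⁻¹) f

/-- The rational function `f` is defined over `L` if it is invariant under `Aut(K/L)`. -/
def IsDefinedOver (φ : DescentDatum k Y) (L : IntermediateField k K)
    (f : RationalFunction Y.left) : Prop :=
  ∀ σ ∈ L.fixingSubgroup, φ.act σ f = f

/-- A descent datum is continuous if every rational function is defined over an
intermediate field that is finitely generated over `k`. -/
def IsContinuous (φ : DescentDatum k Y) : Prop :=
  ∀ f : RationalFunction Y.left, ∃ L : IntermediateField k K, L.FG ∧ φ.IsDefinedOver L f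

/-- The base change `X_K = X ×_k K` of a `k`-scheme. -/
abbrev baseChange (K : Type u) [Field K] [Algebra k K] (X : Over (Spec (CommRingCat.of k))) :
    Over (Spec (CommRingCat.of K)) :=
  (Over.pullback (Spec.map (CommRingCat.ofHom (algebraMap k K)))).obj X

/-- The morphism `id_X × Spec σ` from `X ×_k K` to itself. -/
def baseChangeAut (X : Over (Spec (CommRingCat.of k))) (σ : K ≃ₐ[k] K) :
    (baseChange K X).left ⟶ (baseChange K X).left :=
  pullback.lift (pullback.fst _ _) (pullback.snd _ _ ≫ specAut σ) (by
    have h : specAut σ ≫ Spec.map (CommRingCat.ofHom (algebraMap k K)) =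
        Spec.map (CommRingCat.ofHom (algebraMap k K)) := by
      rw [← Spec.map_comp, ← CommRingCat.ofHom_comp]
      congr 2
      exact σ.toAlgHom.comp_algebraMap
    rw [Category.assoc, h, pullback.condition])

@[simp]
theorem baseChangeAut_fst (X : Over (Spec (CommRingCat.of k))) (σ : K ≃ₐ[k] K) :
    baseChangeAut X σ ≫ pullback.fst _ _ = pullback.fst _ _ :=
  pullback.lift_fst _ _ _

@[simp]
theorem baseChangeAut_snd (X : Over (Spec (CommRingCat.of k))) (σ : K ≃ₐ[k] K) :
    baseChangeAut X σ ≫ pullback.snd _ _ = pullback.snd _ _ ≫ specAut σ :=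
  pullback.lift_snd _ _ _

theorem baseChangeAut_mul (X : Over (Spec (CommRingCat.of k))) (σ τ : K ≃ₐ[k] K) :
    baseChangeAut X (σ * τ) = baseChangeAut X σ ≫ baseChangeAut X τ := by
  apply pullback.hom_ext
  · rw [Category.assoc, baseChangeAut_fst, baseChangeAut_fst, baseChangeAut_fst]
  · rw [Category.assoc, baseChangeAut_snd, baseChangeAut_snd, ← Category.assoc,
      baseChangeAut_snd, Category.assoc, specAut_mul]

theorem baseChangeAut_one (X : Over (Spec (CommRingCat.of k))) :
    baseChangeAut X (1 : K ≃ₐ[k] K) = 𝟙 _ := by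
  apply pullback.hom_ext
  · rw [baseChangeAut_fst, Category.id_comp]
  · rw [baseChangeAut_snd, specAut_one, Category.comp_id, Category.id_comp]

/-- `baseChangeAut` as an isomorphism. -/
def baseChangeIso (X : Over (Spec (CommRingCat.of k))) (σ : K ≃ₐ[k] K) :
    (baseChange K X).left ≅ (baseChange K X).left where
  hom := baseChangeAut X σ
  inv := baseChangeAut X σ⁻¹
  hom_inv_id := by rw [← baseChangeAut_mul, mul_inv_cancel, baseChangeAut_one]
  inv_hom_id := by rw [← baseChangeAut_mul, inv_mul_cancel, baseChangeAut_one]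

/-- The natural descent datum on `X ×_k K`: the isomorphism `^σ(X ×_k K) ⟶ X ×_k K` of
`K`-schemes is the projection `^σ(X ×_k K) ⟶ X ×_k K` followed by `id_X × Spec σ⁻¹`. -/
def ofBaseChange (K : Type u) [Field K] [Algebra k K] (X : Over (Spec (CommRingCat.of k))) :
    DescentDatum k (baseChange K X) where
  iso σ := Over.isoMk (conjLeft σ (baseChange K X) ≪≫ baseChangeIso X σ⁻¹) (by
    rw [conj_hom, Iso.trans_hom, Category.assoc]
    exact congrArg _ (baseChangeAut_snd X σ⁻¹))
  cocycle σ τ := by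
    ext1
    change 𝟙 _ ≫ baseChangeAut X (σ * τ)⁻¹ =
      (𝟙 _ ≫ 𝟙 _ ≫ 𝟙 _) ≫ (𝟙 _ ≫ baseChangeAut X τ⁻¹) ≫ 𝟙 _ ≫ baseChangeAut X σ⁻¹
    simp only [Category.id_comp]
    rw [mul_inv_rev, baseChangeAut_mul]

/-- The descent datum `φ` on `Y` comes from the `k`-scheme `X`: there is an isomorphism of
`K`-schemes `X ×_k K ≅ Y` carrying the natural descent datum on `X ×_k K` to `φ`. -/
def ComesFrom (φ : DescentDatum k Y) (X : Over (Spec (CommRingCat.of k))) : Prop :=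
  ∃ e : baseChange K X ≅ Y, ∀ σ : K ≃ₐ[k] K,
    ((ofBaseChange K X).iso σ).hom ≫ e.hom = (conj σ).map e.hom ≫ (φ.iso σ).hom

/-- A descent datum is effective if it comes from some `k`-scheme. -/
def IsEffective (φ : DescentDatum k Y) : Prop :=
  ∃ X : Over (Spec (CommRingCat.of k)), φ.ComesFrom X

end DescentDatum

end

end WeilDescent

open CategoryTheory Limits AlgebraicGeometry TopologicalSpace

set_option linter.unusedSectionVars false

namespace WeilDescent

/-! ### Automorphisms of an algebraically closed field over a subfield -/

section FieldTheory

/-! A descent datum is a semilinear action of `Aut(K/k)` on `Y`, and a model over a field `F`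
between `k` and `K` is an invariant map `π : Y ⟶ X` that exhibits `Y` as `X ×_F K`. Because `K` is
algebraically closed, `Aut(K/F)` has fixed field `F` and acts transitively on the roots of an
irreducible polynomial and on the elements transcendental over `F`. The conjugates of an `F`-basis
of `K` are therefore independent in the strong sense of `eq_zero_of_sum_mul_algEquiv_eq_zero`. This
replaces finite Galois theory: invariant functions on `Y` are linearly disjoint from `K`, and
invariant morphisms to separated schemes descend to any model (`exists_desc`).

Morphisms to projective space are taken over the small field, since a morphism `Y ⟶ ℙ_k` is a system
of ratios of functions and can be invariant under a semilinear action. Suppose that there is an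
invariant affine morphism `i` to a projective space and that the rings of functions on the preimages
of its charts are generated over `K` by invariant functions. After passing to powers of the
coordinates, the generators become further coordinates (`exists_hom_extending`), and the
scheme-theoretic image of `Y` in the relevant charts of `ℙ_F` is a quasi-projective model
(`exists_isModel_of_closure_eq`).

Continuity makes such an `i` and such generators invariant over some `k(S)` with `S` finite, because
a morphism to projective space is determined by finitely many rational functions (`exists_isGood`).
The elements of `S` are then removed one at a time. Let `E = F(x)`, with an affine morphism and a
model over `E`. The conjugate of the morphism by `σ` depends only on `σ x`. If `x` is algebraic over
`F`, the product of the finitely many conjugates, a norm, is affine and invariant over `F`. If `x`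
is transcendental, the generic conjugate spreads out to a family over `E[X, 1/f]`, and its
specialization at a point `t₀` of `F` with `f(t₀) ≠ 0` is affine and invariant over `F`. Given this
morphism, the functions on the preimages of its charts are spanned over `K` by functions fixed by
the stabilizer of `x`, namely those from the model over `E`; `span_fixed_eq_top` shows that they are
spanned by functions fixed by all of `Aut(K/F)`, which gives the model over `F`. Infinite
transcendence degree supplies parameters that are generic over any given finitely generated field.

Any `X` from which the datum comes is a model, hence isomorphic to the constructed one. Affineness
and quasi-affineness descend along the faithfully flat map `π` through `X ⟶ Spec Γ(X)`. -/

theorem nonempty_algEquiv_of_trdeg_eq {E K L : Type u} [Field E] [Field K] [Field L]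
    [IsAlgClosed K] [IsAlgClosed L] [Algebra E K] [Algebra E L]
    (h : Algebra.trdeg E K = Algebra.trdeg E L) : Nonempty (K ≃ₐ[E] L) := by
  obtain ⟨s, v, hv⟩ := exists_isTranscendenceBasis' E K
  obtain ⟨t, w, hw⟩ := exists_isTranscendenceBasis' E L
  have hst : Cardinal.mk s = Cardinal.mk t := by
    rw [hv.cardinalMk_eq_trdeg, hw.cardinalMk_eq_trdeg, h]
  obtain ⟨e⟩ := Cardinal.eq.mp hst
  -- Both fields are algebraic closures of the polynomial rings on their transcendence bases, so a
  -- bijection of the bases extends to an isomorphism.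
  let _ := IsAlgClosed.isAlgClosure_of_transcendence_basis v hv
  let _ := IsAlgClosed.isAlgClosure_of_transcendence_basis w hw
  let f : Algebra.adjoin E (Set.range v) ≃ₐ[E] Algebra.adjoin E (Set.range w) :=
    hv.1.aevalEquiv.symm.trans ((MvPolynomial.renameEquiv E e).trans hw.1.aevalEquiv)
  refine ⟨AlgEquiv.ofRingEquiv (f := IsAlgClosure.equivOfEquiv K L f.toRingEquiv) fun c => ?_⟩
  have := IsAlgClosure.equivOfEquiv_algebraMap K L f.toRingEquiv (algebraMap E _ c)
  rw [← IsScalarTower.algebraMap_apply] at this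
  rw [this]
  change algebraMap _ L (f _) = _
  rw [f.commutes, ← IsScalarTower.algebraMap_apply]

open scoped IntermediateField.algebraAdjoinAdjoin in
theorem trdeg_lt_aleph0_of_fg {F K : Type u} [Field F] [Field K] [Algebra F K]
    {E : IntermediateField F K} (hE : E.FG) : Algebra.trdeg F E < Cardinal.aleph0 := by
  obtain ⟨S, rfl⟩ := hE
  have h1 : Algebra.FiniteType F (Algebra.adjoin F (S : Set K)) :=
    (Algebra.adjoin F (S : Set K)).fg_iff_finiteType.mp ⟨S, rfl⟩
  have h2 : Algebra.IsAlgebraic (Algebra.adjoin F (S : Set K))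
      (IntermediateField.adjoin F (S : Set K)) :=
    IsLocalization.isAlgebraic (R := Algebra.adjoin F (S : Set K))
      (S := IntermediateField.adjoin F (S : Set K)) (nonZeroDivisors _)
  rw [← trdeg_add_eq F (Algebra.adjoin F (S : Set K)),
    trdeg_eq_zero (R := Algebra.adjoin F (S : Set K))
      (A := IntermediateField.adjoin F (S : Set K)), add_zero]
  exact trdeg_lt_aleph0_of_finiteType

theorem fg_adjoin_simple (F : Type u) {K : Type u} [Field F] [Field K] [Algebra F K] (a : K) :
    (IntermediateField.adjoin F {a}).FG := ⟨{a}, by simp⟩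

/-- Transcendence degrees add in towers and the finite contribution of `E` can be cancelled, so `K`
and `L` have the same transcendence degree over `E`. -/
theorem exists_algEquiv_extending_aux {F E K L : Type u} [Field F] [Field E] [Field K] [Field L]
    [IsAlgClosed K] [IsAlgClosed L] [Algebra F E] [Algebra F K] [Algebra F L] [Algebra E K]
    [Algebra E L] [IsScalarTower F E K] [IsScalarTower F E L]
    (hE : Algebra.trdeg F E < Cardinal.aleph0) (h : Algebra.trdeg F K = Algebra.trdeg F L) :
    ∃ σ : K ≃ₐ[F] L, ∀ c : E, σ (algebraMap E K c) = algebraMap E L c := by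
  rw [← trdeg_add_eq F E (A := K), ← trdeg_add_eq F E (A := L)] at h
  obtain ⟨e⟩ := nonempty_algEquiv_of_trdeg_eq (Cardinal.eq_of_add_eq_add_left h hE)
  exact ⟨e.restrictScalars F, e.commutes⟩

variable {F K : Type u} [Field F] [Field K] [Algebra F K] [IsAlgClosed K]

/-- The field `K` is regarded as an extension of `F(a)` in two ways, by inclusion and by `i`. No
hypothesis on the size of `K` is needed, as `F(a)` has finite transcendence degree over `F`. -/
theorem exists_algEquiv_extending {a : K} (i : IntermediateField.adjoin F {a} →ₐ[F] K) :
    ∃ σ : K ≃ₐ[F] K, ∀ c : IntermediateField.adjoin F {a}, σ c = i c :=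
  @exists_algEquiv_extending_aux F (IntermediateField.adjoin F {a}) K K _ _ _ _ _ _ _ _ _ _
    i.toRingHom.toAlgebra _ (@IsScalarTower.of_algebraMap_eq _ _ _ _ _ _ _ i.toRingHom.toAlgebra _
      fun c => (i.commutes c).symm) (trdeg_lt_aleph0_of_fg (fg_adjoin_simple F a)) rfl

theorem exists_algEquiv_apply_eq_of_isAlgebraic {a b : K} (ha : IsAlgebraic F a)
    (hb : Polynomial.aeval b (minpoly F a) = 0) : ∃ σ : K ≃ₐ[F] K, σ a = b := by
  obtain ⟨σ, hσ⟩ := exists_algEquiv_extending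
    ((IntermediateField.algHomAdjoinIntegralEquiv F ha.isIntegral).symm
      ⟨b, Polynomial.mem_aroots.mpr ⟨minpoly.ne_zero ha.isIntegral, hb⟩⟩)
  exact ⟨σ, (hσ (IntermediateField.AdjoinSimple.gen F a)).trans
    (IntermediateField.algHomAdjoinIntegralEquiv_symm_apply_gen F ha.isIntegral _)⟩

theorem exists_algEquiv_apply_eq_of_transcendental
    {a b : K} (ha : Transcendental F a) (hb : Transcendental F b) : ∃ σ : K ≃ₐ[F] K, σ a = b := by
  obtain ⟨σ, hσ⟩ := exists_algEquiv_extending ((IntermediateField.val _).comp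
    ((RatFunc.algEquivOfTranscendental a ha).symm.trans
      (RatFunc.algEquivOfTranscendental b hb)).toAlgHom)
  refine ⟨σ, (hσ (IntermediateField.AdjoinSimple.gen F a)).trans ?_⟩
  simp

/-- If `a` were fixed, transitivity on the roots would leave `a` as the only root of its separable
minimal polynomial, which would then be linear. -/
theorem exists_algEquiv_apply_ne_of_isAlgebraic [CharZero F] {a : K} (ha : IsAlgebraic F a)
    (ha' : a ∉ (algebraMap F K).range) : ∃ σ : K ≃ₐ[F] K, σ a ≠ a := by
  by_contra! h
  have h1 : (minpoly F a).aroots K ≤ {a} := by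
    rw [Multiset.le_iff_subset
      (Polynomial.nodup_aroots_iff_of_splits (minpoly.ne_zero ha.isIntegral)
      (IsAlgClosed.splits _) |>.mpr (minpoly.irreducible ha.isIntegral).separable)]
    intro b hb
    obtain ⟨σ, hσ⟩ := exists_algEquiv_apply_eq_of_isAlgebraic ha (Polynomial.mem_aroots.mp hb).2
    simp [← hσ, h σ]
  have h2 := Multiset.card_le_card h1
  rw [Polynomial.aroots_def, ← (IsAlgClosed.splits _).natDegree_eq_card_roots,
    Polynomial.natDegree_map, Multiset.card_singleton] at h2
  exact ha' (minpoly.mem_range_of_degree_eq_one F a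
    ((Polynomial.degree_eq_iff_natDegree_eq_of_pos one_pos).mpr
      (le_antisymm h2 (minpoly.natDegree_pos ha.isIntegral))))

/-- A transcendental `a` is moved, for instance to `a + 1`, and an algebraic one outside `F` is
moved to another conjugate. -/
theorem mem_range_algebraMap_of_fixed [CharZero F] {a : K} (ha : ∀ σ : K ≃ₐ[F] K, σ a = a) :
    a ∈ (algebraMap F K).range := by
  by_cases h : IsAlgebraic F a
  · by_contra ha'
    obtain ⟨σ, hσ⟩ := exists_algEquiv_apply_ne_of_isAlgebraic h ha'
    exact hσ (ha σ)
  · have : CharZero K := charZero_of_injective_algebraMap (algebraMap F K).injective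
    obtain ⟨σ, hσ⟩ := exists_algEquiv_apply_eq_of_transcendental (b := a + 1) h (by
      intro h'
      exact h (by simpa using h'.sub isAlgebraic_one))
    rw [ha σ] at hσ
    simp at hσ

theorem aleph0_le_trdeg_of_fg {F K : Type u} [Field F] [Field K] [Algebra F K]
    (htr : Cardinal.aleph0 ≤ Algebra.trdeg F K) {E : IntermediateField F K} (hE : E.FG) :
    Cardinal.aleph0 ≤ Algebra.trdeg E K := by
  rw [← trdeg_add_eq F E] at htr
  by_contra! h
  exact absurd htr (Cardinal.add_lt_aleph0 (trdeg_lt_aleph0_of_fg hE) h).not_ge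

theorem exists_transcendental_of_fg {F K : Type u} [Field F] [Field K] [Algebra F K]
    (htr : Cardinal.aleph0 ≤ Algebra.trdeg F K) {E : IntermediateField F K} (hE : E.FG) :
    ∃ a : K, Transcendental E a := by
  have h0 := aleph0_le_trdeg_of_fg htr hE
  by_contra! h
  have : Algebra.IsAlgebraic E K := ⟨fun a => not_not.mp (h a)⟩
  rw [trdeg_eq_zero] at h0
  exact absurd h0 (by simp [Cardinal.aleph0_ne_zero])

theorem transcendental_add_natCast {E K : Type u} [Field E] [Field K] [Algebra E K]
    {a : K} (ha : Transcendental E a) (n : ℕ) : Transcendental E (a + n) := by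
  intro h
  exact ha (by simpa using h.sub (isAlgebraic_algebraMap (A := K) (n : E)))

theorem transcendental_of_le {F K : Type u} [Field F] [Field K] [Algebra F K]
    {E E' : IntermediateField F K} (h : E ≤ E') {a : K} (ha : Transcendental E' a) :
    Transcendental E a := by
  intro h'
  obtain ⟨p, hp, hpa⟩ := h'
  refine ha ⟨p.map (IntermediateField.inclusion h).toRingHom, ?_, ?_⟩
  · rwa [Polynomial.map_ne_zero_iff (IntermediateField.inclusion h).toRingHom.injective]
  · rw [Polynomial.aeval_def, Polynomial.eval₂_map]
    exact hpa

theorem transcendental_apply_of_map {F K : Type u} [Field F] [Field K] [Algebra F K]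
    {E : IntermediateField F K} (τ : K ≃ₐ[F] K) {a : K}
    (ha : Transcendental (E.map τ.toAlgHom) a) : Transcendental E (τ.symm a) := by
  intro h'
  obtain ⟨p, hp, hpa⟩ := h'
  refine ha ⟨p.map (E.intermediateFieldMap τ).toRingEquiv.toRingHom, ?_, ?_⟩
  · rwa [Polynomial.map_ne_zero_iff (E.intermediateFieldMap τ).injective]
  · rw [Polynomial.aeval_def, Polynomial.eval₂_map]
    have h := congrArg (τ : K →+* K) hpa
    rw [map_zero, Polynomial.aeval_def, Polynomial.hom_eval₂] at h
    have ha' : (τ : K →+* K) (τ.symm a) = a := τ.apply_symm_apply a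
    rw [ha'] at h
    exact h

end FieldTheory

/-! ### Semilinear representations and their fixed vectors -/

section Semilinear

open Polynomial

/-- Fixed vectors of a semilinear action that are linearly independent over the fixed field
are linearly independent. -/
theorem linearIndependent_of_fixed {F K V G ι : Type*} [Field F] [Field K] [Algebra F K]
    [AddCommGroup V] [Module K V] [Module F V] [IsScalarTower F K V]
    (ρ : G → V →+ V) (s : G → K → K) (hs1 : ∀ g, s g 1 = 1)
    (hfix : ∀ a : K, (∀ g, s g a = a) → a ∈ (algebraMap F K).range)
    (hρ : ∀ g (c : K) v, ρ g (c • v) = s g c • ρ g v)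
    (v : ι → V) (hv : ∀ g i, ρ g (v i) = v i) (hind : LinearIndependent F v) :
    LinearIndependent K v := by
  classical
  rw [linearIndependent_iff'] at hind ⊢
  intro t
  induction t using Finset.induction_on with
  | empty => simp
  | insert j t hj ih =>
    intro c hc i hi
    by_cases hcj : c j = 0
    · rw [Finset.sum_insert hj, hcj, zero_smul, zero_add] at hc
      rcases Finset.mem_insert.1 hi with rfl | hi
      · exact hcj
      · exact ih c hc i hi
    · exfalso
      -- With the coefficient at `j` normalised to `1`, subtracting the relation from its transform
      -- under `g` leaves a relation on `t`. By induction the remaining coefficients are fixed, so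
      -- the relation is defined over `F`.
      let d : ι → K := fun i => (c j)⁻¹ * c i
      have hdj : d j = 1 := inv_mul_cancel₀ hcj
      have hd : ∑ i ∈ insert j t, d i • v i = 0 := by
        have := congrArg (fun w => (c j)⁻¹ • w) hc
        simpa only [Finset.smul_sum, smul_smul, smul_zero] using this
      have key : ∀ g, ∀ i ∈ t, s g (d i) = d i := by
        intro g
        have h2 : ∑ i ∈ insert j t, s g (d i) • v i = 0 := by
          have := congrArg (ρ g) hd
          simpa only [map_sum, hρ, hv, map_zero] using this
        rw [Finset.sum_insert hj] at hd h2
        rw [hdj, hs1] at h2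
        rw [hdj] at hd
        have h3 : ∑ i ∈ t, (s g (d i) - d i) • v i = 0 := by
          simp only [sub_smul, Finset.sum_sub_distrib]
          rw [eq_neg_of_add_eq_zero_right h2, eq_neg_of_add_eq_zero_right hd, sub_self]
        intro i hi
        exact sub_eq_zero.1 (ih _ h3 i hi)
      have hmem : ∀ i ∈ insert j t, ∃ a : F, algebraMap F K a = d i := by
        intro i hi
        apply hfix
        intro g
        rcases Finset.mem_insert.1 hi with rfl | hi
        · rw [hdj, hs1]
        · exact key g i hi
      choose! a ha using hmem
      have h4 : ∑ i ∈ insert j t, a i • v i = 0 := by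
        rw [← hd]
        refine Finset.sum_congr rfl fun i hi => ?_
        rw [← ha i hi, algebraMap_smul]
      have h5 := hind _ a h4 j (Finset.mem_insert_self _ _)
      have h6 := ha j (Finset.mem_insert_self _ _)
      rw [h5, map_zero, hdj] at h6
      exact zero_ne_one h6

/-- Independence of the conjugates: if the `b i` are linearly independent over `F` and
`∑ i, a i * σ (b i) = 0` for all `σ`, then `a = 0`. -/
theorem eq_zero_of_sum_mul_algEquiv_eq_zero {F K ι : Type*} [Field F] [Field K] [Algebra F K]
    (hfix : ∀ a : K, (∀ σ : K ≃ₐ[F] K, σ a = a) → a ∈ (algebraMap F K).range)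
    (b : ι → K) (hb : LinearIndependent F b) (t : Finset ι) (a : ι → K)
    (h : ∀ σ : K ≃ₐ[F] K, ∑ i ∈ t, a i * σ (b i) = 0) : ∀ i ∈ t, a i = 0 := by
  -- Twisted action on `K`-valued functions on the group: `(τ f)(σ) = τ (f (τ⁻¹ σ))`. The functions
  -- `σ ↦ σ (b i)` are fixed by it, and evaluation at `σ = 1` shows that they are independent over
  -- `F`.
  let ρ : (K ≃ₐ[F] K) → ((K ≃ₐ[F] K) → K) →+ ((K ≃ₐ[F] K) → K) := fun τ =>
    { toFun := fun f σ => τ (f (τ⁻¹ * σ))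
      map_zero' := by ext; simp
      map_add' := by intros; ext; simp }
  have key := linearIndependent_of_fixed (F := F) (K := K) ρ (fun τ => τ)
    (fun τ => map_one τ) hfix (fun τ c f => by ext σ; simp [ρ])
    (fun i σ => σ (b i)) (fun τ i => by
      ext σ
      change τ ((τ⁻¹ * σ) (b i)) = σ (b i)
      rw [← AlgEquiv.mul_apply, mul_inv_cancel_left]) (by
      rw [linearIndependent_iff'] at hb ⊢
      intro s c hc i hi
      refine hb s c ?_ i hi
      have := congrFun hc 1
      simpa using this)
  rw [linearIndependent_iff'] at key
  refine key t a ?_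
  ext σ
  simpa using h σ

variable {F K V : Type u} [Field F] [CharZero F] [Field K] [IsAlgClosed K] [Algebra F K]
  [AddCommGroup V] [Module K V]

theorem apply_mul_apply (ρ : (K ≃ₐ[F] K) →* AddMonoid.End V) (σ τ : K ≃ₐ[F] K) (v : V) :
    ρ (σ * τ) v = ρ σ (ρ τ v) := by
  rw [map_mul]; rfl

/-- The conjugates of `v` form a finite family `w y` indexed by the roots `y` of the minimal
polynomial of `x`. The sums `∑ y ^ m • w y` are fixed, and Lagrange interpolation recovers `v = w x`
from them. -/
theorem span_fixed_of_isAlgebraic (ρ : (K ≃ₐ[F] K) →* AddMonoid.End V)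
    (hρ : ∀ σ (c : K) v, ρ σ (c • v) = σ c • ρ σ v) {x : K} (hx : IsAlgebraic F x)
    {v : V} (hv : ∀ σ : K ≃ₐ[F] K, σ x = x → ρ σ v = v) :
    v ∈ Submodule.span K {w : V | ∀ σ, ρ σ w = w} := by
  classical
  let R : Finset K := ((minpoly F x).aroots K).toFinset
  have hR : ∀ y, y ∈ R ↔ aeval y (minpoly F x) = 0 := by
    intro y
    simp [R, minpoly.ne_zero hx.isIntegral]
  have hex : ∀ y, y ∈ R → ∃ σ : K ≃ₐ[F] K, σ x = y := fun y hy =>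
    exists_algEquiv_apply_eq_of_isAlgebraic hx ((hR y).1 hy)
  choose! s hs using hex
  have hxR : x ∈ R := (hR x).2 (minpoly.aeval F x)
  let w : K → V := fun y => ρ (s y) v
  have hw : ∀ σ : K ≃ₐ[F] K, σ x ∈ R → ρ σ v = w (σ x) := by
    intro σ h
    have h1 : ρ ((s (σ x))⁻¹ * σ) v = v := hv _ (by
      rw [AlgEquiv.mul_apply, AlgEquiv.aut_inv, AlgEquiv.symm_apply_eq, hs _ h])
    have h2 := congrArg (ρ (s (σ x))) h1
    rwa [← apply_mul_apply, mul_inv_cancel_left] at h2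
  have hRσ : ∀ (σ : K ≃ₐ[F] K) y, y ∈ R → σ y ∈ R := by
    intro σ y hy
    rw [hR] at hy ⊢
    have : aeval (σ.toAlgHom y) (minpoly F x) = _ := aeval_algHom_apply σ.toAlgHom y _
    exact this.trans (by rw [hy, map_zero])
  have hτ : ∀ (τ : K ≃ₐ[F] K) y, y ∈ R → ρ τ (w y) = w (τ y) := by
    intro τ y hy
    have h := hs y hy
    have := hw (τ * s y) (by rw [AlgEquiv.mul_apply, h]; exact hRσ τ y hy)
    rw [AlgEquiv.mul_apply, h, map_mul] at this
    exact this
  let u : ℕ → V := fun m => ∑ y ∈ R, y ^ m • w y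
  have hu : ∀ m τ, ρ τ (u m) = u m := by
    intro m τ
    simp only [u, map_sum, hρ, map_pow]
    rw [Finset.sum_congr rfl fun y hy => by rw [hτ τ y hy]]
    refine Finset.sum_nbij' (fun y => τ y) (fun y => τ⁻¹ y) (hRσ τ) (hRσ τ⁻¹) ?_ ?_ ?_
    · intro y _; rw [← AlgEquiv.mul_apply]; simp
    · intro y _; rw [← AlgEquiv.mul_apply]; simp
    · intro y _; rfl
  -- A polynomial with value `1` at `x` and `0` at the other roots: weighting the fixed vectors `u
  -- m` by its coefficients isolates `w x = v`.
  let B := Lagrange.basis R id x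
  have hB : v = ∑ m ∈ B.support, B.coeff m • u m := by
    have h1 : ∀ y ∈ R, (∑ m ∈ B.support, (B.coeff m * y ^ m)) • w y =
        if y = x then v else 0 := by
      intro y hy
      have h2 : ∑ m ∈ B.support, (B.coeff m * y ^ m) = B.eval y := by
        rw [eval_eq_sum, Polynomial.sum]
      rw [h2]
      split_ifs with hyx
      · subst hyx
        have h3 : B.eval y = 1 := Lagrange.eval_basis_self (v := id) (fun _ _ _ _ h => h) hy
        rw [h3, one_smul]
        have := hw 1 (by simpa using hy)
        rw [map_one] at this
        exact this.symm
      · have := Lagrange.eval_basis_of_ne (s := R) (v := id) (i := x) (j := y) (Ne.symm hyx) hy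
        rw [id] at this
        rw [this, zero_smul]
    simp only [u, Finset.smul_sum, smul_smul]
    rw [Finset.sum_comm]
    simp only [← Finset.sum_smul]
    rw [Finset.sum_congr rfl h1, Finset.sum_ite_eq' R x, if_pos hxR]
  rw [hB]
  exact Submodule.sum_mem _ fun m _ => Submodule.smul_mem _ _ (Submodule.subset_span (hu m))

theorem exists_common_denominator {E L ι : Type*} [Field E] [Field L] [Algebra E L] {y : L}
    (hy : Transcendental E y) (t : Finset ι) (c : ι → L)
    (hc : ∀ i ∈ t, c i ∈ IntermediateField.adjoin E {y}) :
    ∃ (q : E[X]) (r : ι → E[X]), q ≠ 0 ∧ ∀ i ∈ t, aeval y q * c i = aeval y (r i) := by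
  classical
  induction t using Finset.induction_on with
  | empty => exact ⟨1, 0, one_ne_zero, by simp⟩
  | insert j t hj ih =>
    obtain ⟨q, r, hq, h⟩ := ih fun i hi => hc i (Finset.mem_insert_of_mem hi)
    obtain ⟨a, b, hab⟩ := IntermediateField.mem_adjoin_simple_iff E (c j) |>.1
      (hc j (Finset.mem_insert_self _ _))
    -- The membership criterion allows the denominator `b = 0`, in which case the quotient `c j` is
    -- `0` by convention.
    by_cases hb : b = 0
    · refine ⟨q, fun i => if i = j then 0 else r i, hq, fun i hi => ?_⟩
      dsimp only
      split_ifs with hij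
      · rw [hij, hab, hb]; simp
      · exact h i ((Finset.mem_insert.1 hi).resolve_left hij)
    · have hby : aeval y b ≠ 0 := fun h0 => hb ((transcendental_iff.1 hy) b h0)
      refine ⟨q * b, fun i => if i = j then q * a else b * r i, mul_ne_zero hq hb, fun i hi => ?_⟩
      dsimp only
      split_ifs with hij
      · rw [hij, hab, map_mul, map_mul]; field_simp
      · rw [map_mul, map_mul, ← h i ((Finset.mem_insert.1 hi).resolve_left hij)]; ring

/-- Evaluation of a polynomial with coefficients in a vector space. -/
noncomputable def evalVec (y : K) : (ℕ →₀ V) →ₗ[K] V :=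
  Finsupp.lsum K fun m => y ^ m • LinearMap.id

theorem evalVec_apply (y : K) (W : ℕ →₀ V) : evalVec y W = W.sum fun m w => y ^ m • w := rfl

/-- Linear functionals on `V` turn `W` into ordinary polynomials with infinitely many roots. -/
theorem eq_zero_of_evalVec_eq_zero {S : Set K} (hS : S.Infinite) (W : ℕ →₀ V)
    (h : ∀ y ∈ S, evalVec y W = 0) : W = 0 := by
  ext m
  rw [Finsupp.zero_apply, ← Module.forall_dual_apply_eq_zero_iff K]
  intro l
  let p : K[X] := ∑ m ∈ W.support, monomial m (l (W m))
  have hp : p = 0 := by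
    refine eq_zero_of_infinite_isRoot p (hS.mono fun y hy => ?_)
    have := congrArg l (h y hy)
    rw [evalVec_apply, Finsupp.sum, map_sum, map_zero] at this
    change p.eval y = 0
    rw [← this, eval_finsetSum]
    refine Finset.sum_congr rfl fun m _ => ?_
    rw [eval_monomial, map_smul, smul_eq_mul, mul_comm]
  have h1 : p.coeff m = l (W m) := by
    simp only [p, finsetSum_coeff, coeff_monomial]
    rw [Finset.sum_ite_eq']
    split_ifs with hm
    · rfl
    · rw [Finsupp.notMem_support_iff.1 hm, map_zero]
  rw [← h1, hp, coeff_zero]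

theorem map_evalVec (ρ : (K ≃ₐ[F] K) →* AddMonoid.End V)
    (hρ : ∀ σ (c : K) v, ρ σ (c • v) = σ c • ρ σ v) (τ : K ≃ₐ[F] K) (y : K) (W : ℕ →₀ V) :
    ρ τ (evalVec y W) = evalVec (τ y) (W.mapRange (ρ τ) (map_zero _)) := by
  rw [evalVec_apply, evalVec_apply, Finsupp.sum_mapRange_index (by simp), Finsupp.sum, Finsupp.sum,
    map_sum]
  exact Finset.sum_congr rfl fun m _ => by rw [hρ, map_pow]

/-- The conjugates `ρ σ v` of a vector are given by a rational function of `σ x`. -/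
def IsRationalIn (ρ : (K ≃ₐ[F] K) →* AddMonoid.End V) (x : K) (v : V) (q : K[X])
    (W : ℕ →₀ V) : Prop :=
  ∃ E : IntermediateField F K, E.FG ∧ ∀ σ : K ≃ₐ[F] K, Transcendental E (σ x) →
    q.eval (σ x) • ρ σ v = evalVec (σ x) W

theorem IsRationalIn.sub {ρ : (K ≃ₐ[F] K) →* AddMonoid.End V} {x : K} {v : V} {q q' : K[X]}
    {W W' : ℕ →₀ V} (h : IsRationalIn ρ x v q W) (h' : IsRationalIn ρ x v q' W') :
    IsRationalIn ρ x v (q - q') (W - W') := by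
  obtain ⟨E, hE, h⟩ := h
  obtain ⟨E', hE', h'⟩ := h'
  refine ⟨E ⊔ E', IntermediateField.fg_sup hE hE', fun σ hσ => ?_⟩
  rw [eval_sub, sub_smul, map_sub, h σ (transcendental_of_le le_sup_left hσ),
    h' σ (transcendental_of_le le_sup_right hσ)]

theorem IsRationalIn.smul {ρ : (K ≃ₐ[F] K) →* AddMonoid.End V} {x : K} {v : V} {q : K[X]}
    {W : ℕ →₀ V} (h : IsRationalIn ρ x v q W) (c : K) :
    IsRationalIn ρ x v (C c * q) (c • W) := by
  obtain ⟨E, hE, h⟩ := h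
  refine ⟨E, hE, fun σ hσ => ?_⟩
  rw [eval_mul, eval_C, mul_smul, h σ hσ, map_smul]

theorem fg_map {E : IntermediateField F K} (hE : E.FG) (τ : K ≃ₐ[F] K) :
    (E.map τ.toAlgHom).FG := by
  classical
  obtain ⟨s, rfl⟩ := hE
  rw [IntermediateField.adjoin_map]
  exact IntermediateField.fg_adjoin_of_finite (s.finite_toSet.image _)

/-- Apply `τ` to the relation for `τ⁻¹ * σ`. The field of exceptional parameters is replaced by its
image under `τ`, which is why `IsRationalIn` leaves this field unspecified. -/
theorem IsRationalIn.map {ρ : (K ≃ₐ[F] K) →* AddMonoid.End V}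
    (hρ : ∀ σ (c : K) v, ρ σ (c • v) = σ c • ρ σ v) {x : K} {v : V} {q : K[X]}
    {W : ℕ →₀ V} (h : IsRationalIn ρ x v q W) (τ : K ≃ₐ[F] K) :
    IsRationalIn ρ x v (q.map (τ : K →+* K)) (W.mapRange (ρ τ) (map_zero _)) := by
  obtain ⟨E, hE, h⟩ := h
  refine ⟨E.map τ.toAlgHom, fg_map hE τ, fun σ hσ => ?_⟩
  have h1 := h (τ⁻¹ * σ) (transcendental_apply_of_map τ hσ)
  have h2 : τ ((τ⁻¹ * σ) x) = σ x := by
    rw [← AlgEquiv.mul_apply, mul_inv_cancel_left]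
  have h3 := congrArg (ρ τ) h1
  rw [hρ, map_evalVec ρ hρ, h2, ← apply_mul_apply, mul_inv_cancel_left] at h3
  rw [← h3]
  congr 1
  have h4 : (q.map (τ : K →+* K)).eval ((τ : K →+* K) ((τ⁻¹ * σ) x)) = _ :=
    eval_map_apply (τ : K →+* K) ((τ⁻¹ * σ) x)
  exact (congrArg (fun y => (q.map (τ : K →+* K)).eval y) h2.symm).trans h4

/-- In a basis of vectors fixed by the stabilizer of `x`, the conjugate of `v` belonging to a
generic parameter `y` has coordinates fixed by `Aut(K/F(x)(y))`. They are rational functions of `y`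
over `F(x)`. Clearing denominators at `y` settles every other generic parameter, because
`Aut(K/F(x))` permutes these transitively and fixes the basis. -/
theorem exists_isRationalIn (htr : Cardinal.aleph0 ≤ Algebra.trdeg F K)
    (ρ : (K ≃ₐ[F] K) →* AddMonoid.End V)
    (hρ : ∀ σ (c : K) v, ρ σ (c • v) = σ c • ρ σ v) {x : K}
    (htop : Submodule.span K {v : V | ∀ σ : K ≃ₐ[F] K, σ x = x → ρ σ v = v} = ⊤)
    (hx : Transcendental F x) {v : V} (hv : ∀ σ : K ≃ₐ[F] K, σ x = x → ρ σ v = v) :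
    ∃ (q : K[X]) (W : ℕ →₀ V), q ≠ 0 ∧ IsRationalIn ρ x v q W := by
  classical
  obtain ⟨B, hBsub, hBspan, hBind⟩ := exists_linearIndependent K
    {v : V | ∀ σ : K ≃ₐ[F] K, σ x = x → ρ σ v = v}
  let E := IntermediateField.adjoin F {x}
  have hE : E.FG := by
    simpa using IntermediateField.fg_adjoin_finset (F := F) ({x} : Finset K)
  have hxE : x ∈ E := IntermediateField.mem_adjoin_simple_self F x
  obtain ⟨y, hy⟩ := exists_transcendental_of_fg htr hE
  have hyF : Transcendental F y := fun h => hy (h.tower_top E)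
  obtain ⟨s, hs⟩ := exists_algEquiv_apply_eq_of_transcendental hx hyF
  let b : Module.Basis B K V := Module.Basis.mk hBind (by
    rw [Subtype.range_coe, hBspan, htop])
  have hb : ∀ i, b i = (i : V) := fun i => by rw [Module.Basis.mk_apply]
  have hfix : ∀ σ : K ≃ₐ[F] K, σ x = x → ∀ i, ρ σ (b i) = b i := fun σ hσ i => by
    rw [hb]; exact hBsub i.2 σ hσ
  let w := ρ s v
  let c := b.repr w
  have hmem : ∀ i ∈ c.support, c i ∈ IntermediateField.adjoin E {y} := by
    intro i _
    have hr : c i ∈ (algebraMap (IntermediateField.adjoin E {y}) K).range := by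
      apply mem_range_algebraMap_of_fixed
      intro τ
      let t : K ≃ₐ[F] K := (τ.restrictScalars E).restrictScalars F
      have ht : ∀ a, t a = τ a := fun _ => rfl
      have htx : t x = x := (τ.restrictScalars E).commutes ⟨x, hxE⟩
      have hty : t y = y := τ.commutes ⟨y, IntermediateField.mem_adjoin_simple_self E y⟩
      have hw : ρ t w = w := by
        have h1 : ρ (s⁻¹ * t * s) v = v := hv _ (by
          rw [AlgEquiv.mul_apply, AlgEquiv.mul_apply, hs, hty, AlgEquiv.aut_inv,
            AlgEquiv.symm_apply_eq, hs])
        have h2 := congrArg (ρ s) h1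
        rwa [← apply_mul_apply, ← mul_assoc, mul_inv_cancel_left, apply_mul_apply] at h2
      have h3 : (c.mapRange t (map_zero t)) = c := by
        apply b.repr.symm.injective
        rw [LinearEquiv.symm_apply_apply]
        rw [Module.Basis.repr_symm_apply, Finsupp.linearCombination_apply,
          Finsupp.sum_mapRange_index (by simp)]
        refine Eq.trans ?_ hw
        conv_rhs => rw [← b.linearCombination_repr w, Finsupp.linearCombination_apply]
        rw [Finsupp.sum, Finsupp.sum, map_sum]
        exact Finset.sum_congr rfl fun i _ => by rw [hρ, hfix t htx]
      have h4 := DFunLike.congr_fun h3 i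
      rwa [Finsupp.mapRange_apply] at h4
    obtain ⟨a, ha⟩ := hr
    rw [← ha]
    exact a.2
  obtain ⟨q, r, hq, hqr⟩ := exists_common_denominator hy c.support c hmem
  let W : ℕ →₀ V := ∑ i ∈ c.support, (r i).sum fun m a => Finsupp.single m ((a : K) • b i)
  have hW : ∀ z : K, evalVec z W = ∑ i ∈ c.support, aeval z (r i) • b i := by
    intro z
    simp only [W, map_sum]
    refine Finset.sum_congr rfl fun i _ => ?_
    rw [Polynomial.sum, map_sum, aeval_def, eval₂_eq_sum, Polynomial.sum, Finset.sum_smul]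
    refine Finset.sum_congr rfl fun m _ => ?_
    rw [evalVec_apply, Finsupp.sum_single_index (by simp), smul_smul, mul_comm]
    rfl
  refine ⟨q.map (algebraMap E K), W, ?_, E, hE, fun σ hσ => ?_⟩
  · rwa [Polynomial.map_ne_zero_iff (algebraMap E K).injective]
  · obtain ⟨τ, hτ⟩ := exists_algEquiv_apply_eq_of_transcendental hy hσ
    let t : K ≃ₐ[F] K := τ.restrictScalars F
    have htx : t x = x := τ.commutes ⟨x, hxE⟩
    have ht : ∀ p : E[X], t (aeval y p) = aeval (σ x) p := by
      intro p
      rw [← hτ]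
      exact (aeval_algHom_apply τ.toAlgHom y p).symm
    have hv' : ρ t w = ρ σ v := by
      have h1 : ρ (σ⁻¹ * (t * s)) v = v := hv _ (by
          rw [AlgEquiv.mul_apply, AlgEquiv.mul_apply, hs, AlgEquiv.aut_inv,
            AlgEquiv.symm_apply_eq, ← hτ]
          rfl)
      have h2 := congrArg (ρ σ) h1
      rwa [← apply_mul_apply, mul_inv_cancel_left, apply_mul_apply] at h2
    have h1 : aeval y q • w = ∑ i ∈ c.support, aeval y (r i) • b i := by
      conv_lhs => rw [← b.linearCombination_repr w, Finsupp.linearCombination_apply]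
      rw [Finsupp.sum, Finset.smul_sum]
      exact Finset.sum_congr rfl fun i hi => by rw [smul_smul, ← hqr i hi]
    have h2 := congrArg (ρ t) h1
    rw [hρ, map_sum, ht, hv'] at h2
    rw [hW, Polynomial.eval_map, ← aeval_def, h2]
    exact Finset.sum_congr rfl fun i _ => by rw [hρ, ht, hfix t htx]

theorem infinite_translates {E : IntermediateField F K} {y : K} (hy : Transcendental E y) :
    {z : K | Transcendental E z}.Infinite := by
  have : CharZero K := charZero_of_injective_algebraMap (algebraMap F K).injective
  refine Set.infinite_of_injective_forall_mem (f := fun n : ℕ => y + n) ?_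
    fun n => transcendental_add_natCast hy n
  intro m n h
  exact_mod_cast add_left_cancel h

/-- Write the conjugates of `v` as `W(σ x) / q(σ x)` with `q` monic of minimal degree. Twisting by
`τ` gives another such expression, and by minimality the two agree. So the coefficients of `q` and
`W` are fixed, and `v = W(x) / q(x)` is a combination of the fixed coefficients of `W`. -/
theorem span_fixed_of_transcendental (htr : Cardinal.aleph0 ≤ Algebra.trdeg F K)
    (ρ : (K ≃ₐ[F] K) →* AddMonoid.End V)
    (hρ : ∀ σ (c : K) v, ρ σ (c • v) = σ c • ρ σ v) {x : K}
    (htop : Submodule.span K {v : V | ∀ σ : K ≃ₐ[F] K, σ x = x → ρ σ v = v} = ⊤)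
    (hx : Transcendental F x) {v : V} (hv : ∀ σ : K ≃ₐ[F] K, σ x = x → ρ σ v = v) :
    v ∈ Submodule.span K {w : V | ∀ σ, ρ σ w = w} := by
  classical
  have hex : ∃ n, ∃ (q : K[X]) (W : ℕ →₀ V), q ≠ 0 ∧ IsRationalIn ρ x v q W ∧ q.natDegree = n := by
    obtain ⟨q, W, h1, h2⟩ := exists_isRationalIn htr ρ hρ htop hx hv
    exact ⟨_, q, W, h1, h2, rfl⟩
  obtain ⟨q₀, W₀, hq₀, hr₀, hn⟩ := Nat.find_spec hex
  have hmin : ∀ (q : K[X]) (W : ℕ →₀ V), IsRationalIn ρ x v q W →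
      q.natDegree < q₀.natDegree → q = 0 := by
    intro q W hq hlt
    by_contra h0
    rw [hn] at hlt
    exact Nat.find_min hex hlt ⟨q, W, h0, hq, rfl⟩
  have hl : q₀.leadingCoeff⁻¹ ≠ 0 := inv_ne_zero (leadingCoeff_ne_zero.2 hq₀)
  obtain ⟨q, W, hmon, hr, hdeg⟩ : ∃ (q : K[X]) (W : ℕ →₀ V), q.Monic ∧ IsRationalIn ρ x v q W ∧
      q.natDegree = q₀.natDegree := by
    refine ⟨C q₀.leadingCoeff⁻¹ * q₀, q₀.leadingCoeff⁻¹ • W₀, ?_, hr₀.smul _, ?_⟩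
    · rw [mul_comm]; exact monic_mul_leadingCoeff_inv hq₀
    · exact natDegree_C_mul hl
  -- Both `q` and its twist are monic of the same degree, so a non-zero difference would be a
  -- denominator of smaller degree.
  have hqτ : ∀ τ : K ≃ₐ[F] K, q.map (τ : K →+* K) = q := by
    intro τ
    have hmon' := hmon.map (τ : K →+* K)
    have hdeg' : (q.map (τ : K →+* K)).natDegree = q.natDegree := natDegree_map _
    rcases Nat.eq_zero_or_pos q.natDegree with h0 | h0
    · rw [hmon.natDegree_eq_zero.1 h0, Polynomial.map_one]
    · by_contra hne
      refine hne (sub_eq_zero.1 (hmin _ _ ((hr.map hρ τ).sub hr) ?_))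
      rw [← hdeg]
      refine natDegree_lt_natDegree (sub_ne_zero.2 hne) ?_
      rw [← degree_map q (τ : K →+* K)]
      exact degree_sub_lt_left (by rw [degree_map]) hmon'.ne_zero (by rw [hmon', hmon])
  have hWτ : ∀ (τ : K ≃ₐ[F] K), W.mapRange (ρ τ) (map_zero _) = W := by
    intro τ
    obtain ⟨E, hE, h⟩ := (hr.map hρ τ).sub hr
    obtain ⟨y, hy⟩ := exists_transcendental_of_fg htr hE
    refine sub_eq_zero.1 (eq_zero_of_evalVec_eq_zero (infinite_translates hy) _ fun z hz => ?_)
    obtain ⟨σ, rfl⟩ := exists_algEquiv_apply_eq_of_transcendental hx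
      (show Transcendental F z from fun h => hz (h.tower_top E))
    rw [← h σ hz, hqτ, sub_self, eval_zero, zero_smul]
  obtain ⟨E, hE, h⟩ := hr
  obtain ⟨y, hy⟩ := exists_transcendental_of_fg htr hE
  -- The relation is known only at parameters transcendental over `E`, and `x` need not be one. It
  -- is used at a conjugate `z = σ x` and brought back by `σ⁻¹`, which is possible since `q` and `W`
  -- are invariant.
  obtain ⟨z, hz, hqz⟩ : ∃ z, Transcendental E z ∧ q.eval z ≠ 0 := by
    by_contra! h0
    exact hmon.ne_zero (eq_zero_of_infinite_isRoot q ((infinite_translates hy).mono h0))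
  obtain ⟨σ, rfl⟩ := exists_algEquiv_apply_eq_of_transcendental hx
    (show Transcendental F z from fun h => hz (h.tower_top E))
  have hσq : q.eval (σ x) = σ (q.eval x) := by
    have h4 : (q.map (σ : K →+* K)).eval ((σ : K →+* K) x) = _ := eval_map_apply (σ : K →+* K) x
    rwa [hqτ] at h4
  have hqx : q.eval x ≠ 0 := fun h0 => hqz (by rw [hσq, h0, map_zero])
  have h1 : ρ σ (q.eval x • v) = ρ σ (evalVec x W) := by
    rw [hρ, map_evalVec ρ hρ, ← hσq, hWτ, h σ hz]
  have h2 : q.eval x • v = evalVec x W := by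
    have := congrArg (ρ σ⁻¹) h1
    rwa [← apply_mul_apply, ← apply_mul_apply, inv_mul_cancel, map_one] at this
  have h3 : v = (q.eval x)⁻¹ • evalVec x W := by
    rw [← h2, smul_smul, inv_mul_cancel₀ hqx, one_smul]
  rw [h3, evalVec_apply]
  refine Submodule.smul_mem _ _ (Submodule.sum_mem _ fun m _ => Submodule.smul_mem _ _
    (Submodule.subset_span fun τ => ?_))
  have := DFunLike.congr_fun (hWτ τ) m
  rwa [Finsupp.mapRange_apply] at this

/-- If a semilinear representation of `Aut(K/F)` is spanned by the vectors fixed by the stabilizer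
of a single `x : K`, then it is spanned by the vectors fixed by the whole group. -/
theorem span_fixed_eq_top (htr : Cardinal.aleph0 ≤ Algebra.trdeg F K)
    (ρ : (K ≃ₐ[F] K) →* AddMonoid.End V)
    (hρ : ∀ σ (c : K) v, ρ σ (c • v) = σ c • ρ σ v) (x : K)
    (htop : Submodule.span K {v : V | ∀ σ : K ≃ₐ[F] K, σ x = x → ρ σ v = v} = ⊤) :
    Submodule.span K {w : V | ∀ σ, ρ σ w = w} = ⊤ := by
  rw [eq_top_iff, ← htop, Submodule.span_le]
  intro v hv
  by_cases hx : IsAlgebraic F x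
  · exact span_fixed_of_isAlgebraic ρ hρ hx hv
  · exact span_fixed_of_transcendental htr ρ hρ htop hx hv

end Semilinear

/-! ### Sections of schemes over a ring and base change -/

section Scalars

theorem le_preimage_top {X Y : Scheme.{u}} (f : X ⟶ Y) (U : X.Opens) : U ≤ f ⁻¹ᵁ ⊤ := le_top

/-- The ring homomorphism `R ⟶ Γ(Y, U)` for a scheme `Y` over `Spec R`. -/
noncomputable def scalars {Y : Scheme.{u}} {R : CommRingCat.{u}} (p : Y ⟶ Spec R) (U : Y.Opens) :
    R ⟶ Γ(Y, U) :=
  (Scheme.ΓSpecIso R).inv ≫ p.appLE ⊤ U (le_preimage_top p U)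

variable {Y Y' : Scheme.{u}} {R S : CommRingCat.{u}}

theorem scalars_appLE (p : Y ⟶ Spec R) (g : Y' ⟶ Y) (U : Y.Opens) (U' : Y'.Opens)
    (h : U' ≤ g ⁻¹ᵁ U) : scalars p U ≫ g.appLE U U' h = scalars (g ≫ p) U' := by
  rw [scalars, scalars, Category.assoc, Scheme.Hom.appLE_comp_appLE]

theorem scalars_map (p : Y ⟶ Spec R) {U U' : Y.Opens} (h : U' ≤ U) :
    scalars p U ≫ Y.presheaf.map (homOfLE h).op = scalars p U' := by
  rw [scalars, scalars, Category.assoc, Scheme.Hom.appLE_map]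

theorem scalars_comp_SpecMap (p : Y ⟶ Spec S) (f : R ⟶ S) (U : Y.Opens) :
    scalars (p ≫ Spec.map f) U = f ≫ scalars p U := by
  rw [scalars, scalars, Scheme.Hom.comp_appLE, Scheme.ΓSpecIso_inv_naturality_assoc]
  rfl

theorem isPushout_scalars_of_isPushout_appLE {X : Scheme.{u}} {π : Y ⟶ X} {p : Y ⟶ Spec S}
    {r : X ⟶ Spec R} {f : R ⟶ S} {V : X.Opens}
    (h : IsPushout (r.appLE ⊤ V (le_preimage_top _ _))
      ((Spec.map f).appLE ⊤ ⊤ (le_preimage_top _ _)) (π.appLE V (π ⁻¹ᵁ V) le_rfl)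
      (p.appLE ⊤ (π ⁻¹ᵁ V) (le_preimage_top _ _))) :
    IsPushout (scalars r V) f (π.app V) (scalars p (π ⁻¹ᵁ V)) := by
  refine h.of_iso (Scheme.ΓSpecIso R) (Iso.refl _) (Scheme.ΓSpecIso S) (Iso.refl _) ?_ ?_ ?_ ?_
  · simp [scalars]
  · rw [← Scheme.ΓSpecIso_naturality f]
    exact congrArg (· ≫ (Scheme.ΓSpecIso S).hom) (Scheme.Hom.appLE_eq_app _)
  · simp [Scheme.Hom.app_eq_appLE]
  · simp [scalars]

theorem isPushout_scalars {X : Scheme.{u}} {π : Y ⟶ X} {p : Y ⟶ Spec S} {r : X ⟶ Spec R}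
    {f : R ⟶ S} (H : IsPullback π p r (Spec.map f)) {V : X.Opens} (hV : IsAffineOpen V) :
    IsPushout (scalars r V) f (π.app V) (scalars p (π ⁻¹ᵁ V)) :=
  isPushout_scalars_of_isPushout_appLE <|
    (isIso_pushoutSection_iff H (US := ⊤) (UT := ⊤) (UX := V) (le_preimage_top _ _)
      (le_preimage_top _ _) (UY := π ⁻¹ᵁ V) (inf_eq_left.2 (le_preimage_top _ _)).symm).1
      (isIso_pushoutSection_of_isAffineOpen H _ _ _
        (isAffineOpen_top _) (isAffineOpen_top _) hV)

/-- Flat base change commutes with sections over every quasi-compact, quasi-separated open subset,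
not only over affine ones. -/
theorem isPushout_scalars_of_flat {X : Scheme.{u}} {π : Y ⟶ X} {p : Y ⟶ Spec S} {r : X ⟶ Spec R}
    {f : R ⟶ S} [Flat (Spec.map f)] (H : IsPullback π p r (Spec.map f)) {V : X.Opens}
    (hV : IsCompact (V : Set X)) (hV' : IsQuasiSeparated (V : Set X)) :
    IsPushout (scalars r V) f (π.app V) (scalars p (π ⁻¹ᵁ V)) :=
  isPushout_scalars_of_isPushout_appLE <|
    (isIso_pushoutSection_iff H (US := ⊤) (UT := ⊤) (UX := V) (le_preimage_top _ _)
      (le_preimage_top _ _) (UY := π ⁻¹ᵁ V) (inf_eq_left.2 (le_preimage_top _ _)).symm).1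
      (isIso_pushoutSection_of_isQuasiSeparated_of_flat_right H _ _ _
        (isAffineOpen_top _) (isAffineOpen_top _) hV hV')

/-- The ring `B` is `A ⊗_R S`, which is free over `A` with basis the images of the `b i`. -/
theorem exists_sum_of_isPushout {R S : Type u} [CommRing R] [CommRing S] [Algebra R S]
    {A B : CommRingCat.{u}} {α : CommRingCat.of R ⟶ A} {β : CommRingCat.of S ⟶ B} {γ : A ⟶ B}
    (H : IsPushout α (CommRingCat.ofHom (algebraMap R S)) γ β) {κ : Type*}
    (b : Module.Basis κ R S) (s : B) : ∃ c : κ →₀ A, s = c.sum fun i a => γ a * β (b i) := by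
  let _ := α.hom.toAlgebra
  let _ := β.hom.toAlgebra
  let _ := γ.hom.toAlgebra
  let _ := (γ.hom.comp α.hom).toAlgebra
  have : IsScalarTower R A B := .of_algebraMap_eq' rfl
  have : IsScalarTower R S B := .of_algebraMap_eq' congr($(H.w).hom)
  have h : Algebra.IsPushout R A S B := CommRingCat.isPushout_iff_isPushout.1 H
  let e := h.equiv
  have key : ∀ t : TensorProduct R A S, ∃ c : κ →₀ A, t = c.sum fun i a => a ⊗ₜ b i := by
    intro t
    refine ⟨(Algebra.TensorProduct.basis A b).repr t, ?_⟩
    conv_lhs => rw [← (Algebra.TensorProduct.basis A b).linearCombination_repr t]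
    rw [Finsupp.linearCombination_apply]
    refine Finsupp.sum_congr fun i _ => ?_
    rw [Algebra.TensorProduct.basis_apply, TensorProduct.smul_tmul', smul_eq_mul, mul_one]
  obtain ⟨c, hc⟩ := key (e.symm s)
  refine ⟨c, ?_⟩
  rw [← e.apply_symm_apply s, hc, map_finsuppSum]
  refine Finsupp.sum_congr fun i _ => ?_
  rw [Algebra.IsPushout.equiv_tmul]
  rfl

end Scalars

/-! ### Families of sections that detect equality of morphisms -/

section JointlyDense

theorem app_eq_zero_of_comp_eq {X Y Z : Scheme.{u}} {f : X ⟶ Z} {g : X ⟶ Y} {h : Y ⟶ Z}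
    (e : g ≫ h = f) {V : Z.Opens} {s : Γ(Z, V)} (hs : h.app V s = 0) : f.app V s = 0 := by
  subst e
  change g.app _ (h.app V s) = 0
  rw [hs, map_zero]

/-- If the `t j : T j ⟶ W` are jointly injective on functions, they detect equality of morphisms
to a separated scheme. -/
theorem hom_ext_of_jointly_injective {J I : Type*} {W Z : Scheme.{u}} {T : J → Scheme.{u}}
    (t : ∀ j, T j ⟶ W) (V : I → W.affineOpens) (hV : ⨆ a, (V a : W.Opens) = ⊤)
    (h : ∀ a, ∀ s : Γ(W, (V a).1), (∀ j, (t j).app _ s = 0) → s = 0)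
    [Z.IsSeparated] {f g : W ⟶ Z} (hfg : ∀ j, t j ≫ f = t j ≫ g) : f = g := by
  -- Every `t j` factors through the equalizer, which is closed because `Z` is separated. A function
  -- vanishing on the equalizer is thus killed by all the `t j`.
  have hk : (equalizer.ι f g).ker = ⊥ := by
    refine Scheme.IdealSheafData.ext_of_iSup_eq_top V hV fun a => ?_
    rw [Scheme.Hom.ker_apply, Scheme.IdealSheafData.ideal_bot, Pi.bot_apply, eq_bot_iff]
    intro s hs
    rw [RingHom.mem_ker] at hs
    refine h a s fun j => ?_
    exact app_eq_zero_of_comp_eq (equalizer.lift_ι _ (hfg j)) hs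
  have : IsIso (equalizer.ι f g) := IsClosedImmersion.isIso_iff_ker_eq_bot.2 hk
  rw [← cancel_epi (equalizer.ι f g)]
  exact equalizer.condition f g

/-- A `K`-vector `∑ a i ⊗ b i` over a `K`-algebra is zero once all its images under
a jointly injective family are zero. -/
theorem eq_zero_of_sum_algebraMap {J κ K A : Type*} [Field K] [CommRing A] (ι : K →+* A)
    (β : J → κ → K) (hβ : ∀ (s : Finset κ) (a : κ → K), (∀ j, ∑ i ∈ s, a i * β j i = 0) →
      ∀ i ∈ s, a i = 0) (s : Finset κ) (a : κ → A) (h : ∀ j, ∑ i ∈ s, a i * ι (β j i) = 0) :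
    ∀ i ∈ s, a i = 0 := by
  let _ := ι.toAlgebra
  intro i hi
  rw [← Module.forall_dual_apply_eq_zero_iff K]
  intro l
  refine hβ s (fun i => l (a i)) (fun j => ?_) i hi
  have := congrArg l (h j)
  rw [map_sum, map_zero] at this
  rw [← this]
  refine Finset.sum_congr rfl fun i _ => ?_
  have h1 : a i * ι (β j i) = β j i • a i := by rw [Algebra.smul_def, mul_comm]; rfl
  rw [h1, map_smul, smul_eq_mul, mul_comm]

theorem app_appLE_of_comp_eq_id {Y W : Scheme.{u}} {t : Y ⟶ W} {w : W ⟶ Y} (e : t ≫ w = 𝟙 Y)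
    (U : Y.Opens) (h : U ≤ t ⁻¹ᵁ w ⁻¹ᵁ U) : w.app U ≫ t.appLE (w ⁻¹ᵁ U) U h = 𝟙 _ := by
  have : ∀ (q : Y ⟶ Y) (e : q = 𝟙 Y) (h : U ≤ q ⁻¹ᵁ U), q.appLE U U h = 𝟙 _ := by
    rintro _ rfl h
    exact (Category.id_comp _).trans (Y.presheaf.map_id _)
  rw [← this _ e h, Scheme.Hom.app_eq_appLE, Scheme.Hom.appLE_comp_appLE]

/-- Let `W = Y ×_E Spec D` for a `K`-scheme `Y`. A family of homomorphisms `θ j : D → K` that is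
jointly injective on `K ⊗_E D` gives sections `t j : Y ⟶ W` which detect equality of morphisms
from `W` to a separated scheme. -/
theorem hom_ext_of_sections {J κ E K D : Type u} [Field K] [CommRing E] [CommRing D]
    [Algebra E K] [Algebra E D] (b : Module.Basis κ E D) (θ : J → D →+* K)
    (hθ : ∀ (s : Finset κ) (a : κ → K), (∀ j, ∑ i ∈ s, a i * θ j (b i) = 0) → ∀ i ∈ s, a i = 0)
    {Y W Z : Scheme.{u}} {p : Y ⟶ Spec (.of K)} {w₁ : W ⟶ Y} {w₂ : W ⟶ Spec (.of D)}
    (H : IsPullback w₁ w₂ (p ≫ Spec.map (CommRingCat.ofHom (algebraMap E K)))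
      (Spec.map (CommRingCat.ofHom (algebraMap E D))))
    (t : J → (Y ⟶ W)) (ht₁ : ∀ j, t j ≫ w₁ = 𝟙 Y)
    (ht₂ : ∀ j, t j ≫ w₂ = p ≫ Spec.map (CommRingCat.ofHom (θ j)))
    [Z.IsSeparated] {f g : W ⟶ Z} (hfg : ∀ j, t j ≫ f = t j ≫ g) : f = g := by
  classical
  have haff : ∀ U : Y.affineOpens, IsAffineOpen (w₁ ⁻¹ᵁ U.1) := fun U => by
    have : IsAffineHom w₁ := MorphismProperty.of_isPullback H.flip inferInstance
    exact U.2.preimage w₁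
  refine hom_ext_of_jointly_injective t (fun U : Y.affineOpens => ⟨w₁ ⁻¹ᵁ U.1, haff U⟩) ?_ ?_ hfg
  · rw [← Scheme.Hom.preimage_iSup, iSup_affineOpens_eq_top, Scheme.Hom.preimage_top]
  · intro U s hs
    -- A function over the preimage of `U` is `∑ a i ⊗ b i`, and `t j` takes it to `∑ a i * θ j (b
    -- i)`.
    obtain ⟨c, rfl⟩ := exists_sum_of_isPushout (isPushout_scalars H U.2) b s
    have hU : ∀ j, U.1 ≤ t j ⁻¹ᵁ w₁ ⁻¹ᵁ U.1 := fun j => by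
      rw [← Scheme.Hom.comp_preimage, ht₁, Scheme.Hom.id_preimage]
    have h1 : ∀ j, (t j).appLE (w₁ ⁻¹ᵁ U.1) U.1 (hU j) (c.sum fun i a => w₁.app U.1 a *
        scalars w₂ (w₁ ⁻¹ᵁ U.1) (b i)) = 0 := by
      intro j
      rw [Scheme.Hom.appLE, CommRingCat.comp_apply, hs j, map_zero]
    have h2 : ∀ j, ∑ i ∈ c.support, c i * (scalars p U.1).hom (θ j (b i)) = 0 := by
      intro j
      rw [← h1 j, Finsupp.sum, map_sum]
      refine Finset.sum_congr rfl fun i _ => ?_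
      rw [map_mul]
      congr 1
      · have := app_appLE_of_comp_eq_id (ht₁ j) U.1 (hU j)
        exact congr($(this.symm).hom (c i))
      · have : scalars w₂ (w₁ ⁻¹ᵁ U.1) ≫ (t j).appLE (w₁ ⁻¹ᵁ U.1) U.1 (hU j) =
            CommRingCat.ofHom (θ j) ≫ scalars p U.1 := by
          rw [scalars_appLE, ht₂, scalars_comp_SpecMap]
        exact congr($(this.symm).hom (b i))
    have h3 := eq_zero_of_sum_algebraMap (scalars p U.1).hom (fun j i => θ j (b i)) hθ _ _ h2
    rw [Finsupp.sum]
    exact Finset.sum_eq_zero fun i hi => by rw [h3 i hi, map_zero, zero_mul]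

end JointlyDense

/-! ### Semilinear actions, models, and descent of invariant morphisms -/

section GaloisAction

variable (F : Type u) {K : Type u} [Field F] [Field K] [Algebra F K]

/-- A semilinear action of `Aut(K/F)` on a `K`-scheme. -/
structure GaloisAct {Y : Scheme.{u}} (p : Y ⟶ Spec (CommRingCat.of K)) where
  act : (K ≃ₐ[F] K) → (Y ⟶ Y)
  act_one : act 1 = 𝟙 Y
  -- The composite is in diagrammatic order, so pull-back of functions is a left action.
  act_mul : ∀ σ τ, act (σ * τ) = act σ ≫ act τ
  act_over : ∀ σ, act σ ≫ p = p ≫ specAut σ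

variable {F}

theorem DescentDatum.schemeIso_hom {Y : Over (Spec (CommRingCat.of K))} (φ : DescentDatum F Y)
    (σ : K ≃ₐ[F] K) : (φ.schemeIso σ).hom = (show Y.left ⟶ Y.left from (φ.iso σ).hom.left) :=
  Category.id_comp (X := Y.left) (Y := Y.left) _

theorem DescentDatum.schemeIso_mul {Y : Over (Spec (CommRingCat.of K))} (φ : DescentDatum F Y)
    (σ τ : K ≃ₐ[F] K) :
    (φ.schemeIso (σ * τ)).hom = (φ.schemeIso τ).hom ≫ (φ.schemeIso σ).hom := by
  have h := congrArg CommaMorphism.left (φ.cocycle σ τ)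
  change (φ.iso (σ * τ)).hom.left =
      (𝟙 Y.left ≫ 𝟙 Y.left ≫ 𝟙 Y.left) ≫ (φ.iso τ).hom.left ≫ (φ.iso σ).hom.left at h
  rw [Category.id_comp, Category.id_comp, Category.id_comp] at h
  rw [schemeIso_hom, schemeIso_hom, schemeIso_hom]
  exact h

/-- The action of `Aut(K/F)` on a `K`-scheme with a descent datum. -/
noncomputable def DescentDatum.galoisAct {Y : Over (Spec (CommRingCat.of K))}
    (φ : DescentDatum F Y) : GaloisAct F Y.hom where
  -- The inverse turns the action on points into the map whose pull-back is the action of `σ` on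
  -- rational functions.
  act σ := (φ.schemeIso σ⁻¹).hom
  act_one := by
    have h := φ.schemeIso_mul 1 1
    rw [one_mul] at h
    rw [inv_one, ← cancel_epi (φ.schemeIso 1).hom, ← h, Category.comp_id]
  act_mul σ τ := by rw [mul_inv_rev, φ.schemeIso_mul]
  act_over σ := by
    have h := Over.w (φ.iso σ⁻¹).hom
    change (φ.iso σ⁻¹).hom.left ≫ Y.hom = Y.hom ≫ specAut σ⁻¹⁻¹ at h
    rw [inv_inv] at h
    rw [schemeIso_hom]
    exact h

variable {Y : Scheme.{u}} {p : Y ⟶ Spec (CommRingCat.of K)}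

/-- Restriction of an action to `Aut(K/E)` for an intermediate field `E`. -/
def GaloisAct.restrict (A : GaloisAct F p) (E : Type u) [Field E] [Algebra F E] [Algebra E K]
    [IsScalarTower F E K] : GaloisAct E p where
  act σ := A.act (σ.restrictScalars F)
  act_one := A.act_one
  act_mul σ τ := A.act_mul (σ.restrictScalars F) (τ.restrictScalars F)
  act_over _ := A.act_over _

/-- `X` is a model over `F` of the `K`-scheme `Y` with its action of `Aut(K/F)`. -/
structure GaloisAct.IsModel (A : GaloisAct F p) {X : Scheme.{u}} (r : X ⟶ Spec (CommRingCat.of F))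
    (π : Y ⟶ X) : Prop where
  isPullback : IsPullback π p r (Spec.map (CommRingCat.ofHom (algebraMap F K)))
  act_comp : ∀ σ, A.act σ ≫ π = π

instance : Flat (Spec.map (CommRingCat.ofHom (algebraMap F K))) := by
  rw [Flat.SpecMap_iff]
  change (algebraMap F K).Flat
  rw [RingHom.flat_algebraMap_iff]
  infer_instance

instance : Surjective (Spec.map (CommRingCat.ofHom (algebraMap F K))) := by
  infer_instance

namespace GaloisAct.IsModel

variable {A : GaloisAct F p} {X : Scheme.{u}} {r : X ⟶ Spec (CommRingCat.of F)} {π : Y ⟶ X}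

theorem flat (h : A.IsModel r π) : Flat π := MorphismProperty.of_isPullback h.isPullback.flip
  inferInstance

theorem surjective (h : A.IsModel r π) : Surjective π :=
  MorphismProperty.of_isPullback h.isPullback.flip inferInstance

theorem isAffineHom (h : A.IsModel r π) : IsAffineHom π :=
  MorphismProperty.of_isPullback h.isPullback.flip inferInstance

theorem effectiveEpi (h : A.IsModel r π) : EffectiveEpi π := by
  have := h.flat
  have := h.surjective
  have := h.isAffineHom
  infer_instance

variable [CharZero F] [IsAlgClosed K]

/-- An invariant morphism to a separated scheme descends to the model. -/
theorem exists_desc (h : A.IsModel r π) {Z : Scheme.{u}} [Z.IsSeparated] (f : Y ⟶ Z)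
    (hf : ∀ σ, A.act σ ≫ f = f) : ∃ g : X ⟶ Z, π ≫ g = f := by
  have := h.effectiveEpi
  have hk : IsKernelPair π (pullback.fst π π) (pullback.snd π π) := IsPullback.of_hasPullback _ _
  -- As `Y = X ×_F K`, the product `Y ×_X Y` is `Y ×_F K`.
  have H : IsPullback (pullback.fst π π) (pullback.snd π π ≫ p)
      (p ≫ Spec.map (CommRingCat.ofHom (algebraMap F K)))
      (Spec.map (CommRingCat.ofHom (algebraMap F K))) := by
    rw [← h.isPullback.w]
    exact hk.paste_vert h.isPullback
  -- The graphs `(id, act σ) : Y ⟶ Y ×_X Y` are jointly injective on functions by independence of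
  -- conjugates. On each graph the two morphisms agree because `f` is invariant.
  have key : pullback.fst π π ≫ f = pullback.snd π π ≫ f := by
    refine hom_ext_of_sections (Module.Basis.ofVectorSpace F K)
      (fun σ : K ≃ₐ[F] K => (σ : K →+* K)) ?_ H
      (fun σ => pullback.lift (𝟙 Y) (A.act σ) (by rw [h.act_comp, Category.id_comp])) ?_ ?_ ?_
    · intro s a hs
      exact eq_zero_of_sum_mul_algEquiv_eq_zero (fun a ha => mem_range_algebraMap_of_fixed ha) _
        (Module.Basis.ofVectorSpace F K).linearIndependent s a hs
    · intro σ; exact pullback.lift_fst _ _ _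
    · intro σ
      rw [pullback.lift_snd_assoc, A.act_over]
    · intro σ
      rw [pullback.lift_fst_assoc, pullback.lift_snd_assoc, hf, Category.id_comp]
  refine ⟨EffectiveEpi.desc π f fun g₁ g₂ hg => ?_, EffectiveEpi.fac _ _ _⟩
  rw [← pullback.lift_fst g₁ g₂ hg, Category.assoc, key, pullback.lift_snd_assoc]

theorem desc_unique (h : A.IsModel r π) {Z : Scheme.{u}} {g g' : X ⟶ Z} (e : π ≫ g = π ≫ g') :
    g = g' := by
  have := h.effectiveEpi
  rwa [cancel_epi] at e

end GaloisAct.IsModel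

/-! ### Descent of affineness and quasi-affineness -/

theorem eq_toSpecΓ_comp_scalars {R : CommRingCat.{u}} {X : Scheme.{u}} (r : X ⟶ Spec R) :
    r = X.toSpecΓ ≫ Spec.map (scalars r ⊤) := by
  have h : scalars r ⊤ = (Scheme.ΓSpecIso R).inv ≫ r.appTop := by
    rw [scalars]
    exact congrArg _ (Scheme.Hom.appLE_eq_app _)
  rw [h, Spec.map_comp, ← Scheme.toSpecΓ_naturality_assoc, ← SpecMap_ΓSpecIso_hom,
    ← Spec.map_comp, Iso.inv_hom_id, Spec.map_id, Category.comp_id]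

/-- Global sections commute with the flat base change to `K`, so `Y ⟶ Spec Γ(Y)` is a base change of
`X ⟶ Spec Γ(X)`. The base change map is faithfully flat and quasi-compact, so being an isomorphism
or an open immersion descends. -/
theorem isPullback_toSpecΓ {X : Scheme.{u}} {r : X ⟶ Spec (.of F)} {π : Y ⟶ X}
    (H : IsPullback π p r (Spec.map (CommRingCat.ofHom (algebraMap F K))))
    [CompactSpace X] [QuasiSeparatedSpace X] :
    IsPullback π Y.toSpecΓ X.toSpecΓ (Spec.map π.appTop) ∧
      (@Surjective ⊓ @Flat ⊓ @QuasiCompact : MorphismProperty Scheme) (Spec.map π.appTop) := by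
  have h := isPushout_scalars_of_flat H (V := ⊤) isCompact_univ
    (isQuasiSeparated_univ)
  have h1 : IsPullback (Spec.map π.appTop) (Spec.map (scalars p ⊤)) (Spec.map (scalars r ⊤))
      (Spec.map (CommRingCat.ofHom (algebraMap F K))) := (h.op.map Scheme.Spec).flip
  refine ⟨IsPullback.of_bot (h₁₁ := π) ?_ (Scheme.toSpecΓ_naturality π) h1, ⟨?_, ?_⟩, ?_⟩
  · rwa [← eq_toSpecΓ_comp_scalars, ← eq_toSpecΓ_comp_scalars]
  · exact MorphismProperty.of_isPullback h1.flip inferInstance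
  · exact MorphismProperty.of_isPullback h1.flip inferInstance
  · infer_instance

theorem isAffine_of_isPullback {X : Scheme.{u}} {r : X ⟶ Spec (.of F)} {π : Y ⟶ X}
    (H : IsPullback π p r (Spec.map (CommRingCat.ofHom (algebraMap F K))))
    [CompactSpace X] [QuasiSeparatedSpace X] [IsAffine Y] : IsAffine X := by
  obtain ⟨h1, h2⟩ := isPullback_toSpecΓ H
  have : IsIso X.toSpecΓ := MorphismProperty.of_isPullback_of_descendsAlong
    (P := .isomorphisms Scheme.{u}) h1.flip h2 (show IsIso _ by infer_instance)
  exact ⟨this⟩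

theorem isQuasiAffine_of_isPullback {X : Scheme.{u}} {r : X ⟶ Spec (.of F)} {π : Y ⟶ X}
    (H : IsPullback π p r (Spec.map (CommRingCat.ofHom (algebraMap F K))))
    [CompactSpace X] [QuasiSeparatedSpace X] [Y.IsQuasiAffine] : X.IsQuasiAffine := by
  obtain ⟨h1, h2⟩ := isPullback_toSpecΓ H
  have : IsOpenImmersion X.toSpecΓ := MorphismProperty.of_isPullback_of_descendsAlong
    (P := @IsOpenImmersion) h1.flip h2 inferInstance
  exact { }

theorem isPullback_restrict {X : Scheme.{u}} {r : X ⟶ Spec (.of F)} {π : Y ⟶ X}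
    (H : IsPullback π p r (Spec.map (CommRingCat.ofHom (algebraMap F K)))) (V : X.Opens) :
    IsPullback (π ∣_ V) ((π ⁻¹ᵁ V).ι ≫ p) (V.ι ≫ r)
      (Spec.map (CommRingCat.ofHom (algebraMap F K))) :=
  (isPullback_morphismRestrict π V).paste_vert H

/-- The model of an affine open subset is affine. -/
theorem isAffineOpen_of_isPullback {X : Scheme.{u}} {r : X ⟶ Spec (.of F)} {π : Y ⟶ X}
    (H : IsPullback π p r (Spec.map (CommRingCat.ofHom (algebraMap F K)))) [Surjective π]
    [QuasiSeparatedSpace X] {V : X.Opens} (hV : IsAffineOpen (π ⁻¹ᵁ V)) : IsAffineOpen V := by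
  have hc : IsCompact (V : Set X) := by
    have := hV.isCompact.image π.continuous
    rwa [Scheme.Hom.coe_preimage, Set.image_preimage_eq _ π.surjective] at this
  have : CompactSpace V := isCompact_iff_compactSpace.1 hc
  have : IsAffine (π ⁻¹ᵁ V) := hV
  have : QuasiSeparatedSpace V := .of_isOpenEmbedding V.ι.isOpenEmbedding
  exact isAffine_of_isPullback (isPullback_restrict H V)

end GaloisAction

/-! ### Ratios of homogeneous elements as functions on `Proj` -/

section Fractions

open HomogeneousLocalization

variable {σ : Type*} {A : Type u} [CommRing A] [SetLike σ A] [AddSubgroupClass σ A]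
  (𝒜 : ℕ → σ) [GradedRing 𝒜]

/-- The function `m / s` on `D₊(s)` for homogeneous `m`, `s` of the same degree. -/
noncomputable def frac {d : ℕ} (s m : 𝒜 d) : Γ(Proj 𝒜, Proj.basicOpen 𝒜 (s : A)) :=
  Proj.awayToSection 𝒜 (s : A) (Away.mk 𝒜 s.2 1 m (by rw [one_smul]; exact m.2))

/-- The homogeneous prime ideal of a point of `Proj`. -/
def idealAt (x : Proj 𝒜) : Ideal A :=
  (ProjectiveSpectrum.asHomogeneousIdeal (𝒜 := 𝒜) x).toIdeal

instance (x : Proj 𝒜) : (idealAt 𝒜 x).IsPrime := ProjectiveSpectrum.isPrime (𝒜 := 𝒜) x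

theorem mem_primeCompl_idealAt {x : Proj 𝒜} {s : A} (hx : x ∈ Proj.basicOpen 𝒜 s) :
    s ∈ (idealAt 𝒜 x).primeCompl := hx

/-- The value of a section of the structure sheaf of `Proj` in the localization at a point. -/
noncomputable def value {V : (Proj 𝒜).Opens} (x : Proj 𝒜) (hx : x ∈ V) :
    Γ(Proj 𝒜, V) →+* Localization.AtPrime (idealAt 𝒜 x) where
  toFun s := (s.1 ⟨x, hx⟩).val
  map_one' := HomogeneousLocalization.val_one
  map_mul' _ _ := HomogeneousLocalization.val_mul _ _
  map_zero' := HomogeneousLocalization.val_zero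
  map_add' _ _ := HomogeneousLocalization.val_add _ _

theorem section_ext {V : (Proj 𝒜).Opens} {s t : Γ(Proj 𝒜, V)}
    (h : ∀ x (hx : x ∈ V), value 𝒜 x hx s = value 𝒜 x hx t) : s = t := by
  apply Subtype.ext
  funext ⟨x, hx⟩
  exact HomogeneousLocalization.val_injective _ (h x hx)

theorem value_map {V W : (Proj 𝒜).Opens} {h : W ≤ V} (x : Proj 𝒜) (hx : x ∈ W) (s : Γ(Proj 𝒜, V)) :
    value 𝒜 x hx ((Proj 𝒜).presheaf.map (homOfLE h).op s) = value 𝒜 x (h hx) s := rfl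

theorem value_frac {d : ℕ} (s m : 𝒜 d) (x : Proj 𝒜) (hx : x ∈ Proj.basicOpen 𝒜 (s : A)) :
    value 𝒜 x hx (frac 𝒜 s m) = Localization.mk (m : A) ⟨s, mem_primeCompl_idealAt 𝒜 hx⟩ := by
  have := ProjectiveSpectrum.Proj.awayToSection_apply 𝒜 (s : A)
    (Away.mk 𝒜 s.2 1 m (by rw [one_smul]; exact m.2)) ⟨x, hx⟩
  refine Eq.trans this ?_
  rw [Away.val_mk, Localization.mk_eq_mk', IsLocalization.map_mk', Localization.mk_eq_mk']
  congr 1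
  exact Subtype.ext (pow_one _)

theorem frac_self {d : ℕ} (s : 𝒜 d) : frac 𝒜 s s = 1 := by
  refine section_ext 𝒜 fun x hx => ?_
  rw [value_frac, map_one]
  exact Localization.mk_self (⟨s, mem_primeCompl_idealAt 𝒜 hx⟩ : (idealAt 𝒜 x).primeCompl)

theorem frac_mul_frac {d : ℕ} (s t m : 𝒜 d) {V : (Proj 𝒜).Opens}
    (hs : V ≤ Proj.basicOpen 𝒜 (s : A)) (ht : V ≤ Proj.basicOpen 𝒜 (t : A)) :
    (Proj 𝒜).presheaf.map (homOfLE hs).op (frac 𝒜 s t) *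
      (Proj 𝒜).presheaf.map (homOfLE ht).op (frac 𝒜 t m) =
      (Proj 𝒜).presheaf.map (homOfLE hs).op (frac 𝒜 s m) := by
  refine section_ext 𝒜 fun x hx => ?_
  rw [map_mul, value_map, value_map, value_map, value_frac, value_frac, value_frac,
    Localization.mk_mul, Localization.mk_eq_mk_iff, Localization.r_iff_exists]
  refine ⟨1, ?_⟩
  simp only [OneMemClass.coe_one, one_mul, Submonoid.coe_mul]
  ring

theorem appLE_frac_mul_frac {d : ℕ} {T : Scheme.{u}} (q : T ⟶ Proj 𝒜) (s t m : 𝒜 d) {U : T.Opens}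
    (hs : U ≤ q ⁻¹ᵁ Proj.basicOpen 𝒜 (s : A)) (ht : U ≤ q ⁻¹ᵁ Proj.basicOpen 𝒜 (t : A)) :
    q.appLE _ U hs (frac 𝒜 s t) * q.appLE _ U ht (frac 𝒜 t m) = q.appLE _ U hs (frac 𝒜 s m) := by
  have h : U ≤ q ⁻¹ᵁ (Proj.basicOpen 𝒜 (s : A) ⊓ Proj.basicOpen 𝒜 (t : A)) :=
    fun x hx => ⟨hs hx, ht hx⟩
  have h9 := congrArg (q.appLE _ U h) (frac_mul_frac 𝒜 s t m inf_le_left inf_le_right)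
  rw [map_mul, ← CommRingCat.comp_apply, ← CommRingCat.comp_apply, ← CommRingCat.comp_apply,
    Scheme.Hom.map_appLE, Scheme.Hom.map_appLE] at h9
  exact h9

theorem frac_add {d : ℕ} (s m m' : 𝒜 d) : frac 𝒜 s (m + m') = frac 𝒜 s m + frac 𝒜 s m' := by
  refine section_ext 𝒜 fun x hx => ?_
  rw [map_add, value_frac, value_frac, value_frac, Localization.add_mk_self]
  rfl

theorem basicOpen_frac {d : ℕ} (s m : 𝒜 d) :
    (Proj 𝒜).basicOpen (frac 𝒜 s m) = Proj.basicOpen 𝒜 (s : A) ⊓ Proj.basicOpen 𝒜 (m : A) := by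
  apply le_antisymm
  · refine le_inf (Scheme.basicOpen_le _ _) fun x hx => ?_
    have hu : IsUnit ((Proj 𝒜).presheaf.map (homOfLE (Scheme.basicOpen_le _ _)).op
        (frac 𝒜 s m) : Γ(Proj 𝒜, (Proj 𝒜).basicOpen (frac 𝒜 s m))) :=
      RingedSpace.isUnit_res_basicOpen (Proj 𝒜).toRingedSpace (frac 𝒜 s m)
    obtain ⟨v, hv⟩ := isUnit_iff_exists_inv.1 hu
    have h1 := congrArg (value 𝒜 x hx) hv
    rw [map_mul, map_one] at h1
    have hs : x ∈ Proj.basicOpen 𝒜 (s : A) := Scheme.basicOpen_le _ _ hx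
    have h2 : value 𝒜 x hs (frac 𝒜 s m) * value 𝒜 x hx v = 1 := h1
    rw [value_frac] at h2
    have h3 : IsUnit (Localization.mk (m : A) 1 :
        Localization.AtPrime (idealAt 𝒜 x)) := by
      have h4 : Localization.mk (m : A) 1 *
          (Localization.mk 1 ⟨(s : A), mem_primeCompl_idealAt 𝒜 hs⟩) =
        (Localization.mk (m : A) ⟨(s : A), mem_primeCompl_idealAt 𝒜 hs⟩ :
          Localization.AtPrime (idealAt 𝒜 x)) := by
        rw [Localization.mk_mul, mul_one, one_mul]
      rw [← h4, mul_assoc] at h2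
      exact IsUnit.of_mul_eq_one _ h2
    rw [Localization.mk_one_eq_algebraMap] at h3
    exact (IsLocalization.AtPrime.isUnit_to_map_iff _ (idealAt 𝒜 x) _).1 h3
  · intro x hx
    have h1 := frac_mul_frac 𝒜 s m s (V := Proj.basicOpen 𝒜 (s : A) ⊓ Proj.basicOpen 𝒜 (m : A))
      inf_le_left inf_le_right
    rw [frac_self, map_one] at h1
    have h2 := IsUnit.of_mul_eq_one _ h1
    have h3 := (Proj 𝒜).basicOpen_of_isUnit h2
    rw [Scheme.basicOpen_res] at h3
    have h4 := h3.ge hx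
    exact h4.2

end Fractions

theorem toSpecΓ_comp_SpecMap_injective {X : Scheme.{u}} {R : CommRingCat.{u}} {U : X.Opens}
    {f g : R ⟶ Γ(X, U)} (h : U.toSpecΓ ≫ Spec.map f = U.toSpecΓ ≫ Spec.map g) : f = g := by
  have h1 := congrArg Scheme.Hom.appTop h
  rw [Scheme.Hom.comp_appTop, Scheme.Hom.comp_appTop, Scheme.Opens.toSpecΓ_appTop,
    cancel_mono] at h1
  rw [← cancel_epi (Scheme.ΓSpecIso R).hom, ← Scheme.ΓSpecIso_naturality,
    ← Scheme.ΓSpecIso_naturality, h1]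

theorem ι_comp_eq_toSpecΓ_comp_scalars {X : Scheme.{u}} {R : CommRingCat.{u}} (p : X ⟶ Spec R)
    (U : X.Opens) : U.ι ≫ p = U.toSpecΓ ≫ Spec.map (scalars p U) := by
  conv_lhs => rw [eq_toSpecΓ_comp_scalars p]
  rw [← Scheme.Opens.toSpecΓ_SpecMap_presheaf_map_top_assoc, ← Spec.map_comp, scalars_map]

theorem resLE_eq_of_appLE_eq {X Y : Scheme.{u}} {f g : X ⟶ Y} {U : Y.Opens} (hU : IsAffineOpen U)
    {V : X.Opens} (hf : V ≤ f ⁻¹ᵁ U) (hg : V ≤ g ⁻¹ᵁ U) (h : f.appLE U V hf = g.appLE U V hg) :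
    V.ι ≫ f = V.ι ≫ g := by
  have : IsIso U.toSpecΓ := by
    rw [← hU.isoSpec_hom]
    infer_instance
  rw [← Scheme.Hom.resLE_comp_ι f hf, ← Scheme.Hom.resLE_comp_ι g hg]
  congr 1
  rw [← cancel_mono U.toSpecΓ, ← Scheme.Opens.toSpecΓ_SpecMap_appLE,
    ← Scheme.Opens.toSpecΓ_SpecMap_appLE, h]

theorem ι_appLE {X : Scheme.{u}} (U : X.Opens) (h : ⊤ ≤ U.ι ⁻¹ᵁ U) :
    U.ι.appLE U ⊤ h = U.topIso.inv := by
  rw [Scheme.Hom.appLE, Scheme.Opens.ι_app]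
  exact (X.presheaf.map_comp _ _).symm

theorem comp_ι_appLE {T X : Scheme.{u}} {U : X.Opens} (q : T ⟶ U.toScheme)
    (h : ⊤ ≤ (q ≫ U.ι) ⁻¹ᵁ U) : (q ≫ U.ι).appLE U ⊤ h = U.topIso.inv ≫ q.appTop := by
  rw [← ι_appLE U (by simp)]
  exact (Scheme.Hom.appLE_comp_appLE q U.ι U ⊤ ⊤ _ le_top).symm.trans
    (congrArg _ (Scheme.Hom.appLE_eq_app q))

/-! ### Morphisms to projective space from ratios of coordinates -/

section ProjectiveSpace

open HomogeneousLocalization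

attribute [local instance] MvPolynomial.gradedAlgebra

variable (L : Type u) [Field L] (ι : Type)

/-- The grading of the polynomial ring. -/
abbrev grading : ℕ → Submodule L (MvPolynomial ι L) := MvPolynomial.homogeneousSubmodule ι L

/-- Projective space with coordinates indexed by `ι`. -/
noncomputable abbrev PSpace : Scheme.{u} := Proj (grading L ι)

/-- The structure morphism of projective space. -/
noncomputable def PSpace.str : PSpace L ι ⟶ Spec (CommRingCat.of L) :=
  Proj.toSpecZero (grading L ι) ≫ Spec.map (CommRingCat.ofHom (algebraMap L (grading L ι 0)))

variable {ι}

/-- A coordinate as an element of the degree one part. -/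
noncomputable def coord (b : ι) : grading L ι 1 :=
  ⟨MvPolynomial.X b, MvPolynomial.isHomogeneous_X L b⟩

variable {L}

/-- The constants of `Away s`. -/
noncomputable def awayC (s : MvPolynomial ι L) : L →+* Away (grading L ι) s :=
  (fromZeroRingHom (grading L ι) _).comp (algebraMap L (grading L ι 0))

theorem val_awayC (s : MvPolynomial ι L) (a : L) :
    (awayC s a).val = algebraMap (MvPolynomial ι L) _ (MvPolynomial.C a) := by
  change (HomogeneousLocalization.mk _).val = _
  rw [HomogeneousLocalization.val_mk]
  exact Localization.mk_one_eq_algebraMap _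

/-- For a linear form `s`, the fraction `m / s ^ n` with `m` of degree `n` is the value of `m` at
the `X b / s`. These ratios therefore generate the functions on `D₊(s)` over `L`. -/
theorem away_mk_eq_eval₂ {s : MvPolynomial ι L} (hs : s ∈ grading L ι 1) (n : ℕ)
    (m : MvPolynomial ι L) (hm : m ∈ grading L ι (n • 1)) :
    Away.mk (grading L ι) hs n m hm = MvPolynomial.eval₂ (awayC s)
      (fun b => Away.mk (grading L ι) hs 1 (MvPolynomial.X b)
        (by rw [one_smul]; exact MvPolynomial.isHomogeneous_X L b)) m := by
  classical
  apply HomogeneousLocalization.val_injective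
  rw [Away.val_mk, MvPolynomial.eval₂_eq, ← HomogeneousLocalization.algebraMap_apply, map_sum]
  have h1 : ∀ e ∈ m.support, ∑ b ∈ e.support, e b = n := by
    intro e he
    have := hm (MvPolynomial.mem_support_iff.1 he)
    rw [smul_eq_mul, mul_one] at this
    exact (DFunLike.congr_fun (Finsupp.degree_eq_weight_one (R := ℕ)) e).trans this
  conv_lhs => rw [m.as_sum, Localization.mk_sum]
  refine Finset.sum_congr rfl fun e he => ?_
  rw [map_mul, map_prod, HomogeneousLocalization.algebraMap_apply, val_awayC]
  simp only [map_pow, HomogeneousLocalization.algebraMap_apply, Away.val_mk, Localization.mk_pow,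
    Localization.mk_prod]
  rw [← Localization.mk_one_eq_algebraMap, Localization.mk_mul, MvPolynomial.monomial_eq]
  congr 1
  ext
  simp [Finset.prod_pow_eq_pow_sum, h1 e he]

/-- The scalars in the sections over a basic open subset. -/
theorem scalars_str {d : ℕ} (hd : 0 < d) (s : grading L ι d) :
    scalars (PSpace.str L ι) (Proj.basicOpen _ (s : MvPolynomial ι L)) =
      CommRingCat.ofHom (awayC (s : MvPolynomial ι L)) ≫ Proj.awayToSection _ _ := by
  have h1 : Proj.awayι (grading L ι) (s : MvPolynomial ι L) s.2 hd ≫ PSpace.str L ι =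
      Spec.map (CommRingCat.ofHom (awayC (s : MvPolynomial ι L))) := by
    rw [PSpace.str, Proj.awayι_toSpecZero_assoc, ← Spec.map_comp]
    rfl
  apply toSpecΓ_comp_SpecMap_injective
  rw [← ι_comp_eq_toSpecΓ_comp_scalars, Spec.map_comp, ← h1, Proj.awayι, Category.assoc]
  have h2 : (Proj.basicOpen _ (s : MvPolynomial ι L)).toSpecΓ ≫
      Spec.map (Proj.awayToSection (grading L ι) (s : MvPolynomial ι L)) =
      (Proj.basicOpenIsoSpec (grading L ι) (s : MvPolynomial ι L) s.2 hd).hom :=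
    (Proj.basicOpenIsoSpec_hom _ _ _ _).symm
  rw [reassoc_of% h2, Iso.hom_inv_id_assoc]

theorem hom_ext_of_frac {s : grading L ι 1} {R : CommRingCat.{u}}
    {f g : Γ(PSpace L ι, Proj.basicOpen _ (s : MvPolynomial ι L)) ⟶ R}
    (h0 : scalars (PSpace.str L ι) _ ≫ f = scalars (PSpace.str L ι) _ ≫ g)
    (h : ∀ b, f (frac _ s (coord L b)) = g (frac _ s (coord L b))) : f = g := by
  rw [← cancel_epi (Proj.basicOpenIsoAway (grading L ι) (s : MvPolynomial ι L) s.2 one_pos).hom,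
    Proj.basicOpenIsoAway_hom]
  rw [scalars_str one_pos, Category.assoc, Category.assoc] at h0
  ext x
  obtain ⟨n, m, hm, rfl⟩ := Away.mk_surjective _ s.2 x
  rw [away_mk_eq_eval₂]
  have h1 : (f.hom.comp ((Proj.awayToSection _ _).hom.comp (awayC (s : MvPolynomial ι L)))) =
      (g.hom.comp ((Proj.awayToSection _ _).hom.comp (awayC (s : MvPolynomial ι L)))) :=
    congr($(h0).hom)
  simp only [CommRingCat.hom_comp, RingHom.comp_apply, MvPolynomial.hom_eval₂]
  congr 1
  ext b
  exact h b

/-- Two morphisms to projective space into the complement of a hyperplane are equal if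
the pullbacks of the affine coordinates are. -/
theorem ι_comp_eq_of_frac {T : Scheme.{u}} {f g : T ⟶ PSpace L ι}
    (h0 : f ≫ PSpace.str L ι = g ≫ PSpace.str L ι) (s : grading L ι 1) {V : T.Opens}
    (hf : V ≤ f ⁻¹ᵁ Proj.basicOpen _ (s : MvPolynomial ι L))
    (hg : V ≤ g ⁻¹ᵁ Proj.basicOpen _ (s : MvPolynomial ι L))
    (h : ∀ b, f.appLE _ V hf (frac _ s (coord L b)) = g.appLE _ V hg (frac _ s (coord L b))) :
    V.ι ≫ f = V.ι ≫ g := by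
  refine resLE_eq_of_appLE_eq (Proj.isAffineOpen_basicOpen _ _ s.2 one_pos) hf hg
    (hom_ext_of_frac ?_ h)
  rw [scalars_appLE, scalars_appLE, h0]

theorem isUnit_eval₂_coord (c : ι) {R : CommRingCat.{u}} (r : CommRingCat.of L ⟶ R) (φ : ι → R)
    (hφ : φ c = 1) : IsUnit (MvPolynomial.eval₂Hom r.hom φ (coord L c : MvPolynomial ι L)) :=
  isUnit_iff_exists_inv.mpr ⟨1, by simp [coord, hφ]⟩

/-- The ring homomorphism from the coordinate ring of `D₊(X c)` with given values at the affine
coordinates. -/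
noncomputable def chartHom (c : ι) {R : CommRingCat.{u}} (r : CommRingCat.of L ⟶ R) (φ : ι → R)
    (hφ : φ c = 1) : CommRingCat.of (Away (grading L ι) (coord L c : MvPolynomial ι L)) ⟶ R :=
  CommRingCat.ofHom ((Localization.awayLift (MvPolynomial.eval₂Hom r.hom φ)
    (coord L c : MvPolynomial ι L) (isUnit_eval₂_coord c r φ hφ)).comp
      (algebraMap _ _))

theorem chartHom_C (c : ι) {R : CommRingCat.{u}} (r : CommRingCat.of L ⟶ R) (φ : ι → R)
    (hφ : φ c = 1) : CommRingCat.ofHom (awayC _) ≫ chartHom c r φ hφ = r := by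
  ext a
  change Localization.awayLift _ _ (isUnit_eval₂_coord c r φ hφ) ((awayC _ a).val) = _
  rw [val_awayC, Localization.awayLift, IsLocalization.Away.lift_eq]
  simp

theorem chartHom_mk (c : ι) {R : CommRingCat.{u}} (r : CommRingCat.of L ⟶ R) (φ : ι → R)
    (hφ : φ c = 1) (m : grading L ι 1) : chartHom c r φ hφ
      (Away.mk (grading L ι) (coord L c).2 1 m (by rw [one_smul]; exact m.2)) =
      MvPolynomial.eval₂ r.hom φ m := by
  change Localization.awayLift _ _ (isUnit_eval₂_coord c r φ hφ)
    ((Away.mk _ (coord L c).2 _ _ _).val) = _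
  rw [Away.val_mk]
  refine (Localization.awayLift_mk _ _ _ 1 (by simp [coord, hφ]) 1).trans ?_
  simp

/-- The morphism from an open subset to projective space, in a chart. -/
noncomputable def chartMap (c : ι) {Y : Scheme.{u}} {V : Y.Opens} (r : CommRingCat.of L ⟶ Γ(Y, V))
    (φ : ι → Γ(Y, V)) (hφ : φ c = 1) : V.toScheme ⟶ PSpace L ι :=
  V.toSpecΓ ≫ Spec.map (chartHom c r φ hφ) ≫ Proj.awayι (grading L ι) _ (coord L c).2 one_pos

theorem chartMap_str (c : ι) {Y : Scheme.{u}} {V : Y.Opens} (r : CommRingCat.of L ⟶ Γ(Y, V))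
    (φ : ι → Γ(Y, V)) (hφ : φ c = 1) :
    chartMap c r φ hφ ≫ PSpace.str L ι = V.toSpecΓ ≫ Spec.map r := by
  have h1 : Proj.awayι (grading L ι) (coord L c : MvPolynomial ι L) (coord L c).2 one_pos ≫
      PSpace.str L ι = Spec.map (CommRingCat.ofHom (awayC (coord L c : MvPolynomial ι L))) := by
    rw [PSpace.str, Proj.awayι_toSpecZero_assoc, ← Spec.map_comp]
    rfl
  rw [chartMap, Category.assoc, Category.assoc, h1, ← Spec.map_comp, chartHom_C]

theorem chartMap_preimage (c : ι) {Y : Scheme.{u}} {V : Y.Opens} (r : CommRingCat.of L ⟶ Γ(Y, V))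
    (φ : ι → Γ(Y, V)) (hφ : φ c = 1) :
    chartMap c r φ hφ ⁻¹ᵁ Proj.basicOpen _ (coord L c : MvPolynomial ι L) = ⊤ := by
  rw [chartMap, Scheme.Hom.comp_preimage, Scheme.Hom.comp_preimage,
    ← Proj.opensRange_awayι _ _ (coord L c).2 one_pos, Scheme.Hom.preimage_opensRange]
  rfl

theorem chartMap_appLE (c : ι) {Y : Scheme.{u}} {V : Y.Opens} (r : CommRingCat.of L ⟶ Γ(Y, V))
    (φ : ι → Γ(Y, V)) (hφ : φ c = 1) (m : grading L ι 1) :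
    (chartMap c r φ hφ).appLE _ ⊤ (chartMap_preimage c r φ hφ).ge (frac _ (coord L c) m) =
      V.topIso.inv (MvPolynomial.eval₂ r.hom φ m) := by
  rw [← chartHom_mk c r φ hφ m]
  let D : (PSpace L ι).Opens := Proj.basicOpen (grading L ι) (coord L c : MvPolynomial ι L)
  obtain ⟨q, hq, h4⟩ : ∃ q : V.toScheme ⟶ D.toScheme,
      q ≫ Proj.basicOpenToSpec (grading L ι) (coord L c : MvPolynomial ι L) =
        V.toSpecΓ ≫ Spec.map (chartHom c r φ hφ) ∧ chartMap c r φ hφ = q ≫ D.ι := by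
    refine ⟨V.toSpecΓ ≫ Spec.map (chartHom c r φ hφ) ≫
      (Proj.basicOpenIsoSpec (grading L ι) _ (coord L c).2 one_pos).inv, ?_, ?_⟩
    · rw [← Proj.basicOpenIsoSpec_hom _ _ (coord L c).2 one_pos, Category.assoc, Category.assoc,
        Iso.inv_hom_id, Category.comp_id]
    · rw [chartMap, Proj.awayι, Category.assoc, Category.assoc]
  have h1 := congrArg Scheme.Hom.appTop hq
  rw [Scheme.Hom.comp_appTop, Scheme.Hom.comp_appTop, Scheme.Opens.toSpecΓ_appTop,
    Scheme.ΓSpecIso_naturality_assoc] at h1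
  have h2 := Proj.basicOpenToSpec_app_top (grading L ι) (coord L c : MvPolynomial ι L)
  change Scheme.Hom.appTop _ = _ at h2
  rw [h2, Category.assoc, cancel_epi] at h1
  have h3 : (chartMap c r φ hφ).appLE _ ⊤ (chartMap_preimage c r φ hφ).ge =
      D.topIso.inv ≫ q.appTop := by
    have h5 : ∀ (f : V.toScheme ⟶ PSpace L ι) (e : f = q ≫ D.ι) (h : ⊤ ≤ f ⁻¹ᵁ D),
        f.appLE D ⊤ h = D.topIso.inv ≫ q.appTop := by
      rintro _ rfl h
      exact comp_ι_appLE q h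
    exact h5 _ h4 _
  rw [h3]
  exact congr($(h1).hom _)

theorem comp_chartMap_appLE (c : ι) {T Y : Scheme.{u}} {V : Y.Opens}
    (r : CommRingCat.of L ⟶ Γ(Y, V)) (φ : ι → Γ(Y, V)) (hφ : φ c = 1) (t : T ⟶ V.toScheme)
    (h : ⊤ ≤ (t ≫ chartMap c r φ hφ) ⁻¹ᵁ Proj.basicOpen _ (coord L c : MvPolynomial ι L))
    (h' : ⊤ ≤ (t ≫ V.ι) ⁻¹ᵁ V) (m : grading L ι 1) :
    (t ≫ chartMap c r φ hφ).appLE _ ⊤ h (frac _ (coord L c) m) =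
      (t ≫ V.ι).appLE V ⊤ h' (MvPolynomial.eval₂ r.hom φ m) := by
  rw [comp_ι_appLE, CommRingCat.comp_apply, ← chartMap_appLE c r φ hφ m]
  rw [← Scheme.Hom.appLE_comp_appLE t _ _ ⊤ ⊤ (chartMap_preimage c r φ hφ).ge le_top,
    CommRingCat.comp_apply]
  have h9 : t.appLE ⊤ ⊤ (le_preimage_top t ⊤) = t.appTop := Scheme.Hom.appLE_eq_app t
  exact congr($(h9).hom _)

/-- A morphism to projective space from an atlas of ratios of coordinates. -/
theorem exists_hom_of_atlas {Y : Scheme.{u}} {α : Type u} (V : α → Y.Opens) (hV : ⨆ a, V a = ⊤)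
    (p : Y ⟶ Spec (CommRingCat.of L)) (c : α → ι) (f : ∀ a, ι → Γ(Y, V a))
    (hf : ∀ a, f a (c a) = 1)
    (hcoc : ∀ a a' b, Y.presheaf.map (homOfLE (inf_le_right : V a ⊓ V a' ≤ V a')).op (f a' b) =
      Y.presheaf.map (homOfLE (inf_le_right : V a ⊓ V a' ≤ V a')).op (f a' (c a)) *
        Y.presheaf.map (homOfLE (inf_le_left : V a ⊓ V a' ≤ V a)).op (f a b)) :
    ∃ i : Y ⟶ PSpace L ι, i ≫ PSpace.str L ι = p ∧
      ∀ a, ∃ h : V a ≤ i ⁻¹ᵁ Proj.basicOpen _ (coord L (c a) : MvPolynomial ι L),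
        ∀ m, i.appLE _ (V a) h (frac _ (coord L (c a)) m) =
          MvPolynomial.eval₂ (scalars p (V a)).hom (f a) m := by
  let D : ι → (PSpace L ι).Opens := fun b => Proj.basicOpen _ (coord L b : MvPolynomial ι L)
  let g : ∀ a, (V a).toScheme ⟶ PSpace L ι := fun a =>
    chartMap (c a) (scalars p (V a)) (f a) (hf a)
  have hg0 : ∀ a, g a ≫ PSpace.str L ι = (V a).ι ≫ p := fun a => by
    rw [chartMap_str, ← ι_comp_eq_toSpecΓ_comp_scalars]
  have hgD : ∀ {T : Scheme.{u}} a (t : T ⟶ (V a).toScheme), ⊤ ≤ (t ≫ g a) ⁻¹ᵁ D (c a) := by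
    intro T a t
    rw [Scheme.Hom.comp_preimage, chartMap_preimage]
    rfl
  have hcompat : ∀ a a', pullback.fst (V a).ι (V a').ι ≫ g a =
      pullback.snd (V a).ι (V a').ι ≫ g a' := by
    intro a a'
    generalize hu : pullback.fst (V a).ι (V a').ι = t
    generalize hu' : pullback.snd (V a).ι (V a').ι = t'
    have e : t ≫ (V a).ι = t' ≫ (V a').ι := by rw [← hu, ← hu', pullback.condition]
    have h1 : ⊤ ≤ (t ≫ (V a).ι) ⁻¹ᵁ V a := by simp
    have h2 : ⊤ ≤ (t' ≫ (V a').ι) ⁻¹ᵁ V a' := by simp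
    have h2' : ⊤ ≤ (t ≫ (V a).ι) ⁻¹ᵁ V a' := by rw [e]; exact h2
    have h3 : ⊤ ≤ (t ≫ (V a).ι) ⁻¹ᵁ (V a ⊓ V a') := fun x _ => ⟨h1 trivial, h2' trivial⟩
    have key : ∀ b, (t' ≫ (V a').ι).appLE _ ⊤ h2 (f a' b) =
        (t' ≫ (V a').ι).appLE _ ⊤ h2 (f a' (c a)) * (t ≫ (V a).ι).appLE _ ⊤ h1 (f a b) := by
      intro b
      have h4 : ∀ (q : pullback (V a).ι (V a').ι ⟶ Y) (e : q = t ≫ (V a).ι) (h : ⊤ ≤ q ⁻¹ᵁ V a'),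
        q.appLE _ ⊤ h = (t ≫ (V a).ι).appLE _ ⊤ h2' := by rintro _ rfl h; rfl
      rw [h4 _ e.symm]
      have h5 := congrArg ((t ≫ (V a).ι).appLE _ ⊤ h3) (hcoc a a' b)
      rw [map_mul, ← CommRingCat.comp_apply, ← CommRingCat.comp_apply, ← CommRingCat.comp_apply,
        Scheme.Hom.map_appLE, Scheme.Hom.map_appLE] at h5
      exact h5
    -- The cocycle condition for `b = c a'`, where `f a' b = 1`, makes `f a' (c a)` invertible on
    -- the overlap. Hence the chart map of `a'` also lands in the chart `c a` there, and the two
    -- maps can be compared.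
    have hunit : IsUnit ((t' ≫ (V a').ι).appLE _ ⊤ h2 (f a' (c a))) := by
      have h6 := key (c a')
      rw [hf, map_one] at h6
      exact IsUnit.of_mul_eq_one _ h6.symm
    have hev : ∀ a b, MvPolynomial.eval₂ (scalars p (V a)).hom (f a)
        (coord L b : MvPolynomial ι L) = f a b := fun a b => by simp [coord]
    have hval' : ∀ b, (t' ≫ g a').appLE (D (c a')) ⊤ (hgD a' t')
        (frac _ (coord L (c a')) (coord L b)) = (t' ≫ (V a').ι).appLE _ ⊤ h2 (f a' b) := by
      intro b
      rw [comp_chartMap_appLE _ _ _ _ _ _ h2, hev]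
    have hD' : ⊤ ≤ (t' ≫ g a') ⁻¹ᵁ D (c a) := by
      have h7 := Scheme.basicOpen_appLE (t' ≫ g a') ⊤ (D (c a')) (hgD a' t')
        (frac _ (coord L (c a')) (coord L (c a)))
      rw [hval', Scheme.basicOpen_of_isUnit _ hunit, basicOpen_frac, top_inf_eq] at h7
      rw [h7]
      exact fun x hx => hx.2
    have h8 : (⊤ : (pullback (V a).ι (V a').ι).Opens).ι ≫ t ≫ g a =
        (⊤ : (pullback (V a).ι (V a').ι).Opens).ι ≫ t' ≫ g a' := by
      refine ι_comp_eq_of_frac ?_ (coord L (c a)) (hgD a t) hD' fun b => ?_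
      · rw [Category.assoc, Category.assoc, hg0, hg0, ← Category.assoc, e, Category.assoc]
      · rw [comp_chartMap_appLE _ _ _ _ _ _ h1, hev]
        apply hunit.mul_left_cancel
        rw [← key, ← hval', ← hval']
        exact (appLE_frac_mul_frac _ _ _ _ _ _ _).symm
    have : IsIso (⊤ : (pullback (V a).ι (V a').ι).Opens).ι := by
      rw [← Scheme.topIso_hom]
      infer_instance
    rwa [cancel_epi] at h8
  let 𝒰 := Y.openCoverOfIsOpenCover V (.mk hV)
  let i : Y ⟶ PSpace L ι := 𝒰.glueMorphisms g hcompat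
  have hi : ∀ a, (V a).ι ≫ i = g a := fun a => 𝒰.ι_glueMorphisms g hcompat a
  refine ⟨i, ?_, fun a => ?_⟩
  · refine 𝒰.hom_ext _ _ fun a => ?_
    exact (Category.assoc _ _ _).symm.trans ((congrArg (· ≫ _) (hi a)).trans (hg0 a))
  · have h1 : V a ≤ i ⁻¹ᵁ D (c a) := by
      have h2 := hgD a (𝟙 _)
      rw [Category.id_comp, ← hi, Scheme.Hom.comp_preimage] at h2
      intro x hx
      exact h2 (show (⟨x, hx⟩ : V a) ∈ ⊤ from trivial)
    refine ⟨h1, fun m => ?_⟩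
    have h3 := chartMap_appLE (c a) (scalars p (V a)) (f a) (hf a) m
    have h4 : ∀ (q : (V a).toScheme ⟶ PSpace L ι) (e : q = (V a).ι ≫ i) (h : ⊤ ≤ q ⁻¹ᵁ D (c a)),
        q.appLE (D (c a)) ⊤ h = i.appLE _ (V a) h1 ≫ (V a).topIso.inv := by
      rintro _ rfl h
      rw [← ι_appLE (V a) (by simp), Scheme.Hom.appLE_comp_appLE]
    rw [h4 _ (hi a).symm, CommRingCat.comp_apply] at h3
    exact (ConcreteCategory.bijective_of_isIso (V a).topIso.inv).1 h3

end ProjectiveSpace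

/-! ### Charts of projective space and affine morphisms to it -/

section ProjectiveSpaceFacts

attribute [local instance] MvPolynomial.gradedAlgebra

variable {L : Type u} [Field L] {ι : Type}

/-- The complement of a coordinate hyperplane. -/
noncomputable abbrev chart (L : Type u) [Field L] {ι : Type} (b : ι) : (PSpace L ι).Opens :=
  Proj.basicOpen (grading L ι) (coord L b : MvPolynomial ι L)

theorem isAffineOpen_chart (b : ι) : IsAffineOpen (chart L b) :=
  Proj.isAffineOpen_basicOpen _ _ (coord L b).2 one_pos

theorem iSup_chart : ⨆ b : ι, chart L b = ⊤ := by
  suffices h : Algebra.adjoin (grading L ι 0)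
      (Set.range fun b : ι => (coord L b : MvPolynomial ι L)) = ⊤ by
    exact Proj.iSup_basicOpen_eq_top' (grading L ι) _ (fun b => ⟨1, (coord L b).2⟩) h
  rw [eq_top_iff]
  rintro m -
  induction m using MvPolynomial.induction_on with
  | C a =>
    exact Subalgebra.algebraMap_mem _ (⟨MvPolynomial.C a, MvPolynomial.isHomogeneous_C _ _⟩ :
      grading L ι 0)
  | add p q hp hq => exact add_mem hp hq
  | mul_X p b hp => exact mul_mem hp (Algebra.subset_adjoin ⟨b, rfl⟩)

theorem isAffineHom_of_chart {Y : Scheme.{u}} (i : Y ⟶ PSpace L ι)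
    (h : ∀ b, IsAffineOpen (i ⁻¹ᵁ chart L b)) : IsAffineHom i := by
  refine isAffineHom_of_forall_exists_isAffineOpen _ fun x => ?_
  have hx : x ∈ ⨆ b : ι, chart L b := by rw [iSup_chart]; trivial
  obtain ⟨b, hb⟩ := Opens.mem_iSup.1 hx
  exact ⟨_, hb, isAffineOpen_chart b, h b⟩

theorem iSup_preimage_chart {Y : Scheme.{u}} (i : Y ⟶ PSpace L ι) :
    ⨆ b : ι, i ⁻¹ᵁ chart L b = ⊤ := by
  rw [← Scheme.Hom.preimage_iSup, iSup_chart, Scheme.Hom.preimage_top]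

instance [Finite ι] : LocallyOfFiniteType (PSpace.str L ι) := by
  have : IsScalarTower L (grading L ι 0) (MvPolynomial ι L) :=
    ⟨fun a b c => smul_mul_assoc a (b : MvPolynomial ι L) c⟩
  have h1 : Algebra.FiniteType (grading L ι 0) (MvPolynomial ι L) :=
    Algebra.FiniteType.of_restrictScalars_finiteType L _ _
  have h2 : LocallyOfFiniteType (Spec.map (CommRingCat.ofHom
      (algebraMap L (grading L ι 0)))) := by
    rw [HasRingHomProperty.Spec_iff (P := @LocallyOfFiniteType)]
    refine RingHom.FiniteType.of_surjective _ ?_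
    rintro ⟨m, hm⟩
    obtain ⟨a, ha⟩ := (MvPolynomial.mem_homogeneousSubmodule 0 m).1 hm |> fun h =>
      MvPolynomial.totalDegree_eq_zero_iff_eq_C.1 (Nat.le_zero.1 h.totalDegree_le) |> fun h =>
      (⟨_, h⟩ : ∃ a, m = MvPolynomial.C a)
    exact ⟨a, Subtype.ext ha.symm⟩
  rw [PSpace.str]
  infer_instance

instance [Finite ι] : LocallyOfFinitePresentation (PSpace.str L ι) :=
  LocallyOfFinitePresentation.iff_locallyOfFiniteType.2 inferInstance

instance [Finite ι] : IsNoetherian (PSpace L ι) := by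
  have := LocallyOfFiniteType.isLocallyNoetherian (PSpace.str L ι)
  have : CompactSpace (PSpace L ι) := by
    rw [← isCompact_univ_iff, ← Opens.coe_top, ← iSup_chart (L := L) (ι := ι), Opens.coe_iSup]
    exact isCompact_iUnion fun b => (isAffineOpen_chart b).isCompact
  exact { }

instance : IsSeparated (PSpace.str L ι) := by
  rw [PSpace.str]
  infer_instance

/-- At a point of `V a'`, lying over the chart `c a` means that the ratio `f a' (c a)` does not
vanish, and `hle` places this locus inside `V a`. -/
theorem preimage_chart_of_atlas {Y : Scheme.{u}} {α : Type*} {V : α → Y.Opens} (hV : ⨆ a, V a = ⊤)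
    {i : Y ⟶ PSpace L ι} {c : α → ι} {f : ∀ a, ι → Γ(Y, V a)}
    (h : ∀ a, V a ≤ i ⁻¹ᵁ chart L (c a))
    (hi : ∀ a b, i.appLE _ (V a) (h a) (frac _ (coord L (c a)) (coord L b)) = f a b) (a : α)
    (hle : ∀ a', Y.basicOpen (f a' (c a)) ≤ V a) : i ⁻¹ᵁ chart L (c a) = V a := by
  refine le_antisymm (fun x hx => ?_) (h a)
  have hx' : x ∈ ⨆ a, V a := by rw [hV]; trivial
  obtain ⟨a', ha'⟩ := Opens.mem_iSup.1 hx'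
  refine hle a' ?_
  rw [← hi, Scheme.basicOpen_appLE, basicOpen_frac]
  exact ⟨ha', h a' ha', hx⟩

/-- Finitely many families of forms of the same degree define, by products of
ratios, a morphism to projective space over any field. -/
theorem exists_hom_of_forms [Finite ι] {σ : Type*} {A : Type u} [CommRing A] [SetLike σ A]
    [AddSubgroupClass σ A] (𝒜 : ℕ → σ) [GradedRing 𝒜] {C : Type*} [Fintype C] {Y : Scheme.{u}}
    (q : C → (Y ⟶ Proj 𝒜)) {d : ℕ} (s : ι → 𝒜 d) (V : ι → Y.Opens) (hV : ⨆ a, V a = ⊤)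
    (hVs : ∀ a x, x ∈ V a ↔ ∀ y, x ∈ q y ⁻¹ᵁ Proj.basicOpen 𝒜 (s a : A))
    (p : Y ⟶ Spec (CommRingCat.of L)) :
    ∃ i : Y ⟶ PSpace L ι, i ≫ PSpace.str L ι = p ∧ (∀ a, i ⁻¹ᵁ chart L a = V a) ∧
      ∀ a (h : V a ≤ i ⁻¹ᵁ chart L a) b, i.appLE _ (V a) h (frac _ (coord L a) (coord L b)) =
        ∏ y, (q y).appLE _ (V a) (fun x hx => (hVs a x).1 hx y) (frac 𝒜 (s a) (s b)) := by
  let f : ∀ a : ι, ι → Γ(Y, V a) := fun a b =>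
    ∏ y, (q y).appLE _ (V a) (fun x hx => (hVs a x).1 hx y) (frac 𝒜 (s a) (s b))
  have hV' : ⨆ a : ULift.{u} ι, V a.down = ⊤ := by
    rw [← hV]
    exact Equiv.ulift.iSup_congr fun _ => rfl
  obtain ⟨i, hi0, hi⟩ := exists_hom_of_atlas (α := ULift.{u} ι) (fun a => V a.down) hV' p
    (fun a => a.down) (fun a => f a.down) (fun a => by simp [f, frac_self]) (by
      rintro ⟨a⟩ ⟨a'⟩ b
      simp only [f, map_prod, ← Finset.prod_mul_distrib]
      refine Finset.prod_congr rfl fun y _ => ?_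
      simp only [← CommRingCat.comp_apply, Scheme.Hom.appLE_map]
      rw [appLE_frac_mul_frac])
  have hi' : ∀ (a : ι) (h : V a ≤ i ⁻¹ᵁ chart L a) b,
      i.appLE _ (V a) h (frac _ (coord L a) (coord L b)) = f a b := fun a h b => by
    obtain ⟨h1, h2⟩ := hi ⟨a⟩
    refine (h2 (coord L b)).trans ?_
    simp [coord]
  refine ⟨i, hi0, fun a => ?_, hi'⟩
  refine preimage_chart_of_atlas (c := fun a : ι => a) hV (fun a => (hi ⟨a⟩).1)
    (fun a => hi' a _) a fun a' x hx => ?_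
  rw [hVs]
  intro y
  have hxa : x ∈ V a' := Scheme.basicOpen_le _ _ hx
  have h1 : x ∈ Y.basicOpen ((q y).appLE _ (V a') (fun x hx => (hVs a' x).1 hx y)
      (frac 𝒜 (s a') (s a))) := by
    rw [Scheme.mem_basicOpen _ _ _ hxa] at hx ⊢
    exact isUnit_of_dvd_unit (map_dvd _ (Finset.dvd_prod_of_mem (fun y => (q y).appLE _ (V a')
      (fun x hx => (hVs a' x).1 hx y) (frac 𝒜 (s a') (s a))) (Finset.mem_univ y))) hx
  rw [Scheme.basicOpen_appLE, basicOpen_frac] at h1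
  exact h1.2.2

theorem exists_form_of_mem {σ : Type*} {A : Type u} [CommRing A] [SetLike σ A]
    [AddSubgroupClass σ A] (𝒜 : ℕ → σ) [GradedRing 𝒜] {O : (Proj 𝒜).Opens} {x : Proj 𝒜}
    (hx : x ∈ O) : ∃ (d : ℕ) (s : 𝒜 d), x ∈ Proj.basicOpen 𝒜 (s : A) ∧
      Proj.basicOpen 𝒜 (s : A) ≤ O := by
  obtain ⟨_, ⟨f, rfl⟩, hf, hfO⟩ := Opens.isBasis_iff_nbhd.1 (Proj.isBasis_basicOpen 𝒜) hx
  rw [Proj.basicOpen_eq_iSup_proj] at hf hfO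
  obtain ⟨d, hd⟩ := Opens.mem_iSup.1 hf
  exact ⟨d, ⟨_, SetLike.coe_mem (DirectSum.decompose 𝒜 f d)⟩, hd,
    (le_iSup (fun i => Proj.basicOpen 𝒜 (GradedRing.proj 𝒜 i f)) d).trans hfO⟩

/-- A quasi-projective scheme over `K` has an affine morphism to a projective space over any
field. -/
theorem exists_isAffineHom_of_isImmersion {K : Type u} [Field K] {κ : Type} [Finite κ]
    {Y : Scheme.{u}} (q : Y ⟶ PSpace K κ) [IsImmersion q] (p : Y ⟶ Spec (CommRingCat.of L)) :
    ∃ (m : ℕ) (i : Y ⟶ PSpace L (Fin m)), i ≫ PSpace.str L (Fin m) = p ∧ IsAffineHom i := by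
  classical
  have : NoetherianSpace Y := q.isEmbedding.isInducing.noetherianSpace
  have h1 : ∀ y : Y, ∃ (d : ℕ) (s : grading K κ d), 0 < d ∧
      y ∈ q ⁻¹ᵁ Proj.basicOpen _ (s : MvPolynomial κ K) ∧
      Proj.basicOpen _ (s : MvPolynomial κ K) ≤ q.coborderRange := by
    intro y
    obtain ⟨d, s, hs, hsO⟩ := exists_form_of_mem (grading K κ) (O := q.coborderRange)
      (x := q y) (subset_coborder ⟨y, rfl⟩)
    have hy : q y ∈ ⨆ b : κ, chart K b := by rw [iSup_chart]; trivial
    obtain ⟨b, hb⟩ := Opens.mem_iSup.1 hy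
    -- Multiplication by a coordinate ensures positive degree, as needed for `D₊(s)` to be affine.
    refine ⟨d + 1, ⟨s * coord K b, SetLike.mul_mem_graded s.2 (coord K b).2⟩, d.succ_pos, ?_, ?_⟩
    · change q y ∈ Proj.basicOpen _ _
      rw [Proj.basicOpen_mul]
      exact ⟨hs, hb⟩
    · refine le_trans ?_ hsO
      rw [Proj.basicOpen_mul]
      exact inf_le_left
  choose d s hd hys hs using h1
  obtain ⟨t, -, ht⟩ := isCompact_univ.elim_nhds_subcover
    (fun y => (q ⁻¹ᵁ Proj.basicOpen _ (s y : MvPolynomial κ K) : Set Y))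
    (fun y _ => (q ⁻¹ᵁ _).2.mem_nhds (hys y))
  -- A common multiple of the degrees. Suitable powers bring all forms to degree `D` without
  -- changing their non-vanishing loci, so their ratios are functions.
  let D := ∏ y ∈ t, d y
  have hD : ∀ y ∈ t, 0 < D / d y := fun y hy => Nat.div_pos
    (Nat.le_of_dvd (Finset.prod_pos fun y _ => hd y) (Finset.dvd_prod_of_mem d hy)) (hd y)
  let e := t.equivFin.symm
  let s' : Fin t.card → grading K κ D := fun a => ⟨(s (e a) : MvPolynomial κ K) ^ (D / d (e a)), by
    have := SetLike.pow_mem_graded (D / d (e a)) (s (e a)).2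
    rwa [smul_eq_mul, Nat.div_mul_cancel (Finset.dvd_prod_of_mem d (e a).2)] at this⟩
  have hs' : ∀ a, Proj.basicOpen (grading K κ) (s' a : MvPolynomial κ K) =
      Proj.basicOpen (grading K κ) (s (e a) : MvPolynomial κ K) := fun a =>
    Proj.basicOpen_pow _ _ _ (hD _ (e a).2)
  obtain ⟨i, hi, hi', -⟩ := exists_hom_of_forms (grading K κ) (C := Unit) (fun _ => q) s'
    (fun a => q ⁻¹ᵁ Proj.basicOpen _ (s (e a) : MvPolynomial κ K)) (by
      rw [eq_top_iff]
      intro x _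
      obtain ⟨y, hy, hx⟩ := Set.mem_iUnion₂.1 (ht (Set.mem_univ x))
      have he : e (t.equivFin ⟨y, hy⟩) = ⟨y, hy⟩ := Equiv.symm_apply_apply _ _
      exact Opens.mem_iSup.2 ⟨t.equivFin ⟨y, hy⟩, by rw [he]; exact hx⟩)
    (fun a x => by simp [hs']) p
  refine ⟨_, i, hi, isAffineHom_of_chart i fun a => ?_⟩
  rw [hi']
  -- The immersion `q` is closed in its coborder, an open set containing `D₊(s)`. So the preimage of
  -- `D₊(s)` is closed in an affine scheme.
  have h2 := ((Proj.isAffineOpen_basicOpen (grading K κ) _ (s (e a)).2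
    (hd (e a))).preimage_of_isOpenImmersion
    q.coborderRange.ι (by simpa using hs (e a))).preimage q.liftCoborder
  rwa [← Scheme.Hom.comp_preimage, Scheme.Hom.liftCoborder_ι] at h2

end ProjectiveSpaceFacts

/-! ### Schematically dense open subsets -/

section SchematicallyDense

theorem IsSchematicallyDense.top (X : Scheme.{u}) : IsSchematicallyDense (⊤ : X.Opens) := by
  intro V s t h
  have h2 : V ≤ V ⊓ ⊤ := le_inf le_rfl le_top
  have h1 := congrArg (X.presheaf.map (homOfLE h2).op) h
  rw [← CommRingCat.comp_apply, ← CommRingCat.comp_apply, ← Functor.map_comp] at h1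
  have h3 : (homOfLE (inf_le_left : V ⊓ ⊤ ≤ V)).op ≫ (homOfLE h2).op = 𝟙 _ := rfl
  rw [h3, X.presheaf.map_id] at h1
  exact h1

theorem IsSchematicallyDense.iInf {X : Scheme.{u}} {κ : Type*} [Finite κ] {U : κ → X.Opens}
    (hU : ∀ i, IsSchematicallyDense (U i)) : IsSchematicallyDense (⨅ i, U i) := by
  classical
  have := Fintype.ofFinite κ
  suffices h : ∀ s : Finset κ, IsSchematicallyDense (⨅ i ∈ s, U i) by
    have h1 := h Finset.univ
    simp only [Finset.mem_univ, iInf_pos] at h1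
    exact h1
  intro s
  induction s using Finset.induction_on with
  | empty => simpa using IsSchematicallyDense.top X
  | insert a s ha ih =>
    rw [Finset.iInf_insert]
    exact (hU a).inf ih

theorem hom_ext_of_isSchematicallyDense {X Z : Scheme.{u}} [Z.IsSeparated] {f g : X ⟶ Z}
    {U : X.Opens} (hU : IsSchematicallyDense U) (h : U.ι ≫ f = U.ι ≫ g) : f = g := by
  refine hom_ext_of_jointly_injective (fun _ : Unit => U.ι) (fun V : X.affineOpens => V)
    (iSup_affineOpens_eq_top X) (fun V s hs => ?_) fun _ => h
  apply hU V.1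
  rw [map_zero]
  have h1 := hs ()
  rw [Scheme.Opens.ι_app] at h1
  have h2 : V.1 ⊓ U ≤ U.ι ''ᵁ U.ι ⁻¹ᵁ V.1 := fun x hx => ⟨⟨x, hx.2⟩, hx.1, rfl⟩
  have h3 := (congrArg (X.presheaf.map (homOfLE h2).op) h1).trans (map_zero _)
  exact (ConcreteCategory.congr_hom (X.presheaf.map_comp _ (homOfLE h2).op) s).trans h3

/-- An open subset is schematically dense if it contains, in each member of an affine open cover,
the non-vanishing locus of a non-zero-divisor. -/
theorem isSchematicallyDense_of_nonZeroDivisors {X : Scheme.{u}} {W : X.Opens} {κ : Type*}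
    (U : κ → X.Opens) (hU : ∀ a, IsAffineOpen (U a)) (hcov : ⨆ a, U a = ⊤) (f : ∀ a, Γ(X, U a))
    (hf : ∀ a, f a ∈ nonZeroDivisors Γ(X, U a)) (hW : ∀ a, X.basicOpen (f a) ≤ W) :
    IsSchematicallyDense W := by
  intro V
  rw [injective_iff_map_eq_zero]
  intro d hd
  refine TopCat.Presheaf.section_ext X.sheaf V _ _ fun x hx => ?_
  have hx' : x ∈ ⨆ a, U a := by rw [hcov]; trivial
  obtain ⟨a, ha⟩ := Opens.mem_iSup.1 hx'
  obtain ⟨g, hg, hxg⟩ := (hU a).exists_basicOpen_le ⟨x, hx⟩ ha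
  -- Near `x`, a power of `g` times `d` extends to `z` on `U a`. Since `d` vanishes on `W`, a power
  -- of `f a * g` kills `z`. The factor `f a` can be cancelled and `g` is invertible near `x`, so `d
  -- = 0` there.
  obtain ⟨n, z, hz⟩ := exists_eq_pow_mul_of_isAffineOpen X (U a) (hU a) g
    (X.presheaf.map (homOfLE hg).op d)
  have hz' : X.presheaf.map (homOfLE (X.basicOpen_le g)).op z =
      (X.presheaf.map (homOfLE (X.basicOpen_le g)).op g) ^ n *
        X.presheaf.map (homOfLE hg).op d := hz
  have h1 : X.basicOpen (f a * g) ≤ V ⊓ W := by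
    rw [Scheme.basicOpen_mul]
    exact le_inf (inf_le_right.trans hg) (inf_le_left.trans (hW a))
  have h2 : X.basicOpen (f a * g) ≤ X.basicOpen g := by
    rw [Scheme.basicOpen_mul]
    exact inf_le_right
  have h3 : X.presheaf.map (homOfLE (X.basicOpen_le (f a * g))).op z = 0 := by
    have h4 := congrArg (X.presheaf.map (homOfLE h2).op) hz'
    have h5 := congrArg (X.presheaf.map (homOfLE h1).op) hd
    rw [map_zero, ← CommRingCat.comp_apply, ← Functor.map_comp] at h5
    have h6 : X.presheaf.map (homOfLE h2).op (X.presheaf.map (homOfLE hg).op d) = 0 := by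
      rw [← CommRingCat.comp_apply, ← Functor.map_comp]
      exact h5
    rw [map_mul, h6, mul_zero, ← CommRingCat.comp_apply, ← Functor.map_comp] at h4
    exact h4
  obtain ⟨m, hm⟩ := exists_pow_mul_eq_zero_of_res_basicOpen_eq_zero_of_isAffineOpen X (hU a) z
    (f a * g) h3
  rw [mul_pow, mul_assoc, mul_left_mem_nonZeroDivisors_eq_zero_iff (pow_mem (hf a) m)] at hm
  have h7 : X.presheaf.map (homOfLE hg).op d = 0 := by
    have hu : IsUnit (X.presheaf.map (homOfLE (X.basicOpen_le g)).op g) :=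
      RingedSpace.isUnit_res_basicOpen X.toRingedSpace g
    have h8 := congrArg (X.presheaf.map (homOfLE (X.basicOpen_le g)).op) hm
    rw [map_mul, map_zero, hz', map_pow] at h8
    exact ((hu.pow n).mul_right_eq_zero).1 (((hu.pow m).mul_right_eq_zero).1 h8)
  change X.presheaf.germ V x hx d = X.presheaf.germ V x hx 0
  rw [map_zero]
  have h9 := X.presheaf.germ_res_apply (homOfLE hg) x hxg d
  refine h9.symm.trans ?_
  rw [h7]
  exact map_zero _

end SchematicallyDense

/-! ### Linear forms in general position -/

section LinearForms

attribute [local instance] MvPolynomial.gradedAlgebra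

variable {L : Type u} [Field L] {ι : Type}

theorem frac_smul (s : grading L ι 1) (a : L) (m : grading L ι 1) :
    frac _ s (a • m) = scalars (PSpace.str L ι) _ a * frac _ s m := by
  rw [scalars_str one_pos, CommRingCat.comp_apply, frac, frac, ← map_mul]
  congr 1
  apply HomogeneousLocalization.val_injective
  rw [HomogeneousLocalization.val_mul]
  change _ = (awayC _ a).val * _
  rw [val_awayC, HomogeneousLocalization.Away.val_mk, HomogeneousLocalization.Away.val_mk,
    ← Localization.mk_one_eq_algebraMap, Localization.mk_mul, one_mul]
  congr 1
  exact MvPolynomial.smul_eq_C_mul _ _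

variable [Infinite L]

/-- Finitely many points of projective space over an infinite field lie off a hyperplane. -/
theorem exists_linearForm_of_points {J : Type*} [Finite J] (x : J → PSpace L ι) :
    ∃ s : grading L ι 1, ∀ j, x j ∈ Proj.basicOpen _ (s : MvPolynomial ι L) := by
  by_contra! H
  -- The forms vanishing at a point are a subspace. A vector space over an infinite field is not a
  -- finite union of proper subspaces, and each subspace here is proper because some coordinate does
  -- not vanish at the point.
  let P : J → Submodule L (grading L ι 1) := fun j =>
    ((idealAt (grading L ι) (x j)).restrictScalars L).comap (Submodule.subtype _)
  obtain ⟨j, hj⟩ := Subspace.exists_eq_top_of_iUnion_eq_univ (p := P) (by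
    rw [Set.eq_univ_iff_forall]
    intro s
    obtain ⟨j, hj⟩ := H s
    exact Set.mem_iUnion.2 ⟨j, not_not.1 hj⟩)
  have hx : x j ∈ ⨆ b : ι, chart L b := by rw [iSup_chart]; trivial
  obtain ⟨b, hb⟩ := Opens.mem_iSup.1 hx
  have h1 : coord L b ∈ P j := by rw [hj]; trivial
  exact hb h1

/-- A linear form that is a non-zero-divisor in each of finitely many charts. -/
theorem exists_linearForm_nonZeroDivisors {Y : Scheme.{u}} [IsLocallyNoetherian Y]
    (i : Y ⟶ PSpace L ι) {T : Type*} [Finite T] (c : T → ι)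
    (hc : ∀ a, IsAffineOpen (i ⁻¹ᵁ chart L (c a))) :
    ∃ s : grading L ι 1, ∀ a, i.app _ (frac _ (coord L (c a)) s) ∈
      nonZeroDivisors Γ(Y, i ⁻¹ᵁ chart L (c a)) := by
  have hN : ∀ a, IsNoetherianRing Γ(Y, i ⁻¹ᵁ chart L (c a)) := fun a =>
    IsLocallyNoetherian.component_noetherian ⟨_, hc a⟩
  -- Zero divisors of a Noetherian ring form the union of its finitely many associated primes, so
  -- only finitely many subspaces of linear forms have to be avoided. Each is proper: the chart's
  -- own coordinate gives the function `1`.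
  let J := Σ a, associatedPrimes Γ(Y, i ⁻¹ᵁ chart L (c a)) Γ(Y, i ⁻¹ᵁ chart L (c a))
  have : ∀ a, Finite (associatedPrimes Γ(Y, i ⁻¹ᵁ chart L (c a)) Γ(Y, i ⁻¹ᵁ chart L (c a))) :=
    fun a => associatedPrimes.finite _ _
  by_contra! H
  let P : J → Submodule L (grading L ι 1) := fun j =>
    { carrier := {m | i.app _ (frac _ (coord L (c j.1)) m) ∈ j.2.1}
      add_mem' := fun {m m'} hm hm' => by
        rw [Set.mem_ofPred_eq, frac_add, map_add]
        exact add_mem hm hm'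
      zero_mem' := by
        have h : frac (grading L ι) (coord L (c j.1)) 0 = 0 := by
          simpa using frac_add (grading L ι) (coord L (c j.1)) 0 0
        rw [Set.mem_ofPred_eq, h, map_zero]
        exact zero_mem _
      smul_mem' := fun a m hm => by
        rw [Set.mem_ofPred_eq, frac_smul, map_mul]
        exact Ideal.mul_mem_left _ _ hm }
  obtain ⟨j, hj⟩ := Subspace.exists_eq_top_of_iUnion_eq_univ (p := P) (by
    rw [Set.eq_univ_iff_forall]
    intro s
    obtain ⟨a, ha⟩ := H s
    have h1 := Set.ext_iff.1 (biUnion_associatedPrimes_eq_compl_nonZeroDivisors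
      Γ(Y, i ⁻¹ᵁ chart L (c a))) (i.app _ (frac _ (coord L (c a)) s))
    obtain ⟨q, hq, hq'⟩ := Set.mem_iUnion₂.1 (h1.2 ha)
    exact Set.mem_iUnion.2 ⟨⟨a, q, hq⟩, hq'⟩)
  have h1 : coord L (c j.1) ∈ P j := by rw [hj]; trivial
  have h2 : i.app _ (frac _ (coord L (c j.1)) (coord L (c j.1))) ∈ j.2.1 := h1
  rw [frac_self, map_one] at h2
  exact (j.2.2.isPrime).ne_top ((Ideal.eq_top_iff_one _).2 h2)

end LinearForms

/-! ### Continuity for morphisms to projective space -/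

section Continuity

attribute [local instance] MvPolynomial.gradedAlgebra

theorem specAut_comp {𝕜 F K : Type u} [Field 𝕜] [Field F] [Field K] [Algebra 𝕜 F] [Algebra 𝕜 K]
    [Algebra F K] [IsScalarTower 𝕜 F K] (σ : K ≃ₐ[F] K) :
    specAut σ ≫ Spec.map (CommRingCat.ofHom (algebraMap 𝕜 K)) =
      Spec.map (CommRingCat.ofHom (algebraMap 𝕜 K)) := by
  rw [← Spec.map_comp, ← CommRingCat.ofHom_comp]
  congr 2
  exact (σ.restrictScalars 𝕜).toAlgHom.comp_algebraMap

theorem GaloisAct.act_comp_algebraMap {𝕜 F K : Type u} [Field 𝕜] [Field F] [Field K] [Algebra 𝕜 F]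
    [Algebra 𝕜 K] [Algebra F K] [IsScalarTower 𝕜 F K] {Y : Scheme.{u}}
    {p : Y ⟶ Spec (CommRingCat.of K)} (A : GaloisAct F p) (σ : K ≃ₐ[F] K) :
    A.act σ ≫ p ≫ Spec.map (CommRingCat.ofHom (algebraMap 𝕜 K)) =
      p ≫ Spec.map (CommRingCat.ofHom (algebraMap 𝕜 K)) := by
  rw [reassoc_of% A.act_over σ, specAut_comp]

variable {k K : Type u} [Field k] [CharZero k] [Field K] [Algebra k K]

/-- A morphism to a projective space is defined over a finitely generated field. -/
theorem DescentDatum.IsContinuous.exists_finset {Y : Over (Spec (CommRingCat.of K))}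
    {φ : DescentDatum k Y} (hφ : φ.IsContinuous) [IsLocallyNoetherian Y.left] {ι : Type} [Finite ι]
    (i : Y.left ⟶ PSpace k ι)
    (hi : i ≫ PSpace.str k ι = Y.hom ≫ Spec.map (CommRingCat.ofHom (algebraMap k K)))
    {T : Type*} [Finite T] (c : T → ι) (hc : ∀ a, IsAffineOpen (i ⁻¹ᵁ chart k (c a)))
    (hcov : ⨆ a, i ⁻¹ᵁ chart k (c a) = ⊤) :
    ∃ S : Finset K, ∀ σ : K ≃ₐ[k] K, (∀ x ∈ S, σ x = x) → φ.galoisAct.act σ ≫ i = i := by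
  classical
  obtain ⟨s, hs⟩ := exists_linearForm_nonZeroDivisors i c hc
  let D : (PSpace k ι).Opens := Proj.basicOpen _ (s : MvPolynomial ι k)
  have hD : IsSchematicallyDense (i ⁻¹ᵁ D) := by
    refine isSchematicallyDense_of_nonZeroDivisors _ hc hcov _ hs fun a => ?_
    rw [← Scheme.Hom.preimage_basicOpen, basicOpen_frac]
    exact fun x hx => hx.2
  -- The affine coordinates `X b / s` on the schematically dense open set `i⁻¹ D₊(s)` are rational
  -- functions, to which continuity applies. There are finitely many of them, and they determine
  -- `i`.
  let f : ι → PartialFunction Y.left := fun b => ⟨i ⁻¹ᵁ D, hD, i.app D (frac _ s (coord k b))⟩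
  choose M hM hMf using fun b => hφ ⟦f b⟧
  choose S hS using hM
  have := Fintype.ofFinite ι
  refine ⟨Finset.univ.biUnion S, fun σ hσ => ?_⟩
  have h1 : ∀ b, σ ∈ (M b).fixingSubgroup := by
    intro b
    rw [← hS b, IntermediateField.mem_fixingSubgroup_iff]
    intro x hx
    induction hx using IntermediateField.adjoin_induction with
    | mem x hx => exact hσ x (Finset.mem_biUnion.2 ⟨b, Finset.mem_univ b, hx⟩)
    | algebraMap x => exact σ.commutes x
    | add x y _ _ hx hy => rw [map_add, hx, hy]
    | inv x _ hx => rw [map_inv₀, hx]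
    | mul x y _ _ hx hy => rw [map_mul, hx, hy]
  have h2 : ∀ b, (PartialFunction.pullback (φ.schemeIso σ⁻¹) (f b)).Equiv (f b) := fun b =>
    Quotient.exact (hMf b σ (h1 b))
  choose W hW hW1 hW2 hWeq using h2
  have hW1' : ∀ b, W b ≤ (φ.galoisAct.act σ ≫ i) ⁻¹ᵁ D := hW1
  have hW2' : ∀ b, W b ≤ i ⁻¹ᵁ D := hW2
  have hWeq' : ∀ b, (φ.galoisAct.act σ ≫ i).appLE D (W b) (hW1' b) (frac _ s (coord k b)) =
    i.appLE D (W b) (hW2' b) (frac _ s (coord k b)) := hWeq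
  -- Projective space with no coordinates is empty, and then so is `Y`.
  rcases isEmpty_or_nonempty ι with hι | ⟨⟨b₀⟩⟩
  · have : IsEmpty Y.left := ⟨fun y => by
      have h3 : i y ∈ ⨆ b : ι, chart k b := by rw [iSup_chart]; trivial
      obtain ⟨b, -⟩ := Opens.mem_iSup.1 h3
      exact isEmptyElim b⟩
    exact (isInitialOfIsEmpty (X := Y.left)).hom_ext _ _
  refine hom_ext_of_isSchematicallyDense (IsSchematicallyDense.iInf hW) ?_
  refine ι_comp_eq_of_frac ?_ s ((iInf_le W b₀).trans (hW1' b₀)) ((iInf_le W b₀).trans (hW2' b₀))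
    fun b => ?_
  · rw [Category.assoc, hi, GaloisAct.act_comp_algebraMap]
  · have h4 := congrArg (Y.left.presheaf.map (homOfLE (iInf_le W b)).op) (hWeq' b)
    rw [← CommRingCat.comp_apply, ← CommRingCat.comp_apply, Scheme.Hom.appLE_map,
      Scheme.Hom.appLE_map] at h4
    exact h4

end Continuity

/-! ### Restriction maps and pull-back of functions -/

section Restriction

variable {X Y : Scheme.{u}}

/-- Restriction of functions. -/
noncomputable def res {U V : X.Opens} (h : V ≤ U) : Γ(X, U) →+* Γ(X, V) :=
  (X.presheaf.map (homOfLE h).op).hom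

theorem res_res {U V W : X.Opens} (h : V ≤ U) (h' : W ≤ V) (s : Γ(X, U)) :
    res h' (res h s) = res (h'.trans h) s :=
  (ConcreteCategory.congr_hom (X.presheaf.map_comp (homOfLE h).op (homOfLE h').op) s).symm

theorem res_self {U : X.Opens} (s : Γ(X, U)) : res le_rfl s = s :=
  ConcreteCategory.congr_hom (X.presheaf.map_id _) s

theorem res_appLE (f : X ⟶ Y) {U : Y.Opens} {V W : X.Opens} (e : V ≤ f ⁻¹ᵁ U) (h : W ≤ V)
    (s : Γ(Y, U)) : res h (f.appLE U V e s) = f.appLE U W (h.trans e) s :=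
  ConcreteCategory.congr_hom (f.appLE_map e (homOfLE h).op) s

theorem appLE_res (f : X ⟶ Y) {U U' : Y.Opens} {V : X.Opens} (h : U' ≤ U) (e : V ≤ f ⁻¹ᵁ U')
    (s : Γ(Y, U)) : f.appLE U' V e (res h s) = f.appLE U V (e.trans (f.preimage_mono h)) s :=
  ConcreteCategory.congr_hom (f.map_appLE e (homOfLE h).op) s

theorem res_injective_of_le {U V : X.Opens} (h : V ≤ U) (h' : U ≤ V) :
    Function.Injective (res h) := by
  intro s t e
  have := congrArg (res h') e
  rwa [res_res, res_res, res_self, res_self] at this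

theorem appLE_appLE {Z : Scheme.{u}} (f : X ⟶ Y) (g : Y ⟶ Z) {U : Z.Opens} {V : Y.Opens}
    {W : X.Opens} (h : V ≤ g ⁻¹ᵁ U) (h' : W ≤ f ⁻¹ᵁ V) (s : Γ(Z, U)) :
    f.appLE V W h' (g.appLE U V h s) = (f ≫ g).appLE U W (h'.trans (f.preimage_mono h)) s :=
  ConcreteCategory.congr_hom (Scheme.Hom.appLE_comp_appLE f g U V W h h') s

theorem appLE_congr {f g : X ⟶ Y} (e : f = g) {U : Y.Opens} {V : X.Opens} (h : V ≤ f ⁻¹ᵁ U)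
    (h' : V ≤ g ⁻¹ᵁ U) (s : Γ(Y, U)) : f.appLE U V h s = g.appLE U V h' s := by
  subst e; rfl

theorem exists_pow_mul_eq_of_res_eq {U : X.Opens} (hU : IsAffineOpen U) (x s t : Γ(X, U))
    (h : res (X.basicOpen_le x) s = res (X.basicOpen_le x) t) : ∃ n, x ^ n * (s - t) = 0 :=
  exists_pow_mul_eq_zero_of_res_basicOpen_eq_zero_of_isAffineOpen X hU (s - t) x
    ((map_sub (res (X.basicOpen_le x)) s t).trans (sub_eq_zero.2 h))

theorem hom_ext_of_iSup_eq_top {κ : Type*} (U : κ → X.Opens) (hU : ⨆ a, U a = ⊤) {f g : X ⟶ Y}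
    (h : ∀ a, (U a).ι ≫ f = (U a).ι ≫ g) : f = g :=
  (X.openCoverOfIsOpenCover U (.mk hU)).hom_ext _ _ h

end Restriction

/-- In finitely many Noetherian rings, the torsion with respect to given elements is killed by
a common power. -/
theorem exists_forall_pow_mul_eq_zero {T : Type*} [Finite T] {R : T → Type*} [∀ t, CommRing (R t)]
    [∀ t, IsNoetherianRing (R t)] (x : ∀ t, R t) :
    ∃ M, ∀ t (z : R t), (∃ n, x t ^ n * z = 0) → x t ^ M * z = 0 := by
  have h1 : ∀ t, ∃ M, ∀ z : R t, (∃ n, x t ^ n * z = 0) → x t ^ M * z = 0 := by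
    intro t
    obtain ⟨M, hM⟩ := monotone_stabilizes_iff_noetherian.2
      (inferInstance : IsNoetherian (R t) (R t))
      (LinearMap.iterateKer (LinearMap.mulLeft (R t) (x t)))
    have h2 : ∀ n z, z ∈ LinearMap.iterateKer (LinearMap.mulLeft (R t) (x t)) n ↔
        x t ^ n * z = 0 := fun n z => by
      change (LinearMap.mulLeft (R t) (x t) ^ n) z = 0 ↔ _
      rw [LinearMap.pow_mulLeft, LinearMap.mulLeft_apply]
    refine ⟨M, fun z ⟨n, hn⟩ => ?_⟩
    rw [← h2] at hn ⊢
    rw [hM (max M n) (le_max_left _ _)]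
    exact (LinearMap.iterateKer (LinearMap.mulLeft (R t) (x t))).monotone (le_max_right M n) hn
  choose M hM using h1
  have := Fintype.ofFinite T
  refine ⟨∑ t, M t, fun t z hz => ?_⟩
  obtain ⟨c, hc⟩ := le_iff_exists_add'.1 (Finset.single_le_sum (fun t _ => Nat.zero_le (M t))
    (Finset.mem_univ t))
  rw [hc, pow_add, mul_assoc, hM t z hz, mul_zero]

/-! ### Turning functions on charts into ratios of coordinates -/

section Extension

attribute [local instance] MvPolynomial.gradedAlgebra

variable {𝕜 L : Type u} [Field 𝕜] [Field L] {ι J : Type} [Finite ι] [Finite J]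

/-- The ratio of two coordinates as a function on the preimage of a chart. -/
noncomputable def ratio {Y : Scheme.{u}} (i : Y ⟶ PSpace 𝕜 ι) (a b : ι) :
    Γ(Y, i ⁻¹ᵁ chart 𝕜 a) :=
  i.appLE _ _ le_rfl (frac _ (coord 𝕜 a) (coord 𝕜 b))

omit [Finite ι] in
theorem ratio_self {Y : Scheme.{u}} (i : Y ⟶ PSpace 𝕜 ι) (a : ι) : ratio i a a = 1 := by
  rw [ratio, frac_self, map_one]

omit [Finite ι] in
theorem basicOpen_ratio {Y : Scheme.{u}} (i : Y ⟶ PSpace 𝕜 ι) (a b : ι) :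
    Y.basicOpen (ratio i a b) = i ⁻¹ᵁ chart 𝕜 a ⊓ i ⁻¹ᵁ chart 𝕜 b := by
  rw [ratio, Scheme.basicOpen_appLE, basicOpen_frac]
  exact Opens.ext (Set.ext fun x => ⟨fun h => ⟨h.1, h.2.2⟩, fun h => ⟨h.1, h.1, h.2⟩⟩)

omit [Finite ι] in
theorem res_ratio_mul {Y : Scheme.{u}} (i : Y ⟶ PSpace 𝕜 ι) (a b c : ι) {V : Y.Opens}
    (ha : V ≤ i ⁻¹ᵁ chart 𝕜 a) (hb : V ≤ i ⁻¹ᵁ chart 𝕜 b) :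
    res ha (ratio i a b) * res hb (ratio i b c) = res ha (ratio i a c) := by
  rw [ratio, ratio, ratio, res_appLE, res_appLE, res_appLE, appLE_frac_mul_frac]

omit [Finite ι] in
theorem appLE_ratio {Y Y' : Scheme.{u}} {i : Y ⟶ PSpace 𝕜 ι} {i' : Y' ⟶ PSpace 𝕜 ι} {s : Y' ⟶ Y}
    (hs : s ≫ i = i') (a b : ι) {V : Y'.Opens} (h : V ≤ s ⁻¹ᵁ i ⁻¹ᵁ chart 𝕜 a)
    (h' : V ≤ i' ⁻¹ᵁ chart 𝕜 a) :
    s.appLE _ V h (ratio i a b) = res h' (ratio i' a b) := by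
  rw [ratio, ratio, appLE_appLE, res_appLE]
  exact appLE_congr hs _ _ _

omit [Finite ι] in
theorem basicOpen_ratio_le {Y : Scheme.{u}} (i : Y ⟶ PSpace 𝕜 ι) (a b : ι) :
    Y.basicOpen (ratio i a b) ≤ i ⁻¹ᵁ chart 𝕜 b :=
  (basicOpen_ratio i a b).le.trans inf_le_right

/-- Inside the chart `a`, the overlap with the chart `α j` is the locus where the ratio is
invertible. So a power of the ratio clears the poles of `g j`, and finiteness allows a uniform
exponent. -/
theorem exists_pow_mul_extends {Y : Scheme.{u}} (i : Y ⟶ PSpace 𝕜 ι)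
    (hi : ∀ a, IsAffineOpen (i ⁻¹ᵁ chart 𝕜 a)) (α : J → ι)
    (g : ∀ j, Γ(Y, i ⁻¹ᵁ chart 𝕜 (α j))) :
    ∃ N, ∃ h : ∀ a, J → Γ(Y, i ⁻¹ᵁ chart 𝕜 a), ∀ a j,
      res (Y.basicOpen_le (ratio i a (α j))) (h a j) =
        res (Y.basicOpen_le _) (ratio i a (α j)) ^ N *
          res (basicOpen_ratio_le i a (α j)) (g j) := by
  have h1 : ∀ a j, ∃ n, ∃ h : Γ(Y, i ⁻¹ᵁ chart 𝕜 a), res (Y.basicOpen_le (ratio i a (α j))) h =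
      res (Y.basicOpen_le _) (ratio i a (α j)) ^ n * res (basicOpen_ratio_le i a (α j)) (g j) :=
    fun a j => exists_eq_pow_mul_of_isAffineOpen Y _ (hi a) (ratio i a (α j)) _
  choose n h hh using h1
  have := Fintype.ofFinite (ι × J)
  have hle : ∀ a j, n a j ≤ ∑ q : ι × J, n q.1 q.2 := fun a j =>
    Finset.single_le_sum (f := fun q : ι × J => n q.1 q.2) (fun _ _ => Nat.zero_le _)
      (Finset.mem_univ (a, j))
  refine ⟨∑ q : ι × J, n q.1 q.2, fun a j =>
    ratio i a (α j) ^ (∑ q : ι × J, n q.1 q.2 - n a j) * h a j, fun a j => ?_⟩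
  rw [map_mul, map_pow, hh, ← mul_assoc, ← pow_add, Nat.sub_add_cancel (hle a j)]

/-- A common exponent killing the torsion with respect to the ratios, on the charts
and their intersections. -/
theorem exists_torsion_exponent {Y : Scheme.{u}} [IsLocallyNoetherian Y] (i : Y ⟶ PSpace 𝕜 ι)
    (hi : ∀ a, IsAffineOpen (i ⁻¹ᵁ chart 𝕜 a)) :
    ∃ M, ∀ a a' b (s t : Γ(Y, i ⁻¹ᵁ chart 𝕜 a ⊓ i ⁻¹ᵁ chart 𝕜 a')),
      res (Y.basicOpen_le (res inf_le_right (ratio i a' b))) s = res (Y.basicOpen_le _) t →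
      res inf_le_right (ratio i a' b) ^ M * s = res inf_le_right (ratio i a' b) ^ M * t := by
  have hUU : ∀ a a', IsAffineOpen (i ⁻¹ᵁ chart 𝕜 a ⊓ i ⁻¹ᵁ chart 𝕜 a') := fun a a' => by
    have := (hi a).basicOpen (ratio i a a')
    rwa [basicOpen_ratio] at this
  have hN1 : ∀ q : ι × ι × ι, IsNoetherianRing Γ(Y, i ⁻¹ᵁ chart 𝕜 q.1 ⊓ i ⁻¹ᵁ chart 𝕜 q.2.1) :=
    fun q => IsLocallyNoetherian.component_noetherian ⟨_, hUU _ _⟩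
  obtain ⟨M, hM⟩ := exists_forall_pow_mul_eq_zero
    (R := fun q : ι × ι × ι => Γ(Y, i ⁻¹ᵁ chart 𝕜 q.1 ⊓ i ⁻¹ᵁ chart 𝕜 q.2.1))
    (fun q => res inf_le_right (ratio i q.2.1 q.2.2))
  refine ⟨M, fun a a' b s t h => ?_⟩
  have h1 := hM (a, a', b) (s - t) (exists_pow_mul_eq_of_res_eq (hUU a a') _ _ _ h)
  exact sub_eq_zero.1 ((mul_sub _ s t).symm.trans h1)

/-- Functions on charts extend to all charts after multiplication with powers of ratios, in
a way that is compatible with automorphisms. -/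
theorem exists_extension {Y : Scheme.{u}} [IsLocallyNoetherian Y] (i : Y ⟶ PSpace 𝕜 ι)
    (hi : ∀ a, IsAffineOpen (i ⁻¹ᵁ chart 𝕜 a)) (α : J → ι)
    (g : ∀ j, Γ(Y, i ⁻¹ᵁ chart 𝕜 (α j))) :
    ∃ e, 0 < e ∧ ∃ h : ∀ a, J → Γ(Y, i ⁻¹ᵁ chart 𝕜 a), (∀ j, h (α j) j = g j) ∧
      (∀ a a' j, res (inf_le_right : i ⁻¹ᵁ chart 𝕜 a ⊓ i ⁻¹ᵁ chart 𝕜 a' ≤ _) (h a' j) =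
        res inf_le_right (ratio i a' a) ^ e * res inf_le_left (h a j)) ∧
      ∀ s : Y ⟶ Y, s ≫ i = i →
        (∀ j (h : i ⁻¹ᵁ chart 𝕜 (α j) ≤ s ⁻¹ᵁ i ⁻¹ᵁ chart 𝕜 (α j)), s.appLE _ _ h (g j) = g j) →
        ∀ a (hs : i ⁻¹ᵁ chart 𝕜 a ≤ s ⁻¹ᵁ i ⁻¹ᵁ chart 𝕜 a) j, s.appLE _ _ hs (h a j) = h a j := by
  obtain ⟨N, h0, hh0⟩ := exists_pow_mul_extends i hi α g
  obtain ⟨M, hM⟩ := exists_torsion_exponent i hi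
  -- The exponent `N` clears poles and `M` kills the discrepancy between two extensions, hence
  -- yields both compatibility on overlaps and invariance. The extra `1` makes `e` positive, so that
  -- `e`-th powers keep their non-vanishing loci.
  refine ⟨N + M + 1, by omega, fun a j => ratio i a (α j) ^ (M + 1) * h0 a j,
    fun j => ?_, fun a a' j => ?_, fun s hs hsg a hsa j => ?_⟩
  · have h2 := hh0 (α j) j
    simp only [ratio_self, map_one, one_pow, one_mul] at h2 ⊢
    exact res_injective_of_le _ (by rw [basicOpen_ratio]; exact le_inf le_rfl le_rfl) h2
  · have hmul := res_ratio_mul i a' a (α j) inf_le_right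
      (inf_le_left : i ⁻¹ᵁ chart 𝕜 a ⊓ i ⁻¹ᵁ chart 𝕜 a' ≤ _)
    have h2 := hM a a' (α j) (res inf_le_right (h0 a' j))
      (res inf_le_right (ratio i a' a) ^ N * res inf_le_left (h0 a j)) (by
        have hE : Y.basicOpen (res (inf_le_right : i ⁻¹ᵁ chart 𝕜 a ⊓ i ⁻¹ᵁ chart 𝕜 a' ≤ _)
            (ratio i a' (α j))) ≤ Y.basicOpen (ratio i a' (α j)) :=
          (Scheme.basicOpen_res _ _ (homOfLE inf_le_right).op).le.trans inf_le_right
        have hE' : Y.basicOpen (res (inf_le_right : i ⁻¹ᵁ chart 𝕜 a ⊓ i ⁻¹ᵁ chart 𝕜 a' ≤ _)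
            (ratio i a' (α j))) ≤ Y.basicOpen (ratio i a (α j)) := by
          rw [basicOpen_ratio]
          exact le_inf ((Y.basicOpen_le _).trans inf_le_left)
            (hE.trans (basicOpen_ratio_le i a' (α j)))
        have h3 := congrArg (res hE) (hh0 a' j)
        have h4 := congrArg (res hE') (hh0 a j)
        rw [map_mul, map_pow, res_res, res_res, res_res] at h3 h4
        rw [map_mul, map_pow, res_res, res_res, res_res, h3, h4, ← mul_assoc, ← mul_pow]
        rw [res_ratio_mul i a' a (α j)])
    rw [map_mul, map_mul, map_pow, map_pow]
    rw [← hmul] at h2 ⊢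
    linear_combination (res inf_le_right (ratio i a' a) * res inf_le_left (ratio i a (α j))) * h2
  · have hsU : ∀ a, i ⁻¹ᵁ chart 𝕜 a ≤ s ⁻¹ᵁ i ⁻¹ᵁ chart 𝕜 a := fun a => by
      rw [← Scheme.Hom.comp_preimage, hs]
    have hx : ∀ b, s.appLE _ _ hsa (ratio i a b) = ratio i a b := fun b =>
      (appLE_ratio hs a b _ le_rfl).trans (res_self _)
    have hDs : Y.basicOpen (ratio i a (α j)) ≤ s ⁻¹ᵁ Y.basicOpen (ratio i a (α j)) := by
      rw [basicOpen_ratio]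
      exact fun y hy => ⟨hsU a hy.1, hsU (α j) hy.2⟩
    have hD : ∀ b, Y.basicOpen (res (inf_le_right : i ⁻¹ᵁ chart 𝕜 a ⊓ i ⁻¹ᵁ chart 𝕜 a ≤ _)
        (ratio i a b)) ≤ Y.basicOpen (ratio i a b) := fun b =>
      (Scheme.basicOpen_res _ _ (homOfLE inf_le_right).op).le.trans inf_le_right
    have h6 : res (Y.basicOpen_le (ratio i a (α j))) (s.appLE _ _ hsa (h0 a j)) =
        res (Y.basicOpen_le _) (h0 a j) := by
      have h3 := congrArg (s.appLE _ _ hDs) (hh0 a j)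
      rw [map_mul, map_pow, appLE_res, appLE_res, appLE_res] at h3
      have h4 : s.appLE _ (Y.basicOpen (ratio i a (α j)))
          ((basicOpen_ratio_le i a (α j)).trans (hsU (α j))) (g j) =
          res (basicOpen_ratio_le i a (α j)) (g j) := by
        rw [← res_appLE _ (hsU (α j)), hsg]
      have h5 : s.appLE _ (Y.basicOpen (ratio i a (α j))) ((Y.basicOpen_le _).trans hsa)
          (ratio i a (α j)) = res (Y.basicOpen_le _) (ratio i a (α j)) :=
        appLE_ratio hs a (α j) _ _
      rw [res_appLE, hh0, h3, h4, h5]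
    have h2 := hM a a (α j) (res inf_le_right (s.appLE _ _ hsa (h0 a j)))
      (res inf_le_right (h0 a j)) (by
        have h7 := congrArg (res (hD (α j))) h6
        rw [res_res, res_res] at h7 ⊢
        exact h7)
    rw [← map_pow, ← map_mul, ← map_mul] at h2
    have h8 := res_injective_of_le inf_le_right (le_inf le_rfl le_rfl) h2
    rw [map_mul, map_pow, hx, pow_succ']
    linear_combination ratio i a (α j) * h8

omit [Finite ι] [Finite J] in
theorem coe_coord (b : ι) : (coord L b : MvPolynomial ι L) = MvPolynomial.X b := rfl

omit [Finite ι] [Finite J] in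
theorem exists_hom_of_ratios {Y : Scheme.{u}} {κ : Type} (V : κ → Y.Opens) (hV : ⨆ a, V a = ⊤)
    (p : Y ⟶ Spec (CommRingCat.of L)) (c : κ → ι) (f : ∀ a, ι → Γ(Y, V a)) (hf : ∀ a, f a (c a) = 1)
    (hcoc : ∀ a a' b, res (inf_le_right : V a ⊓ V a' ≤ V a') (f a' b) =
      res (inf_le_right : V a ⊓ V a' ≤ V a') (f a' (c a)) *
        res (inf_le_left : V a ⊓ V a' ≤ V a) (f a b))
    (hle : ∀ a a', Y.basicOpen (f a' (c a)) ≤ V a) :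
    ∃ i : Y ⟶ PSpace L ι, i ≫ PSpace.str L ι = p ∧ (∀ a, i ⁻¹ᵁ chart L (c a) = V a) ∧
      ∀ a (h : V a ≤ i ⁻¹ᵁ chart L (c a)) b,
        res h (ratio i (c a) b) = f a b := by
  have hV' : ⨆ a : ULift.{u} κ, V a.down = ⊤ := by
    rw [← hV]
    exact Equiv.ulift.iSup_congr fun _ => rfl
  obtain ⟨i, hi0, hi⟩ := exists_hom_of_atlas (fun a : ULift.{u} κ => V a.down) hV' p
    (fun a => c a.down) (fun a => f a.down) (fun a => hf a.down)
    (fun a a' b => hcoc a.down a'.down b)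
  have hval : ∀ a (h : V a ≤ i ⁻¹ᵁ chart L (c a)) b,
      i.appLE _ (V a) h (frac _ (coord L (c a)) (coord L b)) = f a b := fun a h b => by
    obtain ⟨h1, h2⟩ := hi ⟨a⟩
    rw [h2 (coord L b), coe_coord, MvPolynomial.eval₂_X]
  refine ⟨i, hi0, fun a => preimage_chart_of_atlas hV (fun a => (hi ⟨a⟩).1) (fun a => hval a _) a
    (hle a), fun a h b => ?_⟩
  rw [ratio, res_appLE, hval]

omit [Finite ι] in
theorem ι_comp_eq_of_ratio {Y : Scheme.{u}} {f g : Y ⟶ PSpace L ι}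
    (h0 : f ≫ PSpace.str L ι = g ≫ PSpace.str L ι) (a : ι) {V : Y.Opens}
    (hf : V ≤ f ⁻¹ᵁ chart L a) (hg : V ≤ g ⁻¹ᵁ chart L a)
    (h : ∀ b, res hf (ratio f a b) = res hg (ratio g a b)) : V.ι ≫ f = V.ι ≫ g := by
  refine ι_comp_eq_of_frac h0 (coord L a) hf hg fun b => ?_
  have h1 := h b
  rwa [ratio, ratio, res_appLE, res_appLE] at h1

/-- Finitely many functions on the charts of `i` become ratios of coordinates, after raising
the coordinates of `i` to a power. -/
theorem exists_hom_extending {Y : Scheme.{u}} [IsLocallyNoetherian Y] (i : Y ⟶ PSpace 𝕜 ι)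
    (hi : ∀ a, IsAffineOpen (i ⁻¹ᵁ chart 𝕜 a)) (α : J → ι) (g : ∀ j, Γ(Y, i ⁻¹ᵁ chart 𝕜 (α j)))
    (p : Y ⟶ Spec (CommRingCat.of L)) :
    ∃ i' : Y ⟶ PSpace L (ι ⊕ J), i' ≫ PSpace.str L _ = p ∧
      (∀ a, i' ⁻¹ᵁ chart L (.inl a) = i ⁻¹ᵁ chart 𝕜 a) ∧
      (∀ j (h : i ⁻¹ᵁ chart 𝕜 (α j) ≤ i' ⁻¹ᵁ chart L (.inl (α j))),
        res h (ratio i' (.inl (α j)) (.inr j)) = g j) ∧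
      ∀ s : Y ⟶ Y, s ≫ i = i → s ≫ p = p →
        (∀ j (h : i ⁻¹ᵁ chart 𝕜 (α j) ≤ s ⁻¹ᵁ i ⁻¹ᵁ chart 𝕜 (α j)), s.appLE _ _ h (g j) = g j) →
        s ≫ i' = i' := by
  obtain ⟨e, he, h, hg, hh, hs⟩ := exists_extension i hi α g
  -- The new homogeneous coordinates are the `e`-th powers of the old ones together with the
  -- extensions of the `g j`. Only the charts of the old coordinates are needed to cover `Y`.
  let f : ∀ a, ι ⊕ J → Γ(Y, i ⁻¹ᵁ chart 𝕜 a) := fun a =>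
    Sum.elim (fun b => ratio i a b ^ e) fun j => h a j
  have hcoc : ∀ a a' b, res (inf_le_right : i ⁻¹ᵁ chart 𝕜 a ⊓ i ⁻¹ᵁ chart 𝕜 a' ≤ _) (f a' b) =
      res inf_le_right (f a' (.inl a)) * res inf_le_left (f a b) := by
    intro a a' b
    rcases b with b | j
    · simp only [f, Sum.elim_inl, map_pow]
      rw [← mul_pow, res_ratio_mul]
    · simp only [f, Sum.elim_inl, Sum.elim_inr, map_pow]
      exact hh a a' j
  obtain ⟨i', hi0, hpre, hval⟩ := exists_hom_of_ratios (L := L) (fun a => i ⁻¹ᵁ chart 𝕜 a)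
    (iSup_preimage_chart i) p Sum.inl f (fun a => by simp [f, ratio_self]) hcoc fun a a' =>
      (Scheme.basicOpen_pow Y (ratio i a' a) he).le.trans (basicOpen_ratio_le i a' a)
  refine ⟨i', hi0, hpre, fun j h => ?_, fun s hsi hsp hsg => ?_⟩
  · exact (hval (α j) h (.inr j)).trans (hg j)
  · refine hom_ext_of_iSup_eq_top _ (iSup_preimage_chart i) fun a => ?_
    have hsU : i ⁻¹ᵁ chart 𝕜 a ≤ s ⁻¹ᵁ i ⁻¹ᵁ chart 𝕜 a := by
      rw [← Scheme.Hom.comp_preimage, hsi]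
    have hU' : i ⁻¹ᵁ chart 𝕜 a ≤ i' ⁻¹ᵁ chart L (Sum.inl a) := (hpre a).ge
    have hU2 : i ⁻¹ᵁ chart 𝕜 a ≤ s ⁻¹ᵁ i' ⁻¹ᵁ chart L (Sum.inl a) := hsU.trans (s.preimage_mono hU')
    have hU3 : i ⁻¹ᵁ chart 𝕜 a ≤ (s ≫ i') ⁻¹ᵁ chart L (Sum.inl a) := by
      rwa [Scheme.Hom.comp_preimage]
    refine ι_comp_eq_of_ratio (by rw [Category.assoc, hi0, hsp]) (Sum.inl a) hU3 hU' fun b => ?_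
    rw [← appLE_ratio rfl (Sum.inl a) b hU2 hU3, ← appLE_res s hU' hsU, hval]
    rcases b with b | j
    · simp only [f, Sum.elim_inl, map_pow]
      rw [(appLE_ratio hsi a b hsU le_rfl).trans (res_self _)]
    · exact hs s hsi hsg a hsU j

end Extension

/-! ### Construction of models as scheme-theoretic images -/

section Models

theorem isIso_of_bijective_appLE {W Y : Scheme.{u}} (c : Y ⟶ W) {T : Type*} (U : T → W.Opens)
    (U' : T → Y.Opens) (hU : ∀ a, IsAffineOpen (U a)) (hcov : ⨆ a, U a = ⊤)
    (hU' : ∀ a, IsAffineOpen (U' a)) (hc : ∀ a, U' a = c ⁻¹ᵁ U a)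
    (hbij : ∀ a, Function.Bijective (c.appLE (U a) (U' a) (hc a).le)) : IsIso c := by
  obtain rfl : U' = fun a => c ⁻¹ᵁ U a := funext hc
  have hca : IsAffineHom c := by
    refine isAffineHom_of_forall_exists_isAffineOpen _ fun x => ?_
    have hx : x ∈ ⨆ a, U a := by rw [hcov]; trivial
    obtain ⟨a, ha⟩ := Opens.mem_iSup.1 hx
    exact ⟨_, ha, hU a, hU' a⟩
  refine (IsZariskiLocalAtTarget.iff_of_iSup_eq_top (P := .isomorphisms Scheme.{u}) U hcov).2
    fun a => ?_
  refine (isIso_morphismRestrict_iff_isIso_app c (hU a)).2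
    ((ConcreteCategory.isIso_iff_bijective _).2 ?_)
  rw [Scheme.Hom.app_eq_appLE]
  exact hbij a

variable {F K : Type u} [Field F] [CharZero F] [Field K] [IsAlgClosed K] [Algebra F K]
  {Y : Scheme.{u}} {p : Y ⟶ Spec (CommRingCat.of K)}

/-- Pullbacks of functions along an invariant morphism which are linearly dependent over `K`
vanish. -/
theorem GaloisAct.eq_zero_of_sum_eq_zero (A : GaloisAct F p) {X : Scheme.{u}} {π : Y ⟶ X}
    (hact : ∀ σ, A.act σ ≫ π = π) {κ : Type*} (b : Module.Basis κ F K) {V : X.Opens}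
    (s : Finset κ) (a : κ → Γ(X, V))
    (h : ∑ i ∈ s, π.app V (a i) * scalars p (π ⁻¹ᵁ V) (b i) = 0) :
    ∀ i ∈ s, π.app V (a i) = 0 := by
  -- The action of `σ` replaces `b i` by `σ (b i)` and leaves functions pulled back from `X`
  -- unchanged, so one relation yields all its conjugates.
  refine eq_zero_of_sum_algebraMap (scalars p (π ⁻¹ᵁ V)).hom
    (fun (σ : K ≃ₐ[F] K) i => σ (b i)) (fun s a hs => ?_) s _ fun σ => ?_
  · exact eq_zero_of_sum_mul_algEquiv_eq_zero (fun a ha => mem_range_algebraMap_of_fixed ha) _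
      b.linearIndependent s a hs
  · have hσ : π ⁻¹ᵁ V ≤ A.act σ ⁻¹ᵁ π ⁻¹ᵁ V := by rw [← Scheme.Hom.comp_preimage, hact]
    have h1 := congrArg ((A.act σ).appLE _ _ hσ) h
    rw [map_sum, map_zero] at h1
    rw [← h1]
    refine Finset.sum_congr rfl fun i _ => ?_
    rw [map_mul]
    congr 1
    · rw [Scheme.Hom.app_eq_appLE, appLE_appLE]
      exact (appLE_congr (hact σ) _ _ _).symm
    · have h2 := scalars_appLE p (A.act σ) _ _ hσ
      rw [A.act_over, scalars_comp_SpecMap] at h2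
      exact congr($(h2.symm).hom (b i))

/-- A criterion for an invariant morphism to be a model. -/
theorem GaloisAct.isModel_of_closure_eq (A : GaloisAct F p) {X : Scheme.{u}} {π : Y ⟶ X}
    {r : X ⟶ Spec (CommRingCat.of F)}
    (w : π ≫ r = p ≫ Spec.map (CommRingCat.ofHom (algebraMap F K)))
    (hact : ∀ σ, A.act σ ≫ π = π) {T : Type*} (V : T → X.Opens) (hV : ∀ a, IsAffineOpen (V a))
    (hcov : ⨆ a, V a = ⊤) (hV' : ∀ a, IsAffineOpen (π ⁻¹ᵁ V a))
    (hinj : ∀ a, Function.Injective (π.app (V a)))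
    (hgen : ∀ a (t : Γ(Y, π ⁻¹ᵁ V a)), t ∈ Subring.closure
      (Set.range (scalars p (π ⁻¹ᵁ V a)) ∪ Set.range (π.app (V a)))) :
    A.IsModel r π := by
  refine ⟨?_, hact⟩
  let b := Module.Basis.ofVectorSpace F K
  have H := IsPullback.of_hasPullback r (Spec.map (CommRingCat.ofHom (algebraMap F K)))
  generalize pullback.fst r (Spec.map (CommRingCat.ofHom (algebraMap F K))) = q₁ at H
  generalize pullback.snd r (Spec.map (CommRingCat.ofHom (algebraMap F K))) = q₂ at H
  -- The comparison map `Y ⟶ X ×_F K` is an isomorphism: on functions, surjectivity is generation by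
  -- constants and functions from `X`, and injectivity is linear disjointness together with `hinj`.
  obtain ⟨c, hc₁, hc₂⟩ : ∃ c, c ≫ q₁ = π ∧ c ≫ q₂ = p := ⟨H.lift _ _ w, by simp, by simp⟩
  have hq : IsAffineHom q₁ := MorphismProperty.of_isPullback H.flip inferInstance
  have hcov' : ⨆ a, q₁ ⁻¹ᵁ V a = ⊤ := by
    rw [← Scheme.Hom.preimage_iSup, hcov, Scheme.Hom.preimage_top]
  have hpre : ∀ a, π ⁻¹ᵁ V a = c ⁻¹ᵁ q₁ ⁻¹ᵁ V a := fun a => by rw [← Scheme.Hom.comp_preimage, hc₁]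
  have e₁ : ∀ a x, c.appLE _ _ (hpre a).le (q₁.app (V a) x) = π.app (V a) x := fun a x => by
    rw [Scheme.Hom.app_eq_appLE, appLE_appLE, Scheme.Hom.app_eq_appLE]
    exact appLE_congr hc₁ _ _ _
  have e₂ : ∀ a x, c.appLE _ _ (hpre a).le (scalars q₂ (q₁ ⁻¹ᵁ V a) x) =
      scalars p (π ⁻¹ᵁ V a) x := fun a x => by
    have h2 := scalars_appLE q₂ c _ _ (hpre a).le
    rw [hc₂] at h2
    exact congr($(h2).hom x)
  have hciso : IsIso c := by
    refine isIso_of_bijective_appLE c _ _ (fun a => (hV a).preimage q₁) hcov' hV' hpre fun a => ?_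
    constructor
    · rw [injective_iff_map_eq_zero]
      intro s hs
      obtain ⟨d, rfl⟩ := exists_sum_of_isPushout (isPushout_scalars H (hV a)) b s
      rw [Finsupp.sum, map_sum] at hs
      simp only [map_mul, e₁, e₂] at hs
      have h2 := A.eq_zero_of_sum_eq_zero hact b _ _ hs
      refine Finset.sum_eq_zero fun i hi => ?_
      have h3 : d i = 0 := hinj a ((h2 i hi).trans (map_zero _).symm)
      beta_reduce
      rw [h3, map_zero, zero_mul]
    · intro t
      have h1 : Subring.closure (Set.range (scalars p (π ⁻¹ᵁ V a)) ∪
          Set.range (π.app (V a))) ≤ (c.appLE _ _ (hpre a).le).hom.range := by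
        rw [Subring.closure_le]
        rintro _ (⟨x, rfl⟩ | ⟨x, rfl⟩)
        · exact ⟨scalars q₂ _ x, e₂ a x⟩
        · exact ⟨q₁.app (V a) x, e₁ a x⟩
      exact h1 (hgen a t)
  exact IsPullback.of_iso_pullback ⟨w⟩ (asIso (c ≫ H.isoPullback.hom)) (by simp [hc₁])
    (by simp [hc₂])

section

attribute [local instance] MvPolynomial.gradedAlgebra

variable {κ : Type} [Finite κ]

/-- A scheme with an invariant morphism to projective space, whose rings of functions on an
affine cover by charts are generated by the coordinates, has a model that is quasi-projective. -/
theorem GaloisAct.exists_isModel_of_closure_eq (A : GaloisAct F p) (j : Y ⟶ PSpace F κ)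
    (hj0 : j ≫ PSpace.str F κ = p ≫ Spec.map (CommRingCat.ofHom (algebraMap F K)))
    (hj : ∀ σ, A.act σ ≫ j = j) {T : Type*} [Finite T] (c : T → κ)
    (haff : ∀ a, IsAffineOpen (j ⁻¹ᵁ chart F (c a))) (hcov : ⨆ a, j ⁻¹ᵁ chart F (c a) = ⊤)
    (hgen : ∀ a (t : Γ(Y, j ⁻¹ᵁ chart F (c a))), t ∈ Subring.closure
      (Set.range (scalars p _) ∪ Set.range (ratio j (c a)))) :
    ∃ (X : Scheme.{u}) (r : X ⟶ Spec (CommRingCat.of F)) (π : Y ⟶ X) (e : X ⟶ PSpace F κ),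
      A.IsModel r π ∧ e ≫ PSpace.str F κ = r ∧ IsImmersion e := by
  have hYc : CompactSpace Y := by
    rw [← isCompact_univ_iff, ← Opens.coe_top, ← hcov, Opens.coe_iSup]
    exact isCompact_iUnion fun a => (haff a).isCompact
  -- The model is the scheme-theoretic image of `Y` in the union `O` of the charts that cover it. It
  -- is closed in `O`, so it is immersed in projective space, and its functions over these charts
  -- inject into those of `Y`.
  let O : (PSpace F κ).Opens := ⨆ a, chart F (c a)
  let jO : Y ⟶ O.toScheme := IsOpenImmersion.lift O.ι j (by
    rw [Scheme.Opens.range_ι]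
    rintro _ ⟨y, rfl⟩
    have hy : y ∈ ⨆ a, j ⁻¹ᵁ chart F (c a) := by rw [hcov]; trivial
    rw [← Scheme.Hom.preimage_iSup] at hy
    exact hy)
  have hjO : jO ≫ O.ι = j := IsOpenImmersion.lift_fac _ _ _
  have : QuasiCompact jO := inferInstance
  let e : jO.image ⟶ PSpace F κ := jO.imageι ≫ O.ι
  have hπ : jO.toImage ≫ e = j := by
    rw [Scheme.Hom.toImage_imageι_assoc, hjO]
  have hV : ∀ a, IsAffineOpen (e ⁻¹ᵁ chart F (c a)) := fun a => by
    rw [Scheme.Hom.comp_preimage]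
    refine IsAffineOpen.preimage ?_ _
    refine (isAffineOpen_chart (c a)).preimage_of_isOpenImmersion _ ?_
    rw [Scheme.Opens.opensRange_ι]
    exact le_iSup (fun a => chart F (c a)) a
  have hpre : ∀ a, jO.toImage ⁻¹ᵁ e ⁻¹ᵁ chart F (c a) = j ⁻¹ᵁ chart F (c a) := fun a => by
    rw [← Scheme.Hom.comp_preimage, hπ]
  refine ⟨jO.image, e ≫ PSpace.str F κ, jO.toImage, e, ?_, rfl, inferInstance⟩
  refine A.isModel_of_closure_eq (by rw [reassoc_of% hπ, hj0]) (fun σ => ?_)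
    (fun a => e ⁻¹ᵁ chart F (c a)) hV ?_ (fun a => ?_) (fun a => ?_) (fun a t => ?_)
  · have h : (A.act σ ≫ jO.toImage) ≫ e = jO.toImage ≫ e := by rw [Category.assoc, hπ, hj]
    exact (cancel_mono e).1 h
  · rw [← Scheme.Hom.preimage_iSup]
    change (jO.imageι ≫ O.ι) ⁻¹ᵁ O = ⊤
    rw [Scheme.Hom.comp_preimage, Scheme.Opens.ι_preimage_self, Scheme.Hom.preimage_top]
  · rw [hpre]
    exact haff a
  · exact jO.toImage_app_injective ⟨O.ι ⁻¹ᵁ chart F (c a), by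
      refine (isAffineOpen_chart (c a)).preimage_of_isOpenImmersion _ ?_
      rw [Scheme.Opens.opensRange_ι]
      exact le_iSup (fun a => chart F (c a)) a⟩
  · have hle : jO.toImage ⁻¹ᵁ e ⁻¹ᵁ chart F (c a) ≤ j ⁻¹ᵁ chart F (c a) := (hpre a).le
    have h1 := hgen a (res (hpre a).ge t)
    have h2 := Subring.mem_map.2 ⟨_, h1, (rfl : res hle _ = _)⟩
    rw [res_res, res_self, RingHom.map_closure] at h2
    refine Subring.closure_mono ?_ h2
    rintro _ ⟨_, ⟨x, rfl⟩ | ⟨b, rfl⟩, rfl⟩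
    · exact Or.inl ⟨x, congr($((scalars_map p hle).symm).hom x)⟩
    · refine Or.inr ⟨ratio e (c a) b, ?_⟩
      rw [Scheme.Hom.app_eq_appLE]
      exact appLE_ratio hπ (c a) b _ hle

end

end Models

/-! ### Finite generation of rings of functions -/

section Generation

variable {K : Type u} [Field K] {Y : Scheme.{u}} (p : Y ⟶ Spec (CommRingCat.of K))

theorem exists_fin_closure_eq [LocallyOfFiniteType p] {U : Y.Opens} (hU : IsAffineOpen U) :
    ∃ (n : ℕ) (g : Fin n → Γ(Y, U)), ∀ t,
      t ∈ Subring.closure (Set.range (scalars p U) ∪ Set.range g) := by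
  have h1 : (p.appLE ⊤ U (le_preimage_top p U)).hom.FiniteType :=
    p.finiteType_appLE (isAffineOpen_top _) hU _
  have h2 : (scalars p U).hom.FiniteType := by
    rw [scalars, CommRingCat.hom_comp]
    exact h1.comp (RingHom.FiniteType.of_surjective _
      (ConcreteCategory.bijective_of_isIso (Scheme.ΓSpecIso (CommRingCat.of K)).inv).2)
  let _ := (scalars p U).hom.toAlgebra
  obtain ⟨S, hS⟩ := h2
  refine ⟨S.card, fun j => S.equivFin.symm j, fun t => ?_⟩
  have h3 : t ∈ Algebra.adjoin K (S : Set Γ(Y, U)) := by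
    have h4 : t ∈ (⊤ : Subalgebra K Γ(Y, U)) := trivial
    rwa [← hS] at h4
  rw [← Subalgebra.mem_toSubring, Algebra.adjoin_eq_ring_closure] at h3
  refine Subring.closure_mono (Set.union_subset_union le_rfl fun x hx => ?_) h3
  exact ⟨S.equivFin ⟨x, hx⟩, by simp⟩

/-- Functions which span over `K` contain finitely many that generate a finitely generated
`K`-algebra. -/
theorem exists_fin_closure_eq_of_span [LocallyOfFiniteType p] {U : Y.Opens} (hU : IsAffineOpen U)
    (B : Set Γ(Y, U)) (hB : ∀ t, t ∈ AddSubgroup.closure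
      {y | ∃ (c : K) (b : Γ(Y, U)), b ∈ B ∧ scalars p U c * b = y}) :
    ∃ (n : ℕ) (g : Fin n → Γ(Y, U)), (∀ j, g j ∈ B) ∧ ∀ t,
      t ∈ Subring.closure (Set.range (scalars p U) ∪ Set.range g) := by
  classical
  have key : ∀ t : Γ(Y, U), ∃ S : Finset Γ(Y, U), (S : Set Γ(Y, U)) ⊆ B ∧
      t ∈ Subring.closure (Set.range (scalars p U) ∪ (S : Set Γ(Y, U))) := by
    intro t
    induction hB t using AddSubgroup.closure_induction with
    | mem x hx =>
      obtain ⟨c, b, hb, rfl⟩ := hx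
      exact ⟨{b}, by simpa using hb, mul_mem (Subring.subset_closure (Or.inl ⟨c, rfl⟩))
        (Subring.subset_closure (Or.inr (by simp)))⟩
    | zero => exact ⟨∅, by simp, zero_mem _⟩
    | add x y _ _ hx hy =>
      obtain ⟨S, hS, hxS⟩ := hx
      obtain ⟨S', hS', hyS⟩ := hy
      refine ⟨S ∪ S', by simp [hS, hS'], add_mem (Subring.closure_mono ?_ hxS)
        (Subring.closure_mono ?_ hyS)⟩ <;> simp only [Finset.coe_union] <;> grind
    | neg x _ hx =>
      obtain ⟨S, hS, hxS⟩ := hx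
      exact ⟨S, hS, neg_mem hxS⟩
  obtain ⟨m, g, hg⟩ := exists_fin_closure_eq p hU
  choose S hS hgS using key
  let S' := Finset.univ.biUnion fun j => S (g j)
  refine ⟨S'.card, fun j => S'.equivFin.symm j, fun j => ?_, fun t => ?_⟩
  · obtain ⟨j', -, hj'⟩ := Finset.mem_biUnion.1 (S'.equivFin.symm j).2
    exact hS _ hj'
  · refine (Subring.closure_le.2 ?_) (hg t)
    rintro _ (⟨c, rfl⟩ | ⟨j, rfl⟩)
    · exact Subring.subset_closure (Or.inl ⟨c, rfl⟩)
    · refine Subring.closure_mono (Set.union_subset_union le_rfl fun x hx => ?_) (hgS (g j))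
      exact ⟨S'.equivFin ⟨x, Finset.mem_biUnion.2 ⟨j, Finset.mem_univ j, hx⟩⟩, by simp⟩

end Generation

/-! ### Invariant affine morphisms and quasi-projective models -/

section Good

attribute [local instance] MvPolynomial.gradedAlgebra

variable (𝕜 : Type u) {F K : Type u} [Field 𝕜] [Field F] [Field K] [Algebra 𝕜 F] [Algebra 𝕜 K]
  [Algebra F K] [IsScalarTower 𝕜 F K] {Y : Scheme.{u}} {p : Y ⟶ Spec (CommRingCat.of K)}

/-- There is an invariant affine morphism to a projective space. -/
def GaloisAct.HasAffineHom (A : GaloisAct F p) : Prop :=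
  ∃ (ι : Type) (_ : Finite ι) (i : Y ⟶ PSpace 𝕜 ι), IsAffineHom i ∧
    i ≫ PSpace.str 𝕜 ι = p ≫ Spec.map (CommRingCat.ofHom (algebraMap 𝕜 K)) ∧
    ∀ σ, A.act σ ≫ i = i

/-- There is a quasi-projective model. -/
def GaloisAct.HasModel (A : GaloisAct F p) : Prop :=
  ∃ (X : Scheme.{u}) (r : X ⟶ Spec (CommRingCat.of F)) (π : Y ⟶ X) (κ : Type) (_ : Finite κ)
    (e : X ⟶ PSpace F κ), A.IsModel r π ∧ e ≫ PSpace.str F κ = r ∧ IsImmersion e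

variable {𝕜} [CharZero F] [IsAlgClosed K]

theorem isLocallyNoetherian_of_over [LocallyOfFiniteType p] : IsLocallyNoetherian Y :=
  LocallyOfFiniteType.isLocallyNoetherian p

theorem le_act_preimage {A : GaloisAct F p} {Z : Scheme.{u}} {i : Y ⟶ Z}
    (hi : ∀ σ, A.act σ ≫ i = i) (V : Z.Opens) (σ : K ≃ₐ[F] K) :
    i ⁻¹ᵁ V ≤ A.act σ ⁻¹ᵁ i ⁻¹ᵁ V := by
  rw [← Scheme.Hom.comp_preimage, hi]

/-- Invariant generators of the rings of functions on the charts yield a model. -/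
theorem GaloisAct.hasModel_of_closure_eq (A : GaloisAct F p) [LocallyOfFiniteType p] {ι : Type}
    [Finite ι] (i : Y ⟶ PSpace 𝕜 ι) [IsAffineHom i] (hi : ∀ σ, A.act σ ≫ i = i) (n : ι → ℕ)
    (g : ∀ a, Fin (n a) → Γ(Y, i ⁻¹ᵁ chart 𝕜 a))
    (hg : ∀ a j σ, (A.act σ).appLE _ _ (le_act_preimage hi (chart 𝕜 a) σ) (g a j) = g a j)
    (hgen : ∀ a t, t ∈ Subring.closure (Set.range (scalars p _) ∪ Set.range (g a))) :
    A.HasModel := by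
  have := isLocallyNoetherian_of_over (p := p)
  have haff : ∀ a, IsAffineOpen (i ⁻¹ᵁ chart 𝕜 a) := fun a => (isAffineOpen_chart a).preimage i
  -- The invariant generators become ratios of coordinates of an invariant morphism `j` over `F`, so
  -- the functions on its charts are generated by ratios.
  obtain ⟨j, hj0, hpre, hval, hj⟩ := exists_hom_extending (L := F) (J := Σ a, Fin (n a)) i haff
    Sigma.fst (fun q => g q.1 q.2) (p ≫ Spec.map (CommRingCat.ofHom (algebraMap F K)))
  obtain ⟨X, r, π, e, h1, h2, h3⟩ := A.exists_isModel_of_closure_eq j hj0 (fun σ =>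
    hj _ (hi σ) (A.act_comp_algebraMap σ) fun q _ => hg q.1 q.2 σ) Sum.inl
    (fun a => by rw [hpre]; exact haff a)
    (by simp only [hpre]; exact iSup_preimage_chart i) (fun a t => by
      have h1 := Subring.mem_map.2 ⟨_, hgen a (res (hpre a).ge t), (rfl : res (hpre a).le _ = _)⟩
      rw [res_res, res_self, RingHom.map_closure] at h1
      refine Subring.closure_mono ?_ h1
      rintro _ ⟨_, ⟨x, rfl⟩ | ⟨b, rfl⟩, rfl⟩
      · exact Or.inl ⟨x, congr($((scalars_map p (hpre a).le).symm).hom x)⟩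
      · refine Or.inr ⟨.inr ⟨a, b⟩, ?_⟩
        rw [← hval ⟨a, b⟩ (hpre a).ge, res_res, res_self])
  exact ⟨X, r, π, _, inferInstance, e, h1, h2, h3⟩

/-- The action on functions on an invariant open subset. -/
noncomputable def GaloisAct.onSections (A : GaloisAct F p) (U : Y.Opens)
    (hU : ∀ σ, U ≤ A.act σ ⁻¹ᵁ U) : (K ≃ₐ[F] K) →* AddMonoid.End Γ(Y, U) where
  toFun σ := ((A.act σ).appLE U U (hU σ)).hom.toAddMonoidHom
  map_one' := by
    ext x
    change (A.act 1).appLE U U (hU 1) x = x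
    rw [appLE_congr A.act_one (hU 1) le_rfl]
    exact (res_appLE (𝟙 Y) le_rfl le_rfl x).symm.trans (by
      rw [← Scheme.Hom.app_eq_appLE, Scheme.Hom.id_app]
      exact res_self x)
  map_mul' σ τ := by
    ext x
    change (A.act (σ * τ)).appLE U U (hU (σ * τ)) x =
      (A.act σ).appLE U U (hU σ) ((A.act τ).appLE U U (hU τ) x)
    rw [appLE_appLE]
    exact appLE_congr (A.act_mul σ τ) _ _ _

theorem GaloisAct.act_appLE_scalars (A : GaloisAct F p) {U : Y.Opens} (σ : K ≃ₐ[F] K)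
    (h : U ≤ A.act σ ⁻¹ᵁ U) (c : K) :
    (A.act σ).appLE U U h (scalars p U c) = scalars p U (σ c) := by
  have h2 := scalars_appLE p (A.act σ) _ _ h
  rw [A.act_over, scalars_comp_SpecMap] at h2
  exact congr($(h2).hom c)

theorem exists_restrictScalars_eq {E : Type u} [Field E] [Algebra F E] [Algebra E K]
    [IsScalarTower F E K] (σ : K ≃ₐ[F] K)
    (h : ∀ y : E, σ (algebraMap E K y) = algebraMap E K y) :
    ∃ σ' : K ≃ₐ[E] K, σ'.restrictScalars F = σ :=
  ⟨AlgEquiv.ofRingEquiv (f := (σ : K ≃+* K)) h, rfl⟩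

/-- A model over a simple extension `E = F(x)` and an invariant affine morphism to projective space
yield a model. -/
theorem GaloisAct.hasModel_of_simple (htr : Cardinal.aleph0 ≤ Algebra.trdeg F K)
    (A : GaloisAct F p) [LocallyOfFiniteType p] (E : Type u) [Field E] [Algebra F E] [Algebra E K]
    [IsScalarTower F E K] (x : K)
    (hE : ∀ σ : K ≃ₐ[F] K, σ x = x → ∀ y : E, σ (algebraMap E K y) = algebraMap E K y)
    (h : A.HasAffineHom 𝕜) (hx : (A.restrict E).HasModel) : A.HasModel := by
  have : CharZero E := charZero_of_injective_algebraMap (algebraMap F E).injective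
  obtain ⟨ι, _, i, _, hi0, hi⟩ := h
  obtain ⟨X, r, π, κ, _, e, hX, he0, _⟩ := hx
  have hXs : IsSeparated r := by rw [← he0]; infer_instance
  have hXs' : X.IsSeparated := ⟨by
    rw [← terminal.comp_from r]; infer_instance⟩
  -- The morphism `i`, being invariant, factors through the model over `E`; its charts pull back to
  -- affine opens of that model.
  obtain ⟨q, hq⟩ := hX.exists_desc i fun σ => hi _
  have := hX.surjective
  have haff : ∀ a, IsAffineOpen (i ⁻¹ᵁ chart 𝕜 a) := fun a => (isAffineOpen_chart a).preimage i
  have hpre : ∀ a, π ⁻¹ᵁ q ⁻¹ᵁ chart 𝕜 a = i ⁻¹ᵁ chart 𝕜 a := fun a => by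
    rw [← Scheme.Hom.comp_preimage, hq]
  have haff' : ∀ a, IsAffineOpen (q ⁻¹ᵁ chart 𝕜 a) := fun a =>
    isAffineOpen_of_isPullback hX.isPullback (by rw [hpre]; exact haff a)
  have key : ∀ a, ∃ (n : ℕ) (g : Fin n → Γ(Y, i ⁻¹ᵁ chart 𝕜 a)),
      (∀ j, g j ∈ {t | ∀ σ, (A.act σ).appLE _ _ (le_act_preimage hi (chart 𝕜 a) σ) t = t}) ∧
      ∀ t, t ∈ Subring.closure (Set.range (scalars p _) ∪ Set.range g) := by
    intro a
    refine exists_fin_closure_eq_of_span p (haff a) _ fun t => ?_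
    let _ := (scalars p (i ⁻¹ᵁ chart 𝕜 a)).hom.toAlgebra
    have hsmul : ∀ (c : K) (v : Γ(Y, i ⁻¹ᵁ chart 𝕜 a)), c • v = scalars p _ c * v := fun c v =>
      Algebra.smul_def c v
    -- Functions on `Y` over the chart are spanned over `K` by functions from the model over `E`,
    -- and these are fixed by the stabilizer of `x`, which acts through `Aut(K/E)`.
    have hspan := span_fixed_eq_top htr (A.onSections _ (le_act_preimage hi (chart 𝕜 a)))
      (fun σ c v => by
        rw [hsmul, hsmul]
        change (A.act σ).appLE _ _ (le_act_preimage hi (chart 𝕜 a) σ) _ = _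
        rw [map_mul, A.act_appLE_scalars]
        rfl) x (by
        rw [eq_top_iff]
        rintro t -
        obtain ⟨c, hc⟩ := exists_sum_of_isPushout (isPushout_scalars hX.isPullback (haff' a))
          (Module.Basis.ofVectorSpace E K) (res (hpre a).le t)
        have hc' := congrArg (res (hpre a).ge) hc
        rw [res_res, res_self, Finsupp.sum, map_sum] at hc'
        rw [hc']
        refine Submodule.sum_mem _ fun l _ => ?_
        rw [map_mul, mul_comm]
        have h1 : res (hpre a).ge (scalars p (π ⁻¹ᵁ q ⁻¹ᵁ chart 𝕜 a)
          (Module.Basis.ofVectorSpace E K l)) = scalars p (i ⁻¹ᵁ chart 𝕜 a) _ :=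
          congr($(scalars_map p (hpre a).ge).hom _)
        rw [h1, ← hsmul]
        refine Submodule.smul_mem _ _ (Submodule.subset_span fun σ hσ => ?_)
        change (A.act σ).appLE _ _ (le_act_preimage hi (chart 𝕜 a) σ) _ = _
        obtain ⟨σ', hσ'⟩ := exists_restrictScalars_eq σ (hE σ hσ)
        have h6 : A.act σ ≫ π = π := by rw [← hσ']; exact hX.act_comp σ'
        rw [Scheme.Hom.app_eq_appLE, res_appLE, appLE_appLE]
        exact appLE_congr h6 _ _ _)
    have ht : t ∈ (⊤ : Submodule K Γ(Y, i ⁻¹ᵁ chart 𝕜 a)) := trivial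
    rw [← hspan] at ht
    induction ht using Submodule.span_induction with
    | mem v hv => exact AddSubgroup.subset_closure ⟨1, v, hv, by rw [map_one, one_mul]⟩
    | zero => exact zero_mem _
    | add v w _ _ hv hw => exact add_mem hv hw
    | smul c v hv' hv =>
      clear hv'
      induction hv using AddSubgroup.closure_induction with
      | mem y hy =>
        obtain ⟨c', b, hb, rfl⟩ := hy
        refine AddSubgroup.subset_closure ⟨c * c', b, hb, ?_⟩
        rw [hsmul, map_mul, mul_assoc]
      | zero => rw [smul_zero]; exact zero_mem _
      | add v w _ _ hv hw => rw [smul_add]; exact add_mem hv hw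
      | neg v _ hv => rw [smul_neg]; exact neg_mem hv
  choose n g hg hgen using key
  exact A.hasModel_of_closure_eq i hi n g (fun a j σ => hg a j σ) hgen

/-- The properties that are passed from an extension field to the base field. -/
def GaloisAct.IsGood (𝕜 : Type u) [Field 𝕜] [Algebra 𝕜 F] [Algebra 𝕜 K] [IsScalarTower 𝕜 F K]
    (A : GaloisAct F p) : Prop :=
  A.HasAffineHom 𝕜 ∧ A.HasModel

/-- A continuous descent datum on a quasi-projective scheme becomes good over a finitely generated
field. -/
theorem DescentDatum.IsContinuous.exists_isGood {k : Type u} [Field k] [CharZero k] [Algebra k K]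
    {Y : Over (Spec (CommRingCat.of K))} {φ : DescentDatum k Y} (hφ : φ.IsContinuous)
    (hY : IsQuasiProjective Y) :
    ∃ S : Finset K,
      (φ.galoisAct.restrict (IntermediateField.adjoin k (S : Set K))).IsGood k := by
  classical
  obtain ⟨m, q, hq⟩ := hY
  have hft : LocallyOfFiniteType Y.hom := by
    rw [← Over.w q]
    have : LocallyOfFiniteType (projectiveSpace K m).hom :=
      inferInstanceAs (LocallyOfFiniteType (PSpace.str K (Fin (m + 1))))
    infer_instance
  have := isLocallyNoetherian_of_over (p := Y.hom)
  have hq' : IsImmersion (show Y.left ⟶ PSpace K (Fin (m + 1)) from q.left) := hq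
  obtain ⟨N, i, hi0, _⟩ := exists_isAffineHom_of_isImmersion (L := k) (κ := Fin (m + 1))
    (show Y.left ⟶ PSpace K (Fin (m + 1)) from q.left)
    (Y.hom ≫ Spec.map (CommRingCat.ofHom (algebraMap k K)))
  have haff : ∀ a, IsAffineOpen (i ⁻¹ᵁ chart k a) := fun a => (isAffineOpen_chart a).preimage i
  choose n g hgen using fun a => exists_fin_closure_eq Y.hom (haff a)
  -- The generators `g` are encoded as ratios of coordinates of `j`. Invariance of `j` over a field,
  -- which continuity provides, then makes all of them invariant.
  obtain ⟨j, hj0, hpre, hval, -⟩ := exists_hom_extending (L := k) (J := Σ a, Fin (n a)) i haff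
    Sigma.fst (fun q => g q.1 q.2) (Y.hom ≫ Spec.map (CommRingCat.ofHom (algebraMap k K)))
  obtain ⟨S₁, hS₁⟩ := hφ.exists_finset i hi0 (fun a => a) haff (iSup_preimage_chart i)
  obtain ⟨S₂, hS₂⟩ := hφ.exists_finset j hj0 Sum.inl (fun a => by rw [hpre]; exact haff a)
    (by simp only [hpre]; exact iSup_preimage_chart i)
  refine ⟨S₁ ∪ S₂, ?_⟩
  let E := IntermediateField.adjoin k ((S₁ ∪ S₂ : Finset K) : Set K)
  have hE : ∀ (σ : K ≃ₐ[E] K), ∀ x ∈ S₁ ∪ S₂, σ x = x := fun σ x hx =>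
    σ.commutes (⟨x, IntermediateField.subset_adjoin _ _ hx⟩ : E)
  have hi : ∀ σ, (φ.galoisAct.restrict E).act σ ≫ i = i := fun σ =>
    hS₁ (σ.restrictScalars k) fun x hx => hE σ x (Finset.mem_union_left _ hx)
  have hj : ∀ σ, (φ.galoisAct.restrict E).act σ ≫ j = j := fun σ =>
    hS₂ (σ.restrictScalars k) fun x hx => hE σ x (Finset.mem_union_right _ hx)
  refine ⟨⟨_, inferInstance, i, inferInstance, hi0, hi⟩, ?_⟩
  refine GaloisAct.hasModel_of_closure_eq _ i hi n g (fun a b σ => ?_) hgen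
  rw [← hval ⟨a, b⟩ (hpre a).ge, appLE_res]
  exact appLE_ratio (hj σ) _ _ _ _

end Good

/-- The automorphism `τ⁻¹ * σ` fixes `x`, hence `E`, hence `i`. So the conjugates of `i` are
parametrized by the values `σ x`. -/
theorem GaloisAct.act_comp_eq_of_apply_eq {F K : Type u} [Field F] [CharZero F] [Field K]
    [IsAlgClosed K] [Algebra F K] {Y : Scheme.{u}} {p : Y ⟶ Spec (CommRingCat.of K)}
    (A : GaloisAct F p) {E : Type u} [Field E] [Algebra F E]
    [Algebra E K] [IsScalarTower F E K] {x : K}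
    (hE : ∀ σ : K ≃ₐ[F] K, σ x = x → ∀ y : E, σ (algebraMap E K y) = algebraMap E K y)
    {Z : Scheme.{u}} {i : Y ⟶ Z} (hi : ∀ σ, (A.restrict E).act σ ≫ i = i) {σ τ : K ≃ₐ[F] K}
    (h : σ x = τ x) : A.act σ ≫ i = A.act τ ≫ i := by
  obtain ⟨ρ, hρ⟩ := exists_restrictScalars_eq (τ⁻¹ * σ) (hE _ (by
    change τ.symm (σ x) = x
    rw [AlgEquiv.symm_apply_eq, h]))
  have h1 : A.act (τ⁻¹ * σ) ≫ i = i := by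
    rw [← hρ]
    exact hi ρ
  rw [← mul_inv_cancel_left τ σ, A.act_mul, Category.assoc, h1]

/-! ### Removing an algebraic generator: the norm of a morphism -/

section AlgebraicStep

attribute [local instance] MvPolynomial.gradedAlgebra

variable {𝕜 F K : Type u} [Field 𝕜] [Field F] [Field K] [Algebra 𝕜 F] [Algebra 𝕜 K]
  [Algebra F K] [IsScalarTower 𝕜 F K] {Y : Scheme.{u}} {p : Y ⟶ Spec (CommRingCat.of K)}

instance (A : GaloisAct F p) (σ : K ≃ₐ[F] K) : IsIso (A.act σ) :=
  ⟨A.act σ⁻¹, by rw [← A.act_mul, mul_inv_cancel, A.act_one],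
    by rw [← A.act_mul, inv_mul_cancel, A.act_one]⟩

/-- The norm of an affine morphism to projective space that is invariant over a finite extension
`E = F(x)`. -/
theorem GaloisAct.hasAffineHom_of_isAlgebraic [CharZero 𝕜] [CharZero F] [IsAlgClosed K]
    (A : GaloisAct F p) (E : Type u)
    [Field E] [Algebra F E] [Algebra 𝕜 E] [Algebra E K] [IsScalarTower F E K]
    [IsScalarTower 𝕜 E K] (x : K)
    (hE : ∀ σ : K ≃ₐ[F] K, σ x = x → ∀ y : E, σ (algebraMap E K y) = algebraMap E K y)
    (hx : IsAlgebraic F x) (h : (A.restrict E).HasAffineHom 𝕜) : A.HasAffineHom 𝕜 := by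
  classical
  obtain ⟨ι, _, i, _, hi0, hi⟩ := h
  let C : Type u := ((minpoly F x).aroots K).toFinset
  have hC : ∀ y : K, y ∈ ((minpoly F x).aroots K).toFinset ↔
      Polynomial.aeval y (minpoly F x) = 0 := fun y => by
    rw [Multiset.mem_toFinset, Polynomial.mem_aroots]
    exact and_iff_right (minpoly.ne_zero hx.isIntegral)
  have hσ : ∀ y : C, ∃ σ : K ≃ₐ[F] K, σ x = y := fun y =>
    exists_algEquiv_apply_eq_of_isAlgebraic hx ((hC _).1 y.2)
  choose s hs using hσ
  let t : (K ≃ₐ[F] K) → C → C := fun τ y => ⟨τ y, (hC _).2 <|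
    (Polynomial.aeval_algHom_apply τ.toAlgHom _ _).trans
      ((congrArg τ ((hC _).1 y.2)).trans (map_zero τ))⟩
  have ht : ∀ τ, Function.Bijective (t τ) := fun τ => Finite.injective_iff_bijective.1
    fun y y' e => Subtype.ext (τ.injective (congrArg Subtype.val e))
  -- The conjugates of `i`, one for each root of the minimal polynomial of `x`; `Aut(K/F)` permutes
  -- them as it permutes the roots.
  let q : C → (Y ⟶ PSpace 𝕜 ι) := fun y => A.act (s y) ≫ i
  have hq : ∀ τ y, A.act τ ≫ q y = q (t τ y) := by
    intro τ y
    have h1 : (τ * s y) x = s (t τ y) x := by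
      rw [hs]
      exact congrArg τ (hs y)
    exact (Category.assoc _ _ _).symm.trans ((congrArg (· ≫ i) (A.act_mul τ (s y)).symm).trans
      (A.act_comp_eq_of_apply_eq hE hi h1))
  have : CompactSpace Y := QuasiCompact.compactSpace_of_compactSpace i
  have hsep : IsSeparated (i ≫ PSpace.str 𝕜 ι) := inferInstance
  have : Y.IsSeparated := ⟨by rw [← terminal.comp_from (i ≫ PSpace.str 𝕜 ι)]; infer_instance⟩
  -- At each point of `Y` one linear form is non-zero on the images under all the conjugates.
  -- Compactness then leaves finitely many forms `l`.
  have hform : ∀ y : Y, ∃ l : grading 𝕜 ι 1, ∀ c,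
      y ∈ q c ⁻¹ᵁ Proj.basicOpen _ (l : MvPolynomial ι 𝕜) :=
    fun y => exists_linearForm_of_points fun c => q c y
  choose l hl using hform
  let W : Y → Y.Opens := fun y => ⨅ c, q c ⁻¹ᵁ Proj.basicOpen _ (l y : MvPolynomial ι 𝕜)
  have hW : ∀ y z, z ∈ W y ↔
      ∀ c, z ∈ q c ⁻¹ᵁ Proj.basicOpen _ (l y : MvPolynomial ι 𝕜) := fun y z => by
    rw [← SetLike.mem_coe, Opens.coe_iInf, Set.mem_iInter]
    rfl
  obtain ⟨T, -, hT⟩ := isCompact_univ.elim_nhds_subcover (fun y => (W y : Set Y))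
    (fun y _ => (W y).2.mem_nhds ((hW y y).2 (hl y)))
  let e := T.equivFin.symm
  have hV : ⨆ a, W (e a) = ⊤ := by
    rw [eq_top_iff]
    intro z _
    obtain ⟨y, hy, hz⟩ := Set.mem_iUnion₂.1 (hT (Set.mem_univ z))
    have he : e (T.equivFin ⟨y, hy⟩) = ⟨y, hy⟩ := Equiv.symm_apply_apply _ _
    exact Opens.mem_iSup.2 ⟨T.equivFin ⟨y, hy⟩, by rw [he]; exact hz⟩
  -- The coordinate ratios of `j` are the products over all conjugates of the pull-backs of `l b / l
  -- a`. They are symmetric in the conjugates, which gives invariance.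
  obtain ⟨j, hj0, hj, hval⟩ := exists_hom_of_forms (grading 𝕜 ι) q (fun a => l (e a))
    (fun a => W (e a)) hV (fun a z => hW (e a) z)
    (p ≫ Spec.map (CommRingCat.ofHom (algebraMap 𝕜 K)))
  have : Nonempty C := ⟨⟨x, (hC x).2 (minpoly.aeval F x)⟩⟩
  refine ⟨_, inferInstance, j, isAffineHom_of_chart j fun a => ?_, hj0, fun τ => ?_⟩
  · rw [hj]
    -- A finite non-empty intersection of affine opens is affine, since `Y` is separated.
    refine IsAffineOpen.iInf fun c => ?_
    exact (Proj.isAffineOpen_basicOpen (grading 𝕜 ι) _ (l (e a)).2 one_pos).preimage (q c)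
  · have hWτ : ∀ a, W (e a) ≤ A.act τ ⁻¹ᵁ W (e a) := fun a z hz => by
      refine (hW _ _).2 fun c => ?_
      have h1 := (hW _ _).1 hz (t τ c)
      rw [← hq, Scheme.Hom.comp_preimage] at h1
      exact h1
    refine hom_ext_of_iSup_eq_top _ hV fun a => ?_
    have h1 : W (e a) ≤ j ⁻¹ᵁ chart 𝕜 a := (hj a).ge
    have h2 : W (e a) ≤ A.act τ ⁻¹ᵁ j ⁻¹ᵁ chart 𝕜 a :=
      (hWτ a).trans ((A.act τ).preimage_mono h1)
    have h3 : W (e a) ≤ (A.act τ ≫ j) ⁻¹ᵁ chart 𝕜 a := by rwa [Scheme.Hom.comp_preimage]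
    refine ι_comp_eq_of_ratio (by
      rw [Category.assoc, hj0]
      exact A.act_comp_algebraMap τ) a h3 h1 fun b => ?_
    have hr : res h1 (ratio j a b) = _ := (res_appLE _ _ _ _).trans (hval a h1 b)
    rw [← appLE_ratio rfl a b h2 h3, ← appLE_res (A.act τ) h1 (hWτ a), hr, map_prod]
    refine Fintype.prod_bijective (t τ) (ht τ) _ _ fun c => ?_
    rw [appLE_appLE]
    exact appLE_congr (hq τ c) _ _ _

end AlgebraicStep

/-! ### Affine morphisms out of a limit of schemes -/

section Limits

attribute [local instance] MvPolynomial.gradedAlgebra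

/-- An affine morphism from a limit to a projective space is defined and affine at a finite
level. -/
theorem exists_isAffineHom_of_isLimit {I : Type u} [Category.{u} I] [IsCofiltered I]
    {D : I ⥤ Scheme.{u}} [∀ {i j} (f : i ⟶ j), IsAffineHom (D.map f)] [∀ i, CompactSpace (D.obj i)]
    [∀ i, QuasiSeparatedSpace (D.obj i)] {c : Cone D} (hc : IsLimit c) {𝕜 : Type u} [Field 𝕜]
    {ι : Type} [Finite ι] (t : D ⟶ (Functor.const I).obj (Spec (CommRingCat.of 𝕜)))
    (q : c.pt ⟶ PSpace 𝕜 ι) (hqa : IsAffineHom q)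
    (hq : ∀ i, c.π.app i ≫ t.app i = q ≫ PSpace.str 𝕜 ι) :
    ∃ (i : I) (g : D.obj i ⟶ PSpace 𝕜 ι), IsAffineHom g ∧ c.π.app i ≫ g = q ∧
      g ≫ PSpace.str 𝕜 ι = t.app i := by
  obtain ⟨i, g, hg, hg0⟩ := Scheme.exists_π_app_comp_eq_of_locallyOfFinitePresentation D t
    (PSpace.str 𝕜 ι) c hc q (by ext j : 2; exact hq j)
  -- The preimage of a chart in the limit is affine, so it comes from an affine open subset at some
  -- level. Two quasi-compact opens with the same preimage in the limit already agree at a further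
  -- level.
  have key : ∀ b, ∃ (l : I) (h : l ⟶ i), IsAffineOpen (D.map h ⁻¹ᵁ g ⁻¹ᵁ chart 𝕜 b) := by
    intro b
    have h1 : c.π.app i ⁻¹ᵁ g ⁻¹ᵁ chart 𝕜 b = q ⁻¹ᵁ chart 𝕜 b := by
      simp only [← Scheme.Hom.comp_preimage, hg]
    obtain ⟨i', V, hV, hVU⟩ := exists_isAffineOpen_preimage_eq D c hc
      (q ⁻¹ᵁ chart 𝕜 b) ((isAffineOpen_chart b).preimage q)
    obtain ⟨k, h, h', -⟩ := IsCofilteredOrEmpty.cone_objs i i'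
    have hU : IsCompact ((D.map h ⁻¹ᵁ g ⁻¹ᵁ chart 𝕜 b : (D.obj k).Opens) : Set (D.obj k)) :=
      QuasiCompact.isCompact_preimage (f := D.map h) _ (g ⁻¹ᵁ chart 𝕜 b).2
        (QuasiCompact.isCompact_preimage (f := g) _ (chart 𝕜 b).2 (isAffineOpen_chart b).isCompact)
    have hV' : IsAffineOpen (D.map h' ⁻¹ᵁ V) := hV.preimage _
    obtain ⟨l, f, hl⟩ := exists_map_preimage_eq_map_preimage D c hc (i := k) hU
      hV'.isCompact (by
        have h2 := (Scheme.Hom.comp_preimage (c.π.app k) (D.map h) (g ⁻¹ᵁ chart 𝕜 b)).symm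
        have h3 := (Scheme.Hom.comp_preimage (c.π.app k) (D.map h') V).symm
        rw [c.w] at h2 h3
        rw [h2, h3, hVU, h1])
    refine ⟨l, f ≫ h, ?_⟩
    rw [D.map_comp, Scheme.Hom.comp_preimage, hl]
    exact hV'.preimage _
  choose l h hl using key
  obtain ⟨_⟩ := nonempty_fintype ι
  classical
  obtain ⟨m, hm, hm'⟩ := IsCofiltered.inf_exists (insert i (Finset.univ.image l))
    (Finset.univ.image fun b => ⟨l b, i, Finset.mem_insert_of_mem
      (Finset.mem_image_of_mem _ (Finset.mem_univ b)), Finset.mem_insert_self _ _, h b⟩)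
  let w : m ⟶ i := hm (Finset.mem_insert_self _ _)
  refine ⟨m, D.map w ≫ g, isAffineHom_of_chart _ fun b => ?_, ?_, ?_⟩
  · have h1 := hm' (Finset.mem_insert_of_mem
      (Finset.mem_image_of_mem _ (Finset.mem_univ b))) (Finset.mem_insert_self _ _)
      (Finset.mem_image_of_mem _ (Finset.mem_univ b))
    rw [Scheme.Hom.comp_preimage, show w = _ from h1.symm, D.map_comp, Scheme.Hom.comp_preimage]
    exact (hl b).preimage _
  · rw [← hg, ← c.w w, Category.assoc]
  · rw [Category.assoc, hg0]
    exact (t.naturality w).trans (Category.comp_id _)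

end Limits

/-! ### Base change to a directed family of subalgebras -/

section Spreading

variable {E : Type u} [CommRing E] {X : Scheme.{u}} (r : X ⟶ Spec (CommRingCat.of E))

/-- The base change of an `E`-scheme to an `E`-algebra. -/
noncomputable abbrev changeBase (R : Type u) [CommRing R] [Algebra E R] : Scheme.{u} :=
  pullback r (Spec.map (CommRingCat.ofHom (algebraMap E R)))

noncomputable abbrev changeBaseFst (R : Type u) [CommRing R] [Algebra E R] : changeBase r R ⟶ X :=
  pullback.fst _ _

noncomputable abbrev changeBaseSnd (R : Type u) [CommRing R] [Algebra E R] :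
    changeBase r R ⟶ Spec (CommRingCat.of R) :=
  pullback.snd _ _

instance isAffineHom_changeBaseFst (R : Type u) [CommRing R] [Algebra E R] :
    IsAffineHom (changeBaseFst r R) :=
  MorphismProperty.of_isPullback (P := @IsAffineHom) (IsPullback.of_hasPullback _ _).flip
    inferInstance

theorem compactSpace_changeBase [CompactSpace X] (R : Type u) [CommRing R] [Algebra E R] :
    CompactSpace (changeBase r R) :=
  QuasiCompact.compactSpace_of_compactSpace (changeBaseFst r R)

theorem quasiSeparatedSpace_changeBase [QuasiSeparatedSpace X] (R : Type u) [CommRing R]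
    [Algebra E R] : QuasiSeparatedSpace (changeBase r R) :=
  quasiSeparatedSpace_of_quasiSeparated (changeBaseFst r R)

variable {R R' : Type u} [CommRing R] [CommRing R'] [Algebra E R] [Algebra E R']

theorem SpecMap_algHom (f : R →ₐ[E] R') :
    Spec.map (CommRingCat.ofHom (f : R →+* R')) ≫ Spec.map (CommRingCat.ofHom (algebraMap E R)) =
      Spec.map (CommRingCat.ofHom (algebraMap E R')) := by
  rw [← Spec.map_comp, ← CommRingCat.ofHom_comp, f.comp_algebraMap]

noncomputable def changeBaseMap (f : R →ₐ[E] R') : changeBase r R' ⟶ changeBase r R :=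
  pullback.lift (changeBaseFst r R')
    (changeBaseSnd r R' ≫ Spec.map (CommRingCat.ofHom (f : R →+* R')))
    (by rw [pullback.condition, Category.assoc, SpecMap_algHom])

theorem changeBaseMap_fst (f : R →ₐ[E] R') :
    changeBaseMap r f ≫ changeBaseFst r R = changeBaseFst r R' := pullback.lift_fst _ _ _

theorem changeBaseMap_snd (f : R →ₐ[E] R') :
    changeBaseMap r f ≫ changeBaseSnd r R =
      changeBaseSnd r R' ≫ Spec.map (CommRingCat.ofHom (f : R →+* R')) := pullback.lift_snd _ _ _

theorem isPullback_changeBaseMap {X' : Scheme.{u}} {ρ : X' ⟶ X} {r' : X' ⟶ Spec (CommRingCat.of R')}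
    (H : IsPullback ρ r' r (Spec.map (CommRingCat.ofHom (algebraMap E R')))) (f : R →ₐ[E] R')
    (c : X' ⟶ changeBase r R) (h1 : c ≫ changeBaseFst r R = ρ)
    (h2 : c ≫ changeBaseSnd r R = r' ≫ Spec.map (CommRingCat.ofHom (f : R →+* R'))) :
    IsPullback c r' (changeBaseSnd r R) (Spec.map (CommRingCat.ofHom (f : R →+* R'))) := by
  refine IsPullback.of_right (h₁₂ := changeBaseFst r R) (v₁₃ := r)
    (h₂₂ := Spec.map (CommRingCat.ofHom (algebraMap E R))) ?_ h2 (IsPullback.of_hasPullback _ _)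
  rwa [h1, SpecMap_algHom]

instance (f : R →ₐ[E] R') : IsAffineHom (changeBaseMap r f) := by
  have : IsAffineHom (changeBaseMap r f ≫ changeBaseFst r R) := by
    rw [changeBaseMap_fst]; infer_instance
  exact IsAffineHom.of_comp _ (changeBaseFst r R)

variable {M : Type u} [CommRing M] [Algebra E M] {J : Type u} [Preorder J]
  (B : J →o Subalgebra E M)

/-- A monotone family of subalgebras as a diagram of rings. -/
def ringDiagram : J ⥤ CommRingCat.{u} where
  obj j := CommRingCat.of (B j)
  map h := CommRingCat.ofHom (Subalgebra.inclusion (B.monotone h.le)).toRingHom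
  map_id _ := rfl
  map_comp _ _ := rfl

/-- The ambient algebra as a cocone over a diagram of subalgebras. -/
def ringCocone : Cocone (ringDiagram B) where
  pt := CommRingCat.of M
  ι := { app := fun j => CommRingCat.ofHom (B j).val.toRingHom
         naturality := fun _ _ _ => rfl }

theorem nonempty_isColimit_ringCocone [IsDirectedOrder J] [Nonempty J] (hB : ∀ x, ∃ j, x ∈ B j) :
    Nonempty (IsColimit (ringCocone B)) := by
  have : ReflectsColimit (ringDiagram B) (forget CommRingCat.{u}) :=
    reflectsColimit_of_reflectsIsomorphisms _ _
  refine ⟨isColimitOfReflects (forget CommRingCat) ?_⟩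
  refine Types.FilteredColimit.isColimitOf _ _ (fun x => ?_) fun i j x y h => ?_
  · obtain ⟨j, hj⟩ := hB x
    exact ⟨j, ⟨x, hj⟩, rfl⟩
  · obtain ⟨k, hi, hj⟩ := exists_ge_ge i j
    exact ⟨k, homOfLE hi, homOfLE hj, Subtype.ext h⟩

/-- The base changes of an `E`-scheme to the members of a family of algebras. -/
noncomputable def schemeDiagram : Jᵒᵖ ⥤ Scheme.{u} where
  obj j := changeBase r (B j.unop)
  map h := changeBaseMap r (Subalgebra.inclusion (B.monotone h.unop.le))
  map_id j := by
    apply pullback.hom_ext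
    · exact (changeBaseMap_fst r _).trans (Category.id_comp _).symm
    · refine (changeBaseMap_snd r _).trans ?_
      refine Eq.trans ?_ (Category.id_comp _).symm
      exact (congrArg _ (Spec.map_id _)).trans (Category.comp_id _)
  map_comp h h' := by
    apply pullback.hom_ext
    · rw [Category.assoc]
      simp only [changeBaseMap_fst]
    · rw [Category.assoc]
      refine (changeBaseMap_snd r _).trans ?_
      refine Eq.trans ?_ (congrArg (changeBaseMap r _ ≫ ·) (changeBaseMap_snd r _)).symm
      refine Eq.trans ?_ (Category.assoc _ _ _)
      rw [changeBaseMap_snd, Category.assoc, ← Spec.map_comp]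
      rfl

/-- The projection of the base changes to the spectra. -/
noncomputable def schemeDiagramSnd : schemeDiagram r B ⟶ (ringDiagram B).op ⋙ Scheme.Spec where
  app j := changeBaseSnd r (B j.unop)
  naturality _ _ _ := changeBaseMap_snd r _

instance {i j : Jᵒᵖ} (h : i ⟶ j) : IsAffineHom ((schemeDiagram r B).map h) :=
  inferInstanceAs (IsAffineHom (changeBaseMap r _))

instance [CompactSpace X] (j : Jᵒᵖ) : CompactSpace ((schemeDiagram r B).obj j) :=
  compactSpace_changeBase r (B j.unop)

instance [QuasiSeparatedSpace X] (j : Jᵒᵖ) : QuasiSeparatedSpace ((schemeDiagram r B).obj j) :=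
  quasiSeparatedSpace_changeBase r (B j.unop)

section Cone

variable {X' : Scheme.{u}} {ρ : X' ⟶ X} {r' : X' ⟶ Spec (CommRingCat.of M)}
    (H : IsPullback ρ r' r (Spec.map (CommRingCat.ofHom (algebraMap E M))))

/-- The projection of the base change to a subalgebra. -/
noncomputable def toChangeBase (S : Subalgebra E M) : X' ⟶ changeBase r S :=
  pullback.lift ρ (r' ≫ Spec.map (CommRingCat.ofHom (S.val : S →+* M)))
    (by rw [H.w, Category.assoc, SpecMap_algHom])

theorem toChangeBase_fst (S : Subalgebra E M) : toChangeBase r H S ≫ changeBaseFst r S = ρ :=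
  pullback.lift_fst _ _ _

theorem toChangeBase_snd (S : Subalgebra E M) : toChangeBase r H S ≫ changeBaseSnd r S =
    r' ≫ Spec.map (CommRingCat.ofHom (S.val : S →+* M)) :=
  pullback.lift_snd _ _ _

/-- The base change to the ambient algebra as a cone over the base changes to subalgebras. -/
noncomputable def schemeCone : Cone (schemeDiagram r B) where
  pt := X'
  π :=
    { app := fun j => toChangeBase r H (B j.unop)
      naturality := fun i j h => by
        refine (Category.id_comp _).trans ?_
        apply pullback.hom_ext
        · refine (toChangeBase_fst r H _).trans ?_
          refine Eq.trans ?_ (Category.assoc _ _ _).symm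
          refine Eq.trans ?_ (congrArg (toChangeBase r H _ ≫ ·) (changeBaseMap_fst r _)).symm
          exact (toChangeBase_fst r H _).symm
        · refine (toChangeBase_snd r H _).trans ?_
          refine Eq.trans ?_ (Category.assoc _ _ _).symm
          refine Eq.trans ?_ (congrArg (toChangeBase r H _ ≫ ·) (changeBaseMap_snd r _)).symm
          refine Eq.trans ?_ (Category.assoc _ _ _)
          refine Eq.trans ?_ (congrArg (· ≫ Spec.map (CommRingCat.ofHom _))
            (toChangeBase_snd r H _)).symm
          rw [Category.assoc, ← Spec.map_comp]
          rfl }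

/-- The spectrum of the union is the limit of the spectra, and the diagram of schemes is its base
change along `r`. Pulling back preserves limits of connected shape. -/
theorem nonempty_isLimit_schemeCone [IsDirectedOrder J] [Nonempty J] (hB : ∀ x, ∃ j, x ∈ B j) :
    Nonempty (IsLimit (schemeCone r B H)) := by
  obtain ⟨h⟩ := nonempty_isColimit_ringCocone B hB
  have : IsConnected Jᵒᵖ := IsCofiltered.isConnected _
  refine ⟨isLimitOfIsPullbackOfIsConnected (schemeDiagramSnd r B) _
    (Scheme.Spec.mapCone (ringCocone B).op) { hom := r', w := fun j => ?_ } (fun j => ?_)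
    (isLimitOfPreserves Scheme.Spec h.op)⟩
  · exact (toChangeBase_snd r H _).symm
  · exact isPullback_changeBaseMap r H (B j.unop).val _ (toChangeBase_fst r H _)
      (toChangeBase_snd r H _)

attribute [local instance] MvPolynomial.gradedAlgebra in
/-- An affine morphism from a base change to a projective space is defined and affine over a
subalgebra. -/
theorem exists_isAffineHom_of_directed [IsDirectedOrder J] [Nonempty J] (hB : ∀ x, ∃ j, x ∈ B j)
    [CompactSpace X] [QuasiSeparatedSpace X] {𝕜 : Type u} [Field 𝕜] {ι : Type} [Finite ι]
    (u : Spec (CommRingCat.of E) ⟶ Spec (CommRingCat.of 𝕜)) (q : X' ⟶ PSpace 𝕜 ι) [IsAffineHom q]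
    (hq : q ≫ PSpace.str 𝕜 ι = ρ ≫ r ≫ u) :
    ∃ (j : J) (g : changeBase r (B j) ⟶ PSpace 𝕜 ι), IsAffineHom g ∧
      toChangeBase r H (B j) ≫ g = q ∧ g ≫ PSpace.str 𝕜 ι = changeBaseFst r (B j) ≫ r ≫ u := by
  obtain ⟨hc⟩ := nonempty_isLimit_schemeCone r B H hB
  obtain ⟨j, g, h1, h2, h3⟩ := exists_isAffineHom_of_isLimit hc
    { app := fun j => changeBaseFst r (B j.unop) ≫ r ≫ u
      naturality := fun i j h => by
        refine Eq.trans ?_ (Category.comp_id _).symm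
        refine (Category.assoc _ _ _).symm.trans ?_
        exact congrArg (· ≫ r ≫ u) (changeBaseMap_fst r _) } q ‹_› (fun i =>
      ((Category.assoc _ _ _).symm.trans
        (congrArg (· ≫ r ≫ u) (toChangeBase_fst r H _))).trans hq.symm)
  exact ⟨j.unop, g, h1, h2, h3⟩

end Cone

end Spreading

/-! ### The algebras `E[X, 1/f]` inside `E(X)` -/

section PolynomialLocalization

open Polynomial

variable {E : Type u} [Field E]

/-- `E[X, 1/f]` as a subalgebra of `E(X)`. -/
noncomputable def polyLoc (f : E[X]) (hf : f ≠ 0) : Subalgebra E (FractionRing E[X]) :=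
  (Localization.subalgebra.ofField (FractionRing E[X]) (Submonoid.powers f)
    (powers_le_nonZeroDivisors_of_noZeroDivisors hf)).restrictScalars E

variable {f : E[X]} {hf : f ≠ 0}

theorem mem_polyLoc {y : FractionRing E[X]} : y ∈ polyLoc f hf ↔ ∃ (a : E[X]) (n : ℕ),
    y = algebraMap _ _ a * (algebraMap E[X] (FractionRing E[X]) (f ^ n))⁻¹ := by
  constructor
  · rintro ⟨a, _, ⟨n, rfl⟩, rfl⟩
    exact ⟨a, n, rfl⟩
  · rintro ⟨a, n, rfl⟩
    exact ⟨a, _, ⟨n, rfl⟩, rfl⟩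

variable (f hf) in
/-- The inclusion of `E[X]` in `E[X, 1/f]`. -/
noncomputable def toPolyLoc : E[X] →+* polyLoc f hf :=
  algebraMap E[X] (Localization.subalgebra.ofField (FractionRing E[X]) (Submonoid.powers f)
    (powers_le_nonZeroDivisors_of_noZeroDivisors hf))

theorem coe_toPolyLoc (a : E[X]) : (toPolyLoc f hf a : FractionRing E[X]) = algebraMap _ _ a := rfl

theorem exists_polyLoc_lift {D : Type*} [CommRing D] (φ : E[X] →+* D) (h : IsUnit (φ f)) :
    ∃ ψ : polyLoc f hf →+* D, ψ.comp (toPolyLoc f hf) = φ := by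
  let S := Localization.subalgebra.ofField (FractionRing E[X]) (Submonoid.powers f)
    (powers_le_nonZeroDivisors_of_noZeroDivisors hf)
  have h1 : ∀ y : Submonoid.powers f, IsUnit (φ y) := by
    rintro ⟨_, n, rfl⟩
    rw [map_pow]
    exact h.pow n
  exact ⟨(IsLocalization.lift (S := S) h1 : S →+* D), IsLocalization.lift_comp (S := S) h1⟩

theorem polyLoc_hom_ext {D : Type*} [CommRing D] {ψ ψ' : polyLoc f hf →+* D}
    (h : ψ.comp (toPolyLoc f hf) = ψ'.comp (toPolyLoc f hf)) : ψ = ψ' :=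
  IsLocalization.ringHom_ext (R := E[X]) (S := Localization.subalgebra.ofField (FractionRing E[X])
    (Submonoid.powers f) (powers_le_nonZeroDivisors_of_noZeroDivisors hf)) (Submonoid.powers f) h

theorem polyLoc_le_mul {g : E[X]} (hg : g ≠ 0) :
    polyLoc f hf ≤ polyLoc (f * g) (mul_ne_zero hf hg) := by
  intro y hy
  obtain ⟨a, n, rfl⟩ := mem_polyLoc.1 hy
  refine mem_polyLoc.2 ⟨a * g ^ n, n, ?_⟩
  have h1 : algebraMap E[X] (FractionRing E[X]) (g ^ n) ≠ 0 := by
    simpa using pow_ne_zero n hg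
  rw [mul_pow, map_mul, map_mul, mul_inv]
  field_simp

theorem exists_mem_polyLoc (y : FractionRing E[X]) :
    ∃ (f : E[X]) (hf : f ≠ 0), y ∈ polyLoc f hf := by
  obtain ⟨a, b, hb, rfl⟩ := IsFractionRing.div_surjective (A := E[X]) y
  exact ⟨b, nonZeroDivisors.ne_zero hb, mem_polyLoc.2 ⟨a, 1, by rw [pow_one, div_eq_mul_inv]⟩⟩

attribute [local instance] MvPolynomial.gradedAlgebra in
/-- An affine morphism from a base change to `E(X)` to a projective space is defined and affine
over some `E[X, 1/f]`. -/
theorem exists_isAffineHom_polyLoc {X X' : Scheme.{u}} (r : X ⟶ Spec (CommRingCat.of E))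
    {ρ : X' ⟶ X} {r' : X' ⟶ Spec (CommRingCat.of (FractionRing E[X]))}
    (H : IsPullback ρ r' r (Spec.map (CommRingCat.ofHom (algebraMap E (FractionRing E[X])))))
    [CompactSpace X] [QuasiSeparatedSpace X] {𝕜 : Type u} [Field 𝕜] {ι : Type} [Finite ι]
    (u : Spec (CommRingCat.of E) ⟶ Spec (CommRingCat.of 𝕜)) (q : X' ⟶ PSpace 𝕜 ι) [IsAffineHom q]
    (hq : q ≫ PSpace.str 𝕜 ι = ρ ≫ r ≫ u) :
    ∃ (f : E[X]) (hf : f ≠ 0) (g : changeBase r (polyLoc f hf) ⟶ PSpace 𝕜 ι), IsAffineHom g ∧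
      toChangeBase r H (polyLoc f hf) ≫ g = q ∧
      g ≫ PSpace.str 𝕜 ι = changeBaseFst r (polyLoc f hf) ≫ r ≫ u := by
  -- Indexing by the subalgebras themselves gives the order by inclusion. Directedness comes from
  -- products of denominators.
  let J := {S : Subalgebra E (FractionRing E[X]) // ∃ (f : E[X]) (hf : f ≠ 0), S = polyLoc f hf}
  have : Nonempty J := ⟨⟨_, 1, one_ne_zero, rfl⟩⟩
  have : IsDirectedOrder J := ⟨by
    rintro ⟨_, f, hf, rfl⟩ ⟨_, g, hg, rfl⟩
    refine ⟨⟨_, f * g, mul_ne_zero hf hg, rfl⟩, polyLoc_le_mul (hf := hf) hg, ?_⟩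
    change polyLoc g hg ≤ polyLoc (f * g) (mul_ne_zero hf hg)
    have h := polyLoc_le_mul (f := g) (hf := hg) hf
    simp only [mul_comm f g]
    exact h⟩
  obtain ⟨⟨_, f, hf, rfl⟩, g, h⟩ := exists_isAffineHom_of_directed r
    (OrderHom.Subtype.val (fun S => ∃ (f : E[X]) (hf : f ≠ 0), S = polyLoc f hf)) H
    (fun y => by
      obtain ⟨f, hf, h⟩ := exists_mem_polyLoc y
      exact ⟨⟨_, f, hf, rfl⟩, h⟩) u q hq
  exact ⟨f, hf, g, h⟩

end PolynomialLocalization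

/-! ### The generic conjugate and its spreading out -/

section TranscendentalStep

open Polynomial

/-- The numerator of `d` is a polynomial that vanishes at the infinitely many points of `T`. -/
theorem polyLoc_eq_zero {K : Type u} [Field K] {f : K[X]} {hf : f ≠ 0} {T : Set K}
    (hT : T.Infinite) (θ : T → polyLoc f hf →+* K)
    (hθ : ∀ s, (θ s).comp (toPolyLoc f hf) = evalRingHom (s : K)) {d : polyLoc f hf}
    (hd : ∀ s, θ s d = 0) : d = 0 := by
  obtain ⟨a, n, h⟩ := mem_polyLoc.1 d.2
  have h0 : algebraMap K[X] (FractionRing K[X]) (f ^ n) ≠ 0 := by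
    simpa using pow_ne_zero n hf
  have h1 : toPolyLoc f hf a = d * toPolyLoc f hf (f ^ n) := by
    apply Subtype.ext
    rw [coe_toPolyLoc, MulMemClass.coe_mul, coe_toPolyLoc, h, inv_mul_cancel_right₀ h0]
  have h2 : a = 0 := by
    refine eq_zero_of_infinite_isRoot a (hT.mono fun s hs => ?_)
    have h3 := congr($(hθ ⟨s, hs⟩) a)
    have h4 := congrArg (θ ⟨s, hs⟩) h1
    rw [map_mul, hd, zero_mul] at h4
    exact h3.symm.trans h4
  apply Subtype.ext
  rw [h, h2, map_zero, zero_mul]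
  rfl

theorem transcendental_of_forall_mem {F E K : Type u} [Field F] [Field E] [Field K] [Algebra F K]
    [Algebra E K] {E' : IntermediateField F K} (h : ∀ y : E, algebraMap E K y ∈ E') {t : K}
    (ht : Transcendental E' t) : Transcendental E t := by
  rintro ⟨p, hp, hpt⟩
  let j : E →+* E' := (algebraMap E K).codRestrict E'.toSubring h
  refine ht ⟨p.map j, (Polynomial.map_ne_zero_iff j.injective).2 hp, ?_⟩
  rw [aeval_def, eval₂_map]
  exact hpt

variable {F K : Type u} [Field F] [Field K] [Algebra F K] [CharZero F]
  [IsAlgClosed K] {Y : Scheme.{u}} {p : Y ⟶ Spec (CommRingCat.of K)}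

/-- The image of `E` is fixed by `Aut(K/F(x))`, whose fixed field is `F(x)`. So elements
transcendental over `F(x)` are transcendental over `E`. -/
theorem forall_mem_adjoin_of_fixed {E : Type u} [Field E]
    [Algebra F E] [Algebra E K] [IsScalarTower F E K] {x : K}
    (hE : ∀ σ : K ≃ₐ[F] K, σ x = x → ∀ y : E, σ (algebraMap E K y) = algebraMap E K y) (y : E) :
    algebraMap E K y ∈ IntermediateField.adjoin F {x} := by
  have : CharZero (IntermediateField.adjoin F {x}) :=
    charZero_of_injective_algebraMap (algebraMap F _).injective
  obtain ⟨z, hz⟩ := mem_range_algebraMap_of_fixed (F := IntermediateField.adjoin F {x})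
    (a := algebraMap E K y) fun σ => hE (σ.restrictScalars F)
      (σ.commutes (IntermediateField.AdjoinSimple.gen F x)) y
  rw [← hz]
  exact z.2

/-- Infinitely many elements are transcendental over two conjugate fields. -/
theorem infinite_transcendental_conjugates (htr : Cardinal.aleph0 ≤ Algebra.trdeg F K)
    (x : K) (τ : K ≃ₐ[F] K) :
    {s : K | Transcendental (IntermediateField.adjoin F {x}) s ∧
      Transcendental (IntermediateField.adjoin F {x}) (τ.symm s)}.Infinite := by
  let E := IntermediateField.adjoin F {x}
  have hE : E.FG := fg_adjoin_simple F x
  have hE' : (E ⊔ E.map τ.toAlgHom).FG := by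
    have h : (E.map τ.toAlgHom).FG := by
      rw [IntermediateField.adjoin_map, Set.image_singleton]
      exact fg_adjoin_simple F _
    obtain ⟨S, hS⟩ := hE
    obtain ⟨S', hS'⟩ := h
    classical
    exact ⟨S ∪ S', by rw [Finset.coe_union, IntermediateField.adjoin_union, hS, hS']⟩
  obtain ⟨a, ha⟩ := exists_transcendental_of_fg htr hE'
  refine (infinite_translates ha).mono fun s hs => ⟨transcendental_of_le le_sup_left hs, ?_⟩
  exact transcendental_apply_of_map τ (transcendental_of_le le_sup_right hs)

attribute [local instance] MvPolynomial.gradedAlgebra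

variable {𝕜 : Type u} [Field 𝕜] [Algebra 𝕜 F] [Algebra 𝕜 K] [IsScalarTower 𝕜 F K]

/-- The generic conjugate of an affine morphism to projective space over `E = F(x)`, spread out. -/
theorem GaloisAct.exists_polyLoc_family (htr : Cardinal.aleph0 ≤ Algebra.trdeg F K)
    (A : GaloisAct F p) (E : Type u) [Field E] [Algebra F E] [Algebra 𝕜 E] [Algebra E K]
    [IsScalarTower F E K] [IsScalarTower 𝕜 E K] {x : K}
    (hE : ∀ σ : K ≃ₐ[F] K, σ x = x → ∀ y : E, σ (algebraMap E K y) = algebraMap E K y)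
    (hx : Transcendental F x) {ι : Type} [Finite ι] {i : Y ⟶ PSpace 𝕜 ι} [IsAffineHom i]
    (hi0 : i ≫ PSpace.str 𝕜 ι = p ≫ Spec.map (CommRingCat.ofHom (algebraMap 𝕜 K)))
    (hi : ∀ σ, (A.restrict E).act σ ≫ i = i) {X : Scheme.{u}} [CompactSpace X]
    [QuasiSeparatedSpace X] {r : X ⟶ Spec (CommRingCat.of E)} {π : Y ⟶ X}
    (hX : (A.restrict E).IsModel r π) :
    ∃ (f : E[X]) (hf : f ≠ 0) (g : changeBase r (polyLoc f hf) ⟶ PSpace 𝕜 ι), IsAffineHom g ∧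
      g ≫ PSpace.str 𝕜 ι = changeBaseFst r (polyLoc f hf) ≫ r ≫
        Spec.map (CommRingCat.ofHom (algebraMap 𝕜 E)) ∧
      ∀ (t : K) (θ : polyLoc f hf →+* K) (j : Y ⟶ changeBase r (polyLoc f hf)) (σ : K ≃ₐ[F] K),
        Transcendental E t → θ.comp (toPolyLoc f hf) = (aeval t : E[X] →ₐ[E] K) →
        j ≫ changeBaseFst r _ = π →
        j ≫ changeBaseSnd r _ = p ≫ Spec.map (CommRingCat.ofHom θ) →
        σ x = t → j ≫ g = A.act σ ≫ i := by
  have : CharZero E := charZero_of_injective_algebraMap (algebraMap F E).injective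
  obtain ⟨y, hy'⟩ := exists_transcendental_of_fg htr (fg_adjoin_simple F x)
  have hy : Transcendental E y := transcendental_of_forall_mem (forall_mem_adjoin_of_fixed hE) hy'
  have hyF : Transcendental F y := hy'.restrictScalars (algebraMap F _).injective
  obtain ⟨σ₀, hσ₀⟩ := exists_algEquiv_apply_eq_of_transcendental hx hyF
  let M := FractionRing E[X]
  -- The variable goes to the generic parameter `y`, so `E(X)` is identified with `E(y)` inside `K`.
  let ev : M →ₐ[E] K := IsFractionRing.liftAlgHom (g := aeval y) (transcendental_iff_injective.1 hy)
  have hev : ∀ a : E[X], ev (algebraMap E[X] M a) = aeval y a := fun a =>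
    IsFractionRing.lift_algebraMap (g := (aeval y : E[X] →ₐ[E] K).toRingHom)
      (transcendental_iff_injective.1 hy) a
  let _ : Algebra M K := ev.toRingHom.toAlgebra
  have : IsScalarTower E M K := IsScalarTower.of_algebraMap_eq fun a => (ev.commutes a).symm
  have : CharZero M := charZero_of_injective_algebraMap (algebraMap E M).injective
  let A' := (A.restrict E).restrict M
  have hp : ∀ σ : K ≃ₐ[E] K, (A.restrict E).act σ ≫ p = p ≫ specAut σ := (A.restrict E).act_over
  let π' : Y ⟶ changeBase r M := pullback.lift π
    (p ≫ Spec.map (CommRingCat.ofHom (algebraMap M K))) (by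
      rw [hX.isPullback.w, Category.assoc, ← Spec.map_comp, ← CommRingCat.ofHom_comp,
        ← IsScalarTower.algebraMap_eq])
  have hπ'1 : π' ≫ changeBaseFst r M = π := pullback.lift_fst _ _ _
  have hπ'2 : π' ≫ changeBaseSnd r M = p ≫ Spec.map (CommRingCat.ofHom (algebraMap M K)) :=
    pullback.lift_snd _ _ _
  have hX' : A'.IsModel (changeBaseSnd r M) π' := by
    refine ⟨isPullback_changeBaseMap r hX.isPullback ev _ hπ'1 hπ'2, fun σ => ?_⟩
    apply pullback.hom_ext
    · rw [Category.assoc, hπ'1]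
      exact hX.act_comp _
    · rw [Category.assoc, hπ'2]
      exact A'.act_comp_algebraMap σ
  -- The generic conjugate, with parameter `σ₀ x = y`. It is invariant over `E(y)` because `σ y = y`
  -- gives `σ (σ₀ x) = σ₀ x`, so it descends to the base change of `X` to `E(X)` and spreads out
  -- from there.
  let i₀ : Y ⟶ PSpace 𝕜 ι := A.act σ₀ ≫ i
  have hi₀ : ∀ σ, A'.act σ ≫ i₀ = i₀ := fun σ => by
    change A.act ((σ.restrictScalars E).restrictScalars F) ≫ A.act σ₀ ≫ i = A.act σ₀ ≫ i
    rw [← Category.assoc, ← A.act_mul]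
    refine A.act_comp_eq_of_apply_eq hE hi ?_
    change σ (σ₀ x) = σ₀ x
    have h1 : σ₀ x = algebraMap M K (algebraMap E[X] M Polynomial.X) := by
      rw [hσ₀]
      exact ((hev Polynomial.X).trans (aeval_X y)).symm
    rw [h1, σ.commutes]
  have hsep : (PSpace 𝕜 ι).IsSeparated := ⟨by
    rw [← terminal.comp_from (PSpace.str 𝕜 ι)]; infer_instance⟩
  obtain ⟨q, hq⟩ := hX'.exists_desc i₀ hi₀
  have hi₀0 : i₀ ≫ PSpace.str 𝕜 ι = p ≫ Spec.map (CommRingCat.ofHom (algebraMap 𝕜 K)) := by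
    rw [Category.assoc, hi0, A.act_comp_algebraMap]
  have hu : π ≫ r ≫ Spec.map (CommRingCat.ofHom (algebraMap 𝕜 E)) =
      p ≫ Spec.map (CommRingCat.ofHom (algebraMap 𝕜 K)) := by
    rw [← Category.assoc, hX.isPullback.w, Category.assoc, ← Spec.map_comp,
      ← CommRingCat.ofHom_comp, ← IsScalarTower.algebraMap_eq]
  have hcm : CompactSpace (changeBase r M) := compactSpace_changeBase r M
  have hqs : QuasiSeparatedSpace (changeBase r M) := quasiSeparatedSpace_changeBase r M
  have := hX'.surjective
  have hqa : IsAffineHom q := isAffineHom_of_chart q fun b =>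
    isAffineOpen_of_isPullback hX'.isPullback (by
      rw [← Scheme.Hom.comp_preimage, hq]
      exact (isAffineOpen_chart b).preimage i₀)
  have H : IsPullback (changeBaseFst r M) (changeBaseSnd r M) r
    (Spec.map (CommRingCat.ofHom (algebraMap E M))) := IsPullback.of_hasPullback _ _
  obtain ⟨f, hf, g, hg, hgq, hg0⟩ := exists_isAffineHom_polyLoc r H
    (Spec.map (CommRingCat.ofHom (algebraMap 𝕜 E))) q (by
      refine hX'.desc_unique ?_
      rw [reassoc_of% hq, hi₀0, reassoc_of% hπ'1, hu])
  refine ⟨f, hf, g, hg, hg0, fun t θ j σ ht hθ hj1 hj2 hσ => ?_⟩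
  -- An automorphism over `E` taking `y` to `t` transports the generic member of the family to the
  -- member at `t`.
  obtain ⟨ρ, hρ⟩ := exists_algEquiv_apply_eq_of_transcendental hy ht
  have hj : j = (A.restrict E).act ρ ≫ π' ≫ toChangeBase r H (polyLoc f hf) := by
    apply pullback.hom_ext
    · rw [Category.assoc, Category.assoc, toChangeBase_fst, hπ'1, hX.act_comp]
      exact hj1
    · rw [Category.assoc, Category.assoc, toChangeBase_snd, reassoc_of% hπ'2, reassoc_of% hp,
        ← Spec.map_comp, ← Spec.map_comp]
      refine hj2.trans ?_
      congr 3
      refine polyLoc_hom_ext (hθ.trans (RingHom.ext fun a => ?_))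
      change aeval t a = ρ (ev (algebraMap E[X] M a))
      rw [hev, ← hρ]
      exact aeval_algHom_apply ρ.toAlgHom y a
  rw [hj, Category.assoc, Category.assoc, hgq, hq]
  change A.act (ρ.restrictScalars F) ≫ A.act σ₀ ≫ i = _
  rw [← Category.assoc, ← A.act_mul]
  refine A.act_comp_eq_of_apply_eq hE hi ?_
  rw [hσ]
  change ρ (σ₀ x) = t
  rw [hσ₀, hρ]

end TranscendentalStep

/-! ### Removing a transcendental generator: specialization at a rational point -/

section Specialization

open Polynomial

attribute [local instance] MvPolynomial.gradedAlgebra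

variable {𝕜 F K : Type u} [Field 𝕜] [Field F] [Field K] [Algebra 𝕜 F] [Algebra 𝕜 K]
  [Algebra F K] [IsScalarTower 𝕜 F K] [CharZero F]
  [IsAlgClosed K] {Y : Scheme.{u}} {p : Y ⟶ Spec (CommRingCat.of K)}

theorem polyLoc_comp_algebraMap {E K : Type u} [Field E] [CommRing K] {f : E[X]} {hf : f ≠ 0}
    {θ : polyLoc f hf →+* K} {φ : E[X] →+* K} (h : θ.comp (toPolyLoc f hf) = φ) :
    θ.comp (algebraMap E (polyLoc f hf)) = φ.comp C :=
  RingHom.ext fun a => congr($h (C a))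

theorem isUnit_toPolyLoc {E : Type u} [Field E] {f : E[X]} {hf : f ≠ 0} :
    IsUnit (toPolyLoc f hf f) := by
  have h1 : algebraMap E[X] (FractionRing E[X]) f ≠ 0 := by simpa using hf
  refine IsUnit.of_mul_eq_one ⟨(algebraMap E[X] (FractionRing E[X]) f)⁻¹, mem_polyLoc.2
    ⟨1, 1, by rw [map_one, one_mul, pow_one]⟩⟩ (Subtype.ext ?_)
  exact mul_inv_cancel₀ h1

theorem polyLoc_jointly_injective {κ K : Type u} [Field K] {f : K[X]} {hf : f ≠ 0} {T : Set K}
    (hT : T.Infinite) (θ : T → polyLoc f hf →+* K)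
    (hθ : ∀ s, (θ s).comp (toPolyLoc f hf) = evalRingHom (s : K)) {b : κ → polyLoc f hf}
    (hb : LinearIndependent K b) (s : Finset κ) (a : κ → K)
    (h : ∀ t, ∑ i ∈ s, a i * θ t (b i) = 0) : ∀ i ∈ s, a i = 0 := by
  refine linearIndependent_iff'.1 hb s a (polyLoc_eq_zero hT θ hθ fun t => ?_)
  rw [map_sum, ← h t]
  refine Finset.sum_congr rfl fun i _ => ?_
  rw [Algebra.smul_def, map_mul]
  congr 1
  exact congr($(polyLoc_comp_algebraMap (hθ t)) (a i)).trans eval_C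

/-- A family of morphisms depending rationally on a parameter which is equivariant at generic
parameters is equivariant. -/
theorem GaloisAct.act_comp_eq_of_polyLoc_family (htr : Cardinal.aleph0 ≤ Algebra.trdeg F K)
    (A : GaloisAct F p) (E : Type u) [Field E] [Algebra F E] [Algebra E K]
    [IsScalarTower F E K] {x : K}
    (hE : ∀ σ : K ≃ₐ[F] K, σ x = x → ∀ y : E, σ (algebraMap E K y) = algebraMap E K y)
    (hx : Transcendental F x) {Z : Scheme.{u}} [Z.IsSeparated] {i : Y ⟶ Z} {X : Scheme.{u}}
    {r : X ⟶ Spec (CommRingCat.of E)} {π : Y ⟶ X}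
    (hX : π ≫ r = p ≫ Spec.map (CommRingCat.ofHom (algebraMap E K)))
    {f : E[X]} {hf : f ≠ 0} (g : changeBase r (polyLoc f hf) ⟶ Z)
    (hg : ∀ (t : K) (θ : polyLoc f hf →+* K) (j : Y ⟶ changeBase r (polyLoc f hf))
        (σ : K ≃ₐ[F] K),
        Transcendental E t → θ.comp (toPolyLoc f hf) = (aeval t : E[X] →ₐ[E] K) →
        j ≫ changeBaseFst r _ = π →
        j ≫ changeBaseSnd r _ = p ≫ Spec.map (CommRingCat.ofHom θ) →
        σ x = t → j ≫ g = A.act σ ≫ i)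
    (t₀ : F) (ht₀ : aeval (algebraMap F K t₀) f ≠ 0) {θ₀ : polyLoc f hf →+* K}
    (hθ₀ : θ₀.comp (toPolyLoc f hf) = (aeval (algebraMap F K t₀) : E[X] →ₐ[E] K))
    {j₀ : Y ⟶ changeBase r (polyLoc f hf)} (hj₀1 : j₀ ≫ changeBaseFst r _ = π)
    (hj₀2 : j₀ ≫ changeBaseSnd r _ = p ≫ Spec.map (CommRingCat.ofHom θ₀)) (τ : K ≃ₐ[F] K) :
    A.act τ ≫ j₀ ≫ g = j₀ ≫ g := by
  -- Inverting `fb` makes the family defined at `s`, and inverting its twist `fa` makes it defined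
  -- at `τ⁻¹ s`. Over `K[X, 1/(fa * fb)]` both members can be compared.
  let fb : K[X] := f.map (algebraMap E K)
  let fa : K[X] := fb.map (τ : K →+* K)
  have hfb : fb ≠ 0 := (Polynomial.map_ne_zero_iff (algebraMap E K).injective).2 hf
  have hfa : fa ≠ 0 := (Polynomial.map_ne_zero_iff (τ : K →+* K).injective).2 hfb
  have hfab : fa * fb ≠ 0 := mul_ne_zero hfa hfb
  have hu : IsUnit (toPolyLoc (fa * fb) hfab (fa * fb)) := isUnit_toPolyLoc
  rw [map_mul, IsUnit.mul_iff] at hu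
  let φb : E[X] →+* K[X] := mapRingHom (algebraMap E K)
  let φa : E[X] →+* K[X] := (mapRingHom (τ : K →+* K)).comp φb
  have hφb : ∀ (s : K) (P : E[X]), eval s (φb P) = aeval s P := fun s P => eval_map_algebraMap P s
  have hφa : ∀ (s : K) (P : E[X]), τ.symm (eval s (φa P)) = aeval (τ.symm s) P := fun s P => by
    have h := eval_map_apply (p := φb P) (f := (τ : K →+* K)) (τ.symm s)
    rw [← hφb, AlgEquiv.symm_apply_eq]
    refine Eq.trans ?_ h
    exact congrArg (fun y => eval y (φa P)) (τ.apply_symm_apply s).symm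
  obtain ⟨βa, hβa⟩ := exists_polyLoc_lift (f := f) (hf := hf)
    ((toPolyLoc (fa * fb) hfab).comp φa) hu.1
  obtain ⟨βb, hβb⟩ := exists_polyLoc_lift (f := f) (hf := hf)
    ((toPolyLoc (fa * fb) hfab).comp φb) hu.2
  have hev : ∀ s : K, aeval s f ≠ 0 → aeval (τ.symm s) f ≠ 0 →
      ∃ θ : polyLoc (fa * fb) hfab →+* K, θ.comp (toPolyLoc _ _) = evalRingHom s := by
    intro s hs hs'
    refine exists_polyLoc_lift _ (IsUnit.mk0 _ ?_)
    rw [map_mul]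
    refine mul_ne_zero (fun h => hs' ?_) (fun h => hs ?_)
    · rw [← hφa, (show eval s (φa f) = 0 from h), map_zero]
    · rw [← hφb]
      exact h
  let W := changeBase p (polyLoc (fa * fb) hfab)
  have hc : ∀ (β : polyLoc f hf →+* polyLoc (fa * fb) hfab) (φ : E[X] →+* K[X]) (c : E →+* K),
      β.comp (toPolyLoc f hf) = (toPolyLoc (fa * fb) hfab).comp φ → (∀ y, φ (C y) = C (c y)) →
      changeBaseFst p (polyLoc (fa * fb) hfab) ≫ p ≫ Spec.map (CommRingCat.ofHom c) =
        (changeBaseSnd p (polyLoc (fa * fb) hfab) ≫ Spec.map (CommRingCat.ofHom β)) ≫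
          Spec.map (CommRingCat.ofHom (algebraMap E (polyLoc f hf))) := by
    intro β φ c h hφ
    rw [Category.assoc, ← Spec.map_comp, ← CommRingCat.ofHom_comp, ← Category.assoc,
      pullback.condition, Category.assoc, ← Spec.map_comp, ← CommRingCat.ofHom_comp]
    congr 3
    rw [polyLoc_comp_algebraMap h]
    refine RingHom.ext fun y => ?_
    change _ = toPolyLoc (fa * fb) hfab (φ (C y))
    rw [hφ]
    rfl
  -- At the parameter `s`, `a ≫ g` is `act τ` followed by the member of the family at `τ⁻¹ s`, while
  -- `b ≫ g` below is the member at `s`. Equivariance of the family is the equality of the two.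
  let a : W ⟶ changeBase r (polyLoc f hf) := pullback.lift
    (changeBaseFst p _ ≫ A.act τ ≫ π)
    (changeBaseSnd p _ ≫ Spec.map (CommRingCat.ofHom βa)) (by
      rw [Category.assoc, Category.assoc, hX, ← Category.assoc (A.act τ), A.act_over,
        Category.assoc p, ← Spec.map_comp, ← CommRingCat.ofHom_comp]
      exact hc βa φa _ hβa fun y => by simp [φa, φb])
  let b : W ⟶ changeBase r (polyLoc f hf) := pullback.lift
    (changeBaseFst p _ ≫ π)
    (changeBaseSnd p _ ≫ Spec.map (CommRingCat.ofHom βb)) (by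
      rw [Category.assoc, hX]
      exact hc βb φb _ hβb fun y => by simp [φb])
  have hab1 : a ≫ changeBaseFst r _ = changeBaseFst p _ ≫ A.act τ ≫ π := pullback.lift_fst _ _ _
  have hab2 : a ≫ changeBaseSnd r _ = changeBaseSnd p _ ≫ Spec.map (CommRingCat.ofHom βa) :=
    pullback.lift_snd _ _ _
  have hb1 : b ≫ changeBaseFst r _ = changeBaseFst p _ ≫ π := pullback.lift_fst _ _ _
  have hb2 : b ≫ changeBaseSnd r _ = changeBaseSnd p _ ≫ Spec.map (CommRingCat.ofHom βb) :=
    pullback.lift_snd _ _ _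
  have key : ∀ (s : K) (θ : polyLoc (fa * fb) hfab →+* K), θ.comp (toPolyLoc _ _) = evalRingHom s →
      ∃ (t : Y ⟶ W) (θa θb : polyLoc f hf →+* K), t ≫ changeBaseFst p _ = 𝟙 Y ∧
        t ≫ changeBaseSnd p _ = p ≫ Spec.map (CommRingCat.ofHom θ) ∧
        θa.comp (toPolyLoc f hf) = (aeval (τ.symm s) : E[X] →ₐ[E] K) ∧
        θb.comp (toPolyLoc f hf) = (aeval s : E[X] →ₐ[E] K) ∧
        (A.act τ⁻¹ ≫ t ≫ a) ≫ changeBaseFst r _ = π ∧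
        (A.act τ⁻¹ ≫ t ≫ a) ≫ changeBaseSnd r _ = p ≫ Spec.map (CommRingCat.ofHom θa) ∧
        (t ≫ b) ≫ changeBaseFst r _ = π ∧
        (t ≫ b) ≫ changeBaseSnd r _ = p ≫ Spec.map (CommRingCat.ofHom θb) := by
    intro s θ hθ
    let t : Y ⟶ W := pullback.lift (𝟙 Y) (p ≫ Spec.map (CommRingCat.ofHom θ)) (by
      rw [Category.assoc, ← Spec.map_comp, ← CommRingCat.ofHom_comp, polyLoc_comp_algebraMap hθ]
      have h : (evalRingHom s).comp C = RingHom.id K := RingHom.ext fun y => eval_C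
      rw [h, CommRingCat.ofHom_id, Spec.map_id, Category.id_comp, Category.comp_id])
    have ht1 : t ≫ changeBaseFst p _ = 𝟙 Y := pullback.lift_fst _ _ _
    have ht2 : t ≫ changeBaseSnd p _ = p ≫ Spec.map (CommRingCat.ofHom θ) := pullback.lift_snd _ _ _
    have hinv : A.act τ⁻¹ ≫ A.act τ = 𝟙 Y := by rw [← A.act_mul, inv_mul_cancel, A.act_one]
    refine ⟨t, ((τ.symm : K →+* K).comp θ).comp βa, θ.comp βb, ht1, ht2, ?_, ?_, ?_, ?_, ?_, ?_⟩
    · exact RingHom.ext fun P => congr(τ.symm (θ ($hβa P))).trans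
        (congr(τ.symm ($hθ (φa P))).trans (hφa s P))
    · exact RingHom.ext fun P => congr(θ ($hβb P)).trans (congr($hθ (φb P)).trans (hφb s P))
    · rw [Category.assoc, Category.assoc, hab1, reassoc_of% ht1, reassoc_of% hinv]
    · have h := A.act_over τ⁻¹
      rw [Category.assoc, Category.assoc, hab2, reassoc_of% ht2, reassoc_of% h,
        ← Spec.map_comp, ← Spec.map_comp, ← CommRingCat.ofHom_comp, ← CommRingCat.ofHom_comp]
    · rw [Category.assoc, hb1, reassoc_of% ht1]
    · rw [Category.assoc, hb2, reassoc_of% ht2, ← Spec.map_comp, ← CommRingCat.ofHom_comp]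
  have hne : ∀ s : K, Transcendental E s → aeval s f ≠ 0 := fun s hs h =>
    hf (transcendental_iff.1 hs f h)
  -- For `s` in `T`, both `s` and `τ⁻¹ s` are generic: if `σ x = τ⁻¹ s`, the members there are the
  -- conjugates of `i` by `τ * σ` and `σ`, so equivariance holds. Evaluations at the infinite set
  -- `T` are jointly injective.
  let T := {s : K | Transcendental (IntermediateField.adjoin F {x}) s ∧
      Transcendental (IntermediateField.adjoin F {x}) (τ.symm s)}
  have hT : T.Infinite := infinite_transcendental_conjugates htr x τ
  have hT1 : ∀ s : T, Transcendental E (s : K) := fun s =>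
    transcendental_of_forall_mem (forall_mem_adjoin_of_fixed hE) s.2.1
  have hT2 : ∀ s : T, Transcendental E (τ.symm s) := fun s =>
    transcendental_of_forall_mem (forall_mem_adjoin_of_fixed hE) s.2.2
  choose θ hθ using fun s : T => hev s (hne _ (hT1 s)) (hne _ (hT2 s))
  choose t θa θb ht1 ht2 hθa hθb ha1 ha2 hb1 hb2 using fun s : T => key s (θ s) (hθ s)
  have hact : A.act τ ≫ A.act τ⁻¹ = 𝟙 Y := by rw [← A.act_mul, mul_inv_cancel, A.act_one]
  have hgen : ∀ s, t s ≫ a ≫ g = t s ≫ b ≫ g := by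
    intro s
    have hsF : Transcendental F (τ.symm s) := s.2.2.restrictScalars (algebraMap F _).injective
    obtain ⟨σ, hσ⟩ := exists_algEquiv_apply_eq_of_transcendental hx hsF
    have h1 := hg _ _ _ σ (hT2 s) (hθa s) (ha1 s) (ha2 s) hσ
    have h2 := hg _ _ _ (τ * σ) (hT1 s) (hθb s) (hb1 s) (hb2 s) (by
      change τ (σ x) = s
      rw [hσ, AlgEquiv.apply_symm_apply])
    rw [A.act_mul] at h2
    simp only [Category.assoc] at h1 h2
    rw [← h1, reassoc_of% hact] at h2
    exact h2.symm
  have hab : a ≫ g = b ≫ g := by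
    have H : IsPullback (changeBaseFst p (polyLoc (fa * fb) hfab))
        (changeBaseSnd p (polyLoc (fa * fb) hfab))
        (p ≫ Spec.map (CommRingCat.ofHom (algebraMap K K)))
        (Spec.map (CommRingCat.ofHom (algebraMap K (polyLoc (fa * fb) hfab)))) := by
      rw [Algebra.algebraMap_self, CommRingCat.ofHom_id, Spec.map_id, Category.comp_id]
      exact IsPullback.of_hasPullback _ _
    exact hom_ext_of_sections (Module.Basis.ofVectorSpace K (polyLoc (fa * fb) hfab)) θ
      (polyLoc_jointly_injective hT θ hθ
        (Module.Basis.ofVectorSpace K (polyLoc (fa * fb) hfab)).linearIndependent)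
      H t ht1 ht2 hgen
  -- At `t₀` in `F` the parameters `t₀` and `τ⁻¹ t₀` coincide, so equivariance becomes invariance.
  have htt : aeval (τ.symm (algebraMap F K t₀)) f ≠ 0 := by
    rw [AlgEquiv.commutes]
    exact ht₀
  obtain ⟨θ', hθ'⟩ := hev _ ht₀ htt
  obtain ⟨t', θa', θb', -, -, hθa', hθb', ha1', ha2', hb1', hb2'⟩ := key _ θ' hθ'
  rw [AlgEquiv.commutes] at hθa'
  have e1 : A.act τ⁻¹ ≫ t' ≫ a = j₀ := by
    apply pullback.hom_ext
    · exact ha1'.trans hj₀1.symm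
    · refine ha2'.trans (Eq.trans ?_ hj₀2.symm)
      rw [polyLoc_hom_ext (hθa'.trans hθ₀.symm)]
  have e2 : t' ≫ b = j₀ := by
    apply pullback.hom_ext
    · exact hb1'.trans hj₀1.symm
    · refine hb2'.trans (Eq.trans ?_ hj₀2.symm)
      rw [polyLoc_hom_ext (hθb'.trans hθ₀.symm)]
  calc A.act τ ≫ j₀ ≫ g = (A.act τ ≫ A.act τ⁻¹) ≫ t' ≫ a ≫ g := by
        rw [← e1]
        simp only [Category.assoc]
    _ = (t' ≫ b) ≫ g := by rw [hact, Category.id_comp, hab, Category.assoc]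
    _ = j₀ ≫ g := by rw [e2]

theorem exists_aeval_ne_zero {E : Type u} [Field E] [Algebra F E] [Algebra E K]
    [IsScalarTower F E K] {f : E[X]} (hf : f ≠ 0) : ∃ t : F, aeval (algebraMap F K t) f ≠ 0 := by
  classical
  obtain ⟨_, ⟨t, rfl⟩, ht⟩ := (Set.infinite_range_of_injective
    (algebraMap F E).injective).exists_notMem_finset f.roots.toFinset
  refine ⟨t, fun h => ht ?_⟩
  rw [Multiset.mem_toFinset, mem_roots hf, IsRoot.def]
  rwa [IsScalarTower.algebraMap_apply F E K, aeval_algebraMap_apply,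
    map_eq_zero_iff _ (algebraMap E K).injective, aeval_def, Algebra.algebraMap_self, eval₂_id] at h

/-- A specialization of the generic conjugate of an affine morphism that is invariant over a purely
transcendental extension `E = F(x)`. -/
theorem GaloisAct.hasAffineHom_of_transcendental (htr : Cardinal.aleph0 ≤ Algebra.trdeg F K)
    (A : GaloisAct F p) (E : Type u) [Field E] [Algebra F E] [Algebra 𝕜 E] [Algebra E K]
    [IsScalarTower F E K] [IsScalarTower 𝕜 E K] (x : K)
    (hE : ∀ σ : K ≃ₐ[F] K, σ x = x → ∀ y : E, σ (algebraMap E K y) = algebraMap E K y)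
    (hx : Transcendental F x) (h : (A.restrict E).HasAffineHom 𝕜) (hM : (A.restrict E).HasModel) :
    A.HasAffineHom 𝕜 := by
  obtain ⟨ι, _, i, _, hi0, hi⟩ := h
  obtain ⟨X, r, π, κ, _, e, hX, he0, _⟩ := hM
  have : NoetherianSpace X := e.isEmbedding.isInducing.noetherianSpace
  have hXs : IsSeparated r := by rw [← he0]; infer_instance
  have hXs' : X.IsSeparated := ⟨by
    rw [← terminal.comp_from r]; infer_instance⟩
  have hsep : (PSpace 𝕜 ι).IsSeparated := ⟨by
    rw [← terminal.comp_from (PSpace.str 𝕜 ι)]; infer_instance⟩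
  obtain ⟨f, hf, g, hg, hg0, H⟩ := A.exists_polyLoc_family htr E hE hx hi0 hi hX
  -- The field `F` is infinite, so it contains a point at which `f` does not vanish.
  obtain ⟨t₀, ht₀⟩ := exists_aeval_ne_zero (F := F) (K := K) hf
  obtain ⟨θ₀, hθ₀⟩ := exists_polyLoc_lift (f := f) (hf := hf)
    (aeval (algebraMap F K t₀) : E[X] →ₐ[E] K).toRingHom (IsUnit.mk0 _ ht₀)
  let j₀ : Y ⟶ changeBase r (polyLoc f hf) := pullback.lift π
    (p ≫ Spec.map (CommRingCat.ofHom θ₀)) (by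
      rw [hX.isPullback.w, Category.assoc, ← Spec.map_comp, ← CommRingCat.ofHom_comp,
        polyLoc_comp_algebraMap hθ₀]
      congr 3
      exact RingHom.ext fun y => (aeval_C _ y).symm)
  have hj1 : j₀ ≫ changeBaseFst r _ = π := pullback.lift_fst _ _ _
  have hj2 : j₀ ≫ changeBaseSnd r _ = p ≫ Spec.map (CommRingCat.ofHom θ₀) := pullback.lift_snd _ _ _
  have hj : IsAffineHom j₀ := by
    have := hX.isAffineHom
    have : IsAffineHom (j₀ ≫ changeBaseFst r (polyLoc f hf)) := by rwa [hj1]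
    have : IsAffineHom (changeBaseFst r (polyLoc f hf)) := isAffineHom_changeBaseFst r _
    exact IsAffineHom.of_comp _ (changeBaseFst r (polyLoc f hf))
  refine ⟨ι, inferInstance, j₀ ≫ g, inferInstance, ?_, fun τ =>
    A.act_comp_eq_of_polyLoc_family htr E hE hx hX.isPullback.w g H t₀ ht₀ hθ₀ hj1 hj2 τ⟩
  rw [Category.assoc, hg0, reassoc_of% hj1, ← Category.assoc, hX.isPullback.w, Category.assoc,
    ← Spec.map_comp, ← CommRingCat.ofHom_comp, ← IsScalarTower.algebraMap_eq]

end Specialization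

/-! ### Descent to the base field, one generator at a time -/

section Descent

attribute [local instance] MvPolynomial.gradedAlgebra

variable {𝕜 F K : Type u} [Field 𝕜] [Field F] [Field K] [Algebra 𝕜 F] [Algebra 𝕜 K]
  [Algebra F K] [IsScalarTower 𝕜 F K] [CharZero 𝕜]
  [IsAlgClosed K] {Y : Scheme.{u}} {p : Y ⟶ Spec (CommRingCat.of K)}

/-- The two properties are carried together: the transcendental case of the affine morphism uses the
model over `E`, and the model over `F` is then built from the new affine morphism. -/
theorem GaloisAct.IsGood.of_simple (htr : Cardinal.aleph0 ≤ Algebra.trdeg F K)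
    (A : GaloisAct F p) [LocallyOfFiniteType p] (E : Type u) [Field E] [Algebra F E] [Algebra 𝕜 E]
    [Algebra E K] [IsScalarTower F E K] [IsScalarTower 𝕜 E K] (x : K)
    (hE : ∀ σ : K ≃ₐ[F] K, σ x = x → ∀ y : E, σ (algebraMap E K y) = algebraMap E K y)
    (h : (A.restrict E).IsGood 𝕜) : A.IsGood 𝕜 := by
  have : CharZero F := charZero_of_injective_algebraMap (algebraMap 𝕜 F).injective
  have h1 : A.HasAffineHom 𝕜 := by
    by_cases hx : IsAlgebraic F x
    · exact A.hasAffineHom_of_isAlgebraic E x hE hx h.1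
    · exact A.hasAffineHom_of_transcendental htr E x hE hx h.1 h.2
  exact ⟨h1, A.hasModel_of_simple htr E x hE h1 h.2⟩

theorem apply_eq_of_mem_adjoin {F K : Type u} [Field F] [Field K] [Algebra F K] {S : Set K}
    (σ : K ≃ₐ[F] K) (hS : ∀ s ∈ S, σ s = s) {y : K} (hy : y ∈ IntermediateField.adjoin F S) :
    σ y = y := by
  induction hy using IntermediateField.adjoin_induction with
  | mem x hx => exact hS x hx
  | algebraMap a => exact σ.commutes a
  | add x y _ _ hx hy => rw [map_add, hx, hy]
  | inv x _ hx => rw [map_inv₀, hx]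
  | mul x y _ _ hx hy => rw [map_mul, hx, hy]

theorem GaloisAct.IsGood.of_adjoin_insert (htr : Cardinal.aleph0 ≤ Algebra.trdeg 𝕜 K)
    (A : GaloisAct 𝕜 p) [LocallyOfFiniteType p] (S : Finset K) (T : Set K) (x : K)
    (hT : T = insert x (S : Set K))
    (h : (A.restrict (IntermediateField.adjoin 𝕜 T)).IsGood 𝕜) :
    (A.restrict (IntermediateField.adjoin 𝕜 (S : Set K))).IsGood 𝕜 := by
  have hle : IntermediateField.adjoin 𝕜 (S : Set K) ≤ IntermediateField.adjoin 𝕜 T :=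
    IntermediateField.adjoin.mono _ _ _ (hT ▸ Set.subset_insert _ _)
  let _ : Algebra (IntermediateField.adjoin 𝕜 (S : Set K)) (IntermediateField.adjoin 𝕜 T) :=
    (IntermediateField.inclusion hle).toRingHom.toAlgebra
  have : IsScalarTower (IntermediateField.adjoin 𝕜 (S : Set K)) (IntermediateField.adjoin 𝕜 T) K :=
    IsScalarTower.of_algebraMap_eq fun _ => rfl
  refine IsGood.of_simple (aleph0_le_trdeg_of_fg htr ⟨S, rfl⟩) _ (IntermediateField.adjoin 𝕜 T) x
    (fun σ hσ y => ?_) h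
  refine apply_eq_of_mem_adjoin (σ.restrictScalars 𝕜) (fun s hs => ?_) y.2
  rw [hT] at hs
  obtain rfl | hs := hs
  · exact hσ
  · exact σ.commutes ⟨s, IntermediateField.subset_adjoin _ _ hs⟩

theorem GaloisAct.IsGood.of_adjoin_finset (htr : Cardinal.aleph0 ≤ Algebra.trdeg 𝕜 K)
    (A : GaloisAct 𝕜 p) [LocallyOfFiniteType p] (S : Finset K)
    (h : (A.restrict (IntermediateField.adjoin 𝕜 (S : Set K))).IsGood 𝕜) : A.IsGood 𝕜 := by
  classical
  induction S using Finset.induction_on with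
  | empty =>
    -- Adjoining nothing is treated as adjoining the dummy element `0`, in order to pass from the
    -- bottom intermediate field to `𝕜` itself.
    refine IsGood.of_simple htr A (IntermediateField.adjoin 𝕜 ((∅ : Finset K) : Set K)) 0
      (fun σ _ y => apply_eq_of_mem_adjoin σ (fun s hs => ?_) y.2) h
    simp at hs
  | insert x S _ ih => exact ih (IsGood.of_adjoin_insert htr A S _ x (Finset.coe_insert _ _) h)

/-- A continuous descent datum on a quasi-projective scheme has a quasi-projective model. -/
theorem DescentDatum.IsContinuous.hasModel {k : Type u} [Field k] [CharZero k] [Algebra k K]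
    (htr : Cardinal.aleph0 ≤ Algebra.trdeg k K) {Y : Over (Spec (CommRingCat.of K))}
    {φ : DescentDatum k Y} (hφ : φ.IsContinuous) (hY : IsQuasiProjective Y) :
    φ.galoisAct.HasModel := by
  obtain ⟨S, hS⟩ := hφ.exists_isGood hY
  have : LocallyOfFiniteType Y.hom := by
    obtain ⟨m, q, hq⟩ := hY
    rw [← Over.w q]
    have : LocallyOfFiniteType (projectiveSpace K m).hom :=
      inferInstanceAs (LocallyOfFiniteType (PSpace.str K (Fin (m + 1))))
    infer_instance
  exact (GaloisAct.IsGood.of_adjoin_finset htr _ S hS).2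

end Descent

/-! ### Independence of projective space from the indexing of its coordinates -/

section Reindexing

attribute [local instance] MvPolynomial.gradedAlgebra

variable {L : Type u} [Field L] {ι κ : Type} {Y : Scheme.{u}}

theorem exists_reindex (s : κ ≃ ι) : ∃ ψ : PSpace L ι ⟶ PSpace L κ,
    ψ ≫ PSpace.str L κ = PSpace.str L ι ∧ (∀ a, ψ ⁻¹ᵁ chart L a = chart L (s a)) ∧
      ∀ a b a' b', a' = s a → b' = s b → ∀ (V : (PSpace L ι).Opens) (h : V ≤ ψ ⁻¹ᵁ chart L a)
        (h' : V ≤ (𝟙 (PSpace L ι)) ⁻¹ᵁ chart L a'),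
        res h (ratio ψ a b) = res h' (ratio (𝟙 (PSpace L ι)) a' b') := by
  have h1 : ∀ a : ι, (𝟙 (PSpace L ι)) ⁻¹ᵁ chart L a = chart L a := fun a => Scheme.Hom.id_preimage _
  obtain ⟨ψ, h0, hpre, hval⟩ := exists_hom_of_ratios (L := L) (ι := κ)
    (fun a : κ => (𝟙 (PSpace L ι)) ⁻¹ᵁ chart L (s a)) (by
      rw [← iSup_preimage_chart (𝟙 (PSpace L ι))]
      exact s.iSup_congr fun _ => rfl)
    (PSpace.str L ι) id (fun a b => ratio (𝟙 (PSpace L ι)) (s a) (s b)) (fun a => ratio_self _ _)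
    (fun a a' b => (res_ratio_mul _ _ _ _ _ _).symm) fun a a' => basicOpen_ratio_le _ _ _
  refine ⟨ψ, h0, hpre, ?_⟩
  rintro a b _ _ rfl rfl V h h'
  rw [← hval a (hpre a).ge b, res_res]
  rfl

theorem exists_isIso_reindex (s : κ ≃ ι) : ∃ ψ : PSpace L ι ⟶ PSpace L κ,
    ψ ≫ PSpace.str L κ = PSpace.str L ι ∧ IsIso ψ := by
  have key : ∀ {ι κ : Type} (s : κ ≃ ι) (ψ : PSpace L ι ⟶ PSpace L κ)
      (ψ' : PSpace L κ ⟶ PSpace L ι), ψ ≫ PSpace.str L κ = PSpace.str L ι →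
      ψ' ≫ PSpace.str L ι = PSpace.str L κ → (∀ a, ψ ⁻¹ᵁ chart L a = chart L (s a)) →
      (∀ a b a' b', a' = s a → b' = s b → ∀ (V : (PSpace L ι).Opens)
        (h : V ≤ ψ ⁻¹ᵁ chart L a) (h' : V ≤ (𝟙 (PSpace L ι)) ⁻¹ᵁ chart L a'),
        res h (ratio ψ a b) = res h' (ratio (𝟙 (PSpace L ι)) a' b')) →
      (∀ a, ψ' ⁻¹ᵁ chart L a = chart L (s.symm a)) →
      (∀ a b a' b', a' = s.symm a → b' = s.symm b → ∀ (V : (PSpace L κ).Opens)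
        (h : V ≤ ψ' ⁻¹ᵁ chart L a) (h' : V ≤ (𝟙 (PSpace L κ)) ⁻¹ᵁ chart L a'),
        res h (ratio ψ' a b) = res h' (ratio (𝟙 (PSpace L κ)) a' b')) →
      ψ ≫ ψ' = 𝟙 _ := by
    intro ι κ s ψ ψ' h0 h0' hpre hval hpre' hval'
    refine hom_ext_of_iSup_eq_top _ (iSup_chart (L := L) (ι := ι)) fun b => ?_
    obtain ⟨a, rfl⟩ := s.surjective b
    have h1 : chart L a ≤ ψ' ⁻¹ᵁ chart L (s a) := by rw [hpre', s.symm_apply_apply]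
    have h2 : chart L (s a) ≤ ψ ⁻¹ᵁ chart L a := (hpre a).ge
    have h3 : chart L (s a) ≤ ψ ⁻¹ᵁ ψ' ⁻¹ᵁ chart L (s a) := h2.trans (ψ.preimage_mono h1)
    have h4 : chart L (s a) ≤ (ψ ≫ ψ') ⁻¹ᵁ chart L (s a) := h3
    have h5 : chart L (s a) ≤ (𝟙 (PSpace L ι)) ⁻¹ᵁ chart L (s a) := le_rfl
    refine ι_comp_eq_of_ratio (by rw [Category.assoc, h0', h0, Category.id_comp]) (s a) h4 h5
      fun c => ?_
    have h6 : chart L a ≤ (𝟙 (PSpace L κ)) ⁻¹ᵁ chart L a := le_rfl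
    rw [← appLE_ratio rfl (s a) c h3 h4, ← appLE_res ψ h1 h2,
      hval' (s a) c a (s.symm c) (s.symm_apply_apply a).symm rfl _ h1 h6, appLE_res ψ h6 h2,
      appLE_ratio (Category.comp_id ψ) a (s.symm c) _ h2]
    exact hval a (s.symm c) (s a) c rfl (s.apply_symm_apply c).symm _ h2 h5
  obtain ⟨ψ, h0, hpre, hval⟩ := exists_reindex (L := L) s
  obtain ⟨ψ', h0', hpre', hval'⟩ := exists_reindex (L := L) s.symm
  exact ⟨ψ, h0, ψ', key s ψ ψ' h0 h0' hpre hval hpre' hval',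
    key s.symm ψ' ψ h0' h0 hpre' hval' hpre hval⟩

end Reindexing

/-! ### Models and effectivity; uniqueness of models -/

section Effectivity

variable {k K : Type u} [Field k] [Field K] [Algebra k K] {Y : Over (Spec (CommRingCat.of K))}
  {φ : DescentDatum k Y}

theorem DescentDatum.galoisAct_act (σ : K ≃ₐ[k] K) :
    φ.galoisAct.act σ = (show Y.left ⟶ Y.left from (φ.iso σ⁻¹).hom.left) := φ.schemeIso_hom σ⁻¹

theorem DescentDatum.comesFrom_of_isModel {X : Scheme.{u}} {r : X ⟶ Spec (CommRingCat.of k)}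
    {π : Y.left ⟶ X} (h : φ.galoisAct.IsModel r π) : φ.ComesFrom (Over.mk r) := by
  let c : Y.left ⟶ (baseChange K (Over.mk r)).left := h.isPullback.isoPullback.hom
  have hc : IsIso c := inferInstanceAs (IsIso h.isPullback.isoPullback.hom)
  have hc1 : c ≫ pullback.fst r _ = π := h.isPullback.isoPullback_hom_fst
  have hc2 : c ≫ pullback.snd r _ = Y.hom := h.isPullback.isoPullback_hom_snd
  let e : Y ≅ baseChange K (Over.mk r) := Over.isoMk (asIso c) hc2
  have key : ∀ σ, φ.galoisAct.act σ ≫ c = c ≫ baseChangeAut (Over.mk r) σ := by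
    intro σ
    refine pullback.hom_ext ?_ ?_
    · refine ((Category.assoc _ _ _).trans (congrArg _ hc1)).trans ((h.act_comp σ).trans ?_)
      refine Eq.trans ?_ (Category.assoc _ _ _).symm
      exact hc1.symm.trans (congrArg (c ≫ ·) (baseChangeAut_fst (K := K) (Over.mk r) σ).symm)
    · refine ((Category.assoc _ _ _).trans (congrArg _ hc2)).trans
        ((φ.galoisAct.act_over σ).trans ?_)
      refine Eq.trans ?_ (Category.assoc _ _ _).symm
      refine Eq.trans ?_ (congrArg (c ≫ ·) (baseChangeAut_snd (K := K) (Over.mk r) σ).symm)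
      exact (congrArg (· ≫ specAut σ) hc2).symm.trans (Category.assoc _ _ _)
  refine ⟨e.symm, fun σ => ?_⟩
  have h1 : ((ofBaseChange K (Over.mk r)).iso σ).hom.left = baseChangeAut (Over.mk r) σ⁻¹ :=
    Category.id_comp _
  have h2 : (φ.iso σ).hom.left = φ.galoisAct.act σ⁻¹ := by
    rw [galoisAct_act, inv_inv]
  have h3 : baseChangeAut (Over.mk r) σ⁻¹ ≫ inv c = inv c ≫ φ.galoisAct.act σ⁻¹ :=
    (IsIso.eq_inv_comp c).2 ((Category.assoc _ _ _).symm.trans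
      ((congrArg (· ≫ inv c) (key σ⁻¹).symm).trans ((Category.assoc _ _ _).trans
      ((congrArg _ (IsIso.hom_inv_id c)).trans (Category.comp_id _)))))
  ext1
  exact (congrArg (· ≫ inv c) h1).trans (h3.trans (congrArg (inv c ≫ ·) h2.symm))

theorem DescentDatum.ComesFrom.exists_isModel {X : Over (Spec (CommRingCat.of k))}
    (h : φ.ComesFrom X) : ∃ π : Y.left ⟶ X.left, φ.galoisAct.IsModel X.hom π := by
  obtain ⟨e, he⟩ := h
  let c : (baseChange K X).left ≅ Y.left := (Over.forget _).mapIso e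
  have hc2 : c.inv ≫ pullback.snd X.hom _ = Y.hom := Over.w e.inv
  have key : ∀ σ, baseChangeAut X σ ≫ c.hom = c.hom ≫ φ.galoisAct.act σ := by
    intro σ
    have h1 : (𝟙 _ ≫ baseChangeAut X (σ⁻¹)⁻¹) ≫ c.hom = c.hom ≫ (φ.iso σ⁻¹).hom.left :=
      congrArg CommaMorphism.left (he σ⁻¹)
    rw [Category.id_comp, inv_inv] at h1
    rw [galoisAct_act]
    exact h1
  refine ⟨c.inv ≫ pullback.fst _ _, ?_, fun σ => ?_⟩
  · exact (IsPullback.of_hasPullback X.hom _).of_iso c (Iso.refl _) (Iso.refl _) (Iso.refl _)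
      (by simp) (by simp [← hc2]) (by simp) (by simp)
  · have h2 : φ.galoisAct.act σ ≫ c.inv = c.inv ≫ baseChangeAut X σ := by
      rw [Iso.comp_inv_eq, Category.assoc, key, Iso.inv_hom_id_assoc]
    refine (Category.assoc _ _ _).symm.trans ((congrArg (· ≫ pullback.fst _ _) h2).trans ?_)
    exact (Category.assoc _ _ _).trans (congrArg (c.inv ≫ ·) (baseChangeAut_fst (K := K) X σ))

/-- Two models are isomorphic. -/
theorem GaloisAct.IsModel.exists_iso [CharZero k] [IsAlgClosed K] {Y : Scheme.{u}}
    {p : Y ⟶ Spec (CommRingCat.of K)} {A : GaloisAct k p} {X X' : Scheme.{u}}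
    {r : X ⟶ Spec (CommRingCat.of k)} {r' : X' ⟶ Spec (CommRingCat.of k)} {π : Y ⟶ X} {π' : Y ⟶ X'}
    (h : A.IsModel r π) (h' : A.IsModel r' π') [X'.IsSeparated] :
    ∃ g : X ⟶ X', IsIso g ∧ g ≫ r' = r := by
  obtain ⟨g, hg⟩ := h.exists_desc π' h'.act_comp
  have hgr : g ≫ r' = r := by
    refine h.desc_unique ?_
    rw [reassoc_of% hg, h'.isPullback.w, h.isPullback.w]
  refine ⟨g, ?_, hgr⟩
  -- After base change along `π'` the comparison map `g` becomes the identity of `Y`, and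
  -- isomorphisms descend along faithfully flat quasi-compact maps.
  have H : IsPullback (𝟙 Y) π π' g := by
    refine IsPullback.of_right (h₁₂ := p) (v₁₃ := Spec.map (CommRingCat.ofHom (algebraMap k K)))
      (h₂₂ := r') ?_ (by rw [hg, Category.id_comp]) h'.isPullback.flip
    rw [hgr, Category.id_comp]
    exact h.isPullback.flip
  have := h'.flat
  have := h'.surjective
  have := h'.isAffineHom
  exact MorphismProperty.of_isPullback_of_descendsAlong (P := .isomorphisms Scheme.{u})
    (Q := @Surjective ⊓ @Flat ⊓ @QuasiCompact) H ⟨⟨‹_›, ‹_›⟩, inferInstance⟩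
    (show IsIso (𝟙 Y) by infer_instance)

end Effectivity

/-! ### Quasi-projectivity from an immersion with arbitrary coordinates -/

section QuasiProjective

attribute [local instance] MvPolynomial.gradedAlgebra

theorem isQuasiProjective_of_isImmersion {F : Type u} [Field F] {κ : Type} [Finite κ]
    (X : Over (Spec (CommRingCat.of F))) (i : X.left ⟶ PSpace F κ) [IsImmersion i]
    (hi : i ≫ PSpace.str F κ = X.hom) : IsQuasiProjective X := by
  -- `projectiveSpace F n` has `n + 1` coordinates, so an empty index type needs the separate remark
  -- that `X` is then empty.
  rcases isEmpty_or_nonempty κ with hκ | hκ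
  · have hX : IsEmpty X.left := ⟨fun y => by
      have h3 : i y ∈ ⨆ b : κ, chart F b := by rw [iSup_chart]; trivial
      obtain ⟨b, -⟩ := Opens.mem_iSup.1 h3
      exact isEmptyElim b⟩
    let j : X.left ⟶ (projectiveSpace F 0).left := (isInitialOfIsEmpty (X := X.left)).to _
    exact ⟨0, Over.homMk j ((isInitialOfIsEmpty (X := X.left)).hom_ext _ _),
      show IsImmersion j from inferInstance⟩
  · obtain ⟨n, ⟨s⟩⟩ : ∃ n : ℕ, Nonempty (κ ≃ Fin (n + 1)) :=
      ⟨Nat.card κ - 1, ⟨(Finite.equivFin κ).trans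
        (finCongr (Nat.succ_pred_eq_of_pos Nat.card_pos).symm)⟩⟩
    obtain ⟨ψ, h0, hψ⟩ := exists_isIso_reindex (L := F) s.symm
    have h1 : IsImmersion (i ≫ ψ) := inferInstance
    exact ⟨n, Over.homMk (i ≫ ψ) (by
      refine (Category.assoc _ _ _).trans (Eq.trans (congrArg (i ≫ ·) h0) hi)), h1⟩

instance {F : Type u} [Field F] {κ : Type} : (PSpace F κ).IsSeparated :=
  ⟨by rw [← terminal.comp_from (PSpace.str F κ)]; infer_instance⟩

end QuasiProjective

end WeilDescent

theorem mainTheorem4 {k K : Type u} [Field k] [CharZero k] [Field K] [IsAlgClosed K]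
    [Algebra k K] (htr : Cardinal.aleph0 ≤ Algebra.trdeg k K)
    (Y : Over (Spec (CommRingCat.of K))) (hY : WeilDescent.IsQuasiProjective Y)
    (φ : WeilDescent.DescentDatum k Y) (hφ : φ.IsContinuous) :
    φ.IsEffective ∧
      ∀ X : Over (Spec (CommRingCat.of k)), φ.ComesFrom X →
        WeilDescent.IsQuasiProjective X ∧
        (IsAffine Y.left → IsAffine X.left) ∧
        (Y.left.IsQuasiAffine → X.left.IsQuasiAffine) := by
  obtain ⟨X', r', π', κ, hκ, e', h', he', he''⟩ := hφ.hasModel htr hY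
  refine ⟨⟨_, WeilDescent.DescentDatum.comesFrom_of_isModel h'⟩, fun X hX => ?_⟩
  obtain ⟨π, h⟩ := hX.exists_isModel
  have hs' : X'.IsSeparated := ⟨by rw [← terminal.comp_from e']; infer_instance⟩
  -- Only the target `X'` must be separated. The given `X` is arbitrary and acquires all its
  -- properties through this isomorphism.
  obtain ⟨g, hg, hgr⟩ := h.exists_iso h'
  have hi : IsImmersion (g ≫ e') := inferInstance
  have hX : WeilDescent.IsQuasiProjective X :=
    WeilDescent.isQuasiProjective_of_isImmersion X (g ≫ e') (by rw [Category.assoc, he', hgr])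
  have hs : X.left.IsSeparated := ⟨by rw [← terminal.comp_from (g ≫ e')]; infer_instance⟩
  have hc : NoetherianSpace X.left := (g ≫ e').isEmbedding.isInducing.noetherianSpace
  exact ⟨hX, fun _ => WeilDescent.isAffine_of_isPullback h.isPullback,
    fun _ => WeilDescent.isQuasiAffine_of_isPullback h.isPullback⟩
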